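/- \textbf{Setting.} Fix a field $\mathbb{K}$ of characteristic $0$; all vector spaces are $\mathbb{Z}$-graded, $s$ denotes the Koszul swap $s(u\otimes v)=(-1)^{|u||v|}v\otimes u$. For homogeneous $x_1,\dots,x_i\in\mathfrak{g}$, $\sum_{(a,b)}\varepsilon$ denotes the sum over all shuffles $\sigma$ splitting $(x_1,\dots,x_i)$ into $a=(x_{\sigma(1)},\dots,x_{\sigma(p)})$ and $b=(x_{\sigma(p+1)},\dots,x_{\sigma(i)})$, $p+q=i$ (all $p,q\ge 0$ unless said otherwise), and $\varepsilon$ is $\mathrm{sgn}(\sigma)$ times the Koszul sign of $\sigma$; $|a|$ is the total degree of $a$. A \emph{homotopy Lie algebra} is a graded vector space $\mathfrak g$ with graded skew-symmetric maps $\ell^i:\bigwedge^i\mathfrak g\to\mathfrak g[2-i]$, $i\ge1$, such that $\sum_{(a,b),\,p\geq1}\varepsilon(-1)^{q}\,\ell^{q+1}(\ell^{p}(a),b)=0$ for all $x_1,\dots,x_i$. Put $\pi_1^i:=(-1)^{i-1}\ell^i$. A \emph{2-shifted Poisson structure} in $\mathfrak g$ is a family of graded skew-symmetric maps $\pi_w^i:\bigwedge^i\mathfrak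 g\to(\mathrm{Sym}^w\mathfrak g)[4-2w-i]$, $w\ge2$, $i\ge0$, where $\mathrm{Sym}^w\mathfrak g\subseteq\mathfrak g^{\otimes w}$ is the space of graded symmetric tensors, such that for all $w\ge2$, $i\ge0$ $$\sum_{(w_1-1)+w_2=w}\ \sum_{(j-1)+k=i}(-1)^{j(k-1)}\,\Sigma^+_{w_1,w_2-1}\,[\pi^j_{w_1}\otimes1_{\mathfrak g^{\otimes(w_2-1)}}]\,[1_{\mathfrak g^{\otimes(j-1)}}\otimes\pi_{w_2}^k]\,\Sigma_{j-1,k}=0,$$ where $w_1,w_2\geq1$, $\Sigma_{j-1,k}$ is the signed sum over shuffles of the inputs, $\Sigma^+$ is the symmetrising (Koszul-signed) shuffle product $\mathfrak g^{\otimes w_1}\otimes\mathfrak g^{\otimes (w_2-1)}\to\mathfrak g^{\otimes w}$, and $\pi_1^0:=0$. An \emph{intertwiner} $f:U\rightsquigarrow V[n]$ is a family of maps $f^{k+1}:\bigwedge^k\mathfrak g\otimes U\to V[n-k]$, $k\ge0$. For $F:U\rightsquigarrow V[n]$, $G:V\rightsquigarrow W[m]$, respectively $f:U\rightsquigarrow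 U'[m]$, $h:V\rightsquigarrow V'[n]$, set, with $p,q$ the lengths of $a,b$, $$(GF)(x_1,\dots,x_i;u)=\sum_{(a,b)}\varepsilon(-1)^{(m-p)q+(n-q)|a|}\,G(a;F(b;u)),$$ $$(f\odot h)(x_1,\dots,x_i;u\otimes v)=\sum_{(a,b)}\varepsilon(-1)^{(m-p)q+(n-q)|a|+(n-q+|b|)|u|}\,f(a;u)\otimes h(b;v).$$ The identities $1_U$, the associators and the symmetric braiding $\gamma_{U,V}=s$ are intertwiners with only a component without $\mathfrak{g}$-inputs; associators and unitors are suppressed below. Put $\varrho_f^{i}:=(-1)^{i}f^{i+1}$, $i\geq1$, viewed as an intertwiner $\varrho_f:\mathfrak g\odot U\rightsquigarrow V[n-1]$ (the last $\mathfrak g$-input becomes part of the module), and let $\ell_U:U\rightsquigarrow(\mathfrak g\otimes U)[2]$ have components $\ell^i\otimes1_U$. A \emph{representation} of $\mathfrak g$ is a graded vector space $U$ with an intertwiner $\rho_U:U\rightsquigarrow U[1]$ such that $\rho_U\rho_U=\varrho_{\rho_U}\ell_U$; $U\odot V$ is $U\otimes V$ with $\rho_{U,V}=\rho_U\odot1_V+1_U\odot\rho_V$.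 Intertwiners $f:U\rightsquigarrow V[n]$ between representations form a complex with $\partial f=\rho_Vf-(-1)^nf\rho_U-\varrho_f\ell_U$; an \emph{equivariant map} is an $f$ of degree $0$ with $\partial f=0$. The homotopy 2-category $\mathcal C=\mathsf{Ho}_2[\mathsf{Rep}(\mathfrak g)]$ has the representations as objects, and as hom-complexes the truncations whose degree $0$ part is the space of equivariant maps and whose degree $-1$ part is the space of intertwiners of degree $-1$ modulo $\partial$ of those of degree $-2$. Define $\varpi_2:\mathbb K\rightsquigarrow\mathrm{Sym}^2\mathfrak g\subseteq\mathfrak g\otimes\mathfrak g$ by $\varpi_2^i=(-1)^i\pi_2^{i-1}$, $i\geq1$; for a representation $U$ let $\varrho_U:\mathfrak g\odot U\rightsquigarrow U$, $\varrho_U^i=(-1)^{i-1}\rho_U^{i+1}$, and $\lambda_U=\varrho_U\gamma_{U,\mathfrak g}$; for $f:U\rightsquigarrow U'$ let $\lambda_f=\varrho_f\gamma_{U,\mathfrak g}$. For representations $U,V$ and equivariant maps $f:U\rightsquigarrow U'$, $g:V\rightsquigarrow V'$ put $$t_{U,V}:=(\lambda_U\odot\varrho_V)(1_U\odot\varpi_2\odot1_V),\qquad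 t_{f,g}:=\big(\lambda_f\odot g\varrho_V+\lambda_{U'}[f\odot1_{\mathfrak g}]\odot\varrho_g\big)(1_U\odot\varpi_2\odot1_V).$$ \textbf{Theorem.} For every homotopy Lie algebra $\mathfrak g$ and every 2-shifted Poisson structure in $\mathfrak g$, the above $t$ is a totally $\gamma$-equivariant coherent infinitesimal 2-braiding on $\mathcal C$. Explicitly, for all representations, and all equivariant maps $f,f',g,g',h$ with suitable sources and targets (equalities of morphisms of degree $-1$ being in $\mathcal C$, i.e. modulo $\partial$ of intertwiners of degree $-2$): (a) (\emph{pseudonatural transformation} $\odot\Rightarrow\odot$) $t_{U,V}$ is equivariant; $t_{f,g}$ is an intertwiner of degree $-1$, bilinear in $(f,g)$; $(f\odot g)t_{U,V}-t_{U',V'}(f\odot g)=\partial t_{f,g}$; if $f$ instead has degree $-1$, then $(f\odot g)t_{U,V}-t_{U',V'}(f\odot g)=t_{\partial f,g}$, and if $g$ instead has degree $-1$, then $(f\odot g)t_{U,V}-t_{U',V'}(f\odot g)=t_{f,\partial g}$; and $t_{f'f,g'g}=t_{f',g'}(f\odot g)+(f'\odot g')t_{f,g}$. (b) (\emph{infinitesimal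 hexagon relations}) $t_{U,V\odot W}=t_{U,V}\odot1_W+(1_U\odot\gamma_{W,V})(t_{U,W}\odot1_V)(1_U\odot\gamma_{V,W})$, $t_{f,g\odot h}=t_{f,g}\odot h+(1_{U'}\odot\gamma_{W',V'})(t_{f,h}\odot g)(1_U\odot\gamma_{V,W})$, $t_{U\odot V,W}=1_U\odot t_{V,W}+(\gamma_{V,U}\odot1_W)(1_V\odot t_{U,W})(\gamma_{U,V}\odot1_W)$, $t_{f\odot g,h}=f\odot t_{g,h}+(\gamma_{V',U'}\odot1_{W'})(g\odot t_{f,h})(\gamma_{U,V}\odot1_W)$. (c) (\emph{$\gamma$-equivariance}) $\gamma_{U,V}t_{U,V}=t_{V,U}\gamma_{U,V}$ and $\gamma_{U',V'}t_{f,g}=t_{g,f}\gamma_{U,V}$. (d) (\emph{total $\gamma$-equivariance}) $t_{\gamma_{U,V},1_W}=0$. (e) (\emph{coherence}) $t_{t_{U,V},1_W}+t_{1_U,t_{V,W}}+(1_U\odot\gamma_{W,V})\,t_{t_{U,W},1_V}\,(1_U\odot\gamma_{V,W})=0$. -/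

import Mathlib

open scoped TensorProduct

universe u

noncomputable section

namespace HLie

/-! ### Graded vector spaces -/

/-- A `ℤ`-graded vector space over `K`. -/
structure GrVect (K : Type u) [Field K] where
  carrier : Type u
  [acg : AddCommGroup carrier]
  [mod : Module K carrier]
  deg : ℤ → Submodule K carrier
  internal : DirectSum.IsInternal deg

attribute [instance] GrVect.acg GrVect.mod

namespace GrVect

variable {K : Type u} [Field K]

theorem bijective (V : GrVect K) : Function.Bijective (DirectSum.coeLinearMap V.deg) := V.internal

/-- The linear map out of `V` determined by its restrictions to the homogeneous pieces. -/
def fromPieces (V : GrVect K) {X : Type u} [AddCommMonoid X] [Module K X]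
    (φ : ∀ d, V.deg d →ₗ[K] X) : V.carrier →ₗ[K] X :=
  DirectSum.toModule K ℤ X φ ∘ₗ
    (LinearEquiv.ofBijective (DirectSum.coeLinearMap V.deg) V.bijective).symm.toLinearMap

theorem fromPieces_apply (V : GrVect K) {X : Type u} [AddCommMonoid X] [Module K X]
    (φ : ∀ d, V.deg d →ₗ[K] X) {d : ℤ} (x : V.deg d) : V.fromPieces φ x = φ d x := by
  have h : (LinearEquiv.ofBijective (DirectSum.coeLinearMap V.deg) V.bijective).symm (x : V.carrier)
      = DirectSum.lof K ℤ (fun i => V.deg i) d x := by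
    rw [LinearEquiv.symm_apply_eq]
    simp [DirectSum.coeLinearMap_lof]
  simp [fromPieces, h]

theorem hom_ext (V : GrVect K) {X : Type u} [AddCommMonoid X] [Module K X]
    {φ ψ : V.carrier →ₗ[K] X} (h : ∀ d, ∀ x : V.deg d, φ x = ψ x) : φ = ψ := by
  have key : φ ∘ₗ DirectSum.coeLinearMap V.deg = ψ ∘ₗ DirectSum.coeLinearMap V.deg := by
    apply DirectSum.linearMap_ext
    intro d
    ext x
    simpa [DirectSum.coeLinearMap_lof] using h d x
  ext v
  obtain ⟨w, rfl⟩ := V.bijective.2 v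
  exact LinearMap.congr_fun key w

/-- The operator that multiplies elements of degree `i` by `c i`. -/
def scaleOp (V : GrVect K) (c : ℤ → K) : V.carrier →ₗ[K] V.carrier :=
  V.fromPieces fun d => c d • (V.deg d).subtype

/-- The operator `v ↦ (-1) ^ (m * |v|) v`. -/
def sgn (V : GrVect K) (m : ℤ) : V.carrier →ₗ[K] V.carrier :=
  V.scaleOp fun d => (-1 : K) ^ (m * d)

theorem scaleOp_apply (V : GrVect K) (c : ℤ → K) {d : ℤ} {v : V.carrier} (hv : v ∈ V.deg d) :
    V.scaleOp c v = c d • v := by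
  have := V.fromPieces_apply (fun d => c d • (V.deg d).subtype) (⟨v, hv⟩ : V.deg d)
  simpa [scaleOp] using this

theorem sgn_apply (V : GrVect K) (m : ℤ) {d : ℤ} {v : V.carrier} (hv : v ∈ V.deg d) :
    V.sgn m v = (-1 : K) ^ (m * d) • v := V.scaleOp_apply _ hv

/-- The degree `n` part of a tensor product. -/
def tensorDeg (U V : GrVect K) (n : ℤ) : Submodule K (U.carrier ⊗[K] V.carrier) :=
  ⨆ p : ℤ, Submodule.map₂ (TensorProduct.mk K U.carrier V.carrier) (U.deg p) (V.deg (n - p))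

theorem tmul_mem (U V : GrVect K) {p q n : ℤ} (h : p + q = n) {u : U.carrier} {v : V.carrier}
    (hu : u ∈ U.deg p) (hv : v ∈ V.deg q) : u ⊗ₜ[K] v ∈ tensorDeg U V n := by
  have hq : q = n - p := by omega
  subst hq
  exact Submodule.mem_iSup_of_mem p (Submodule.apply_mem_map₂ _ hu hv)

/-- Sends a tensor to the family of its homogeneous components. -/
def tensorSplit (U V : GrVect K) :
    U.carrier ⊗[K] V.carrier →ₗ[K] DirectSum ℤ (fun n => tensorDeg U V n) :=
  TensorProduct.lift <| U.fromPieces fun p => LinearMap.flip <| V.fromPieces fun q =>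
    LinearMap.mk₂ K
      (fun (v : V.deg q) (u : U.deg p) =>
        DirectSum.lof K ℤ (fun n => tensorDeg U V n) (p + q)
          ⟨(u : U.carrier) ⊗ₜ[K] (v : V.carrier), tmul_mem U V rfl u.2 v.2⟩)
      (by intro a b c; rw [← map_add]; congr 1; ext; simp [TensorProduct.tmul_add])
      (by intro a b c; rw [← map_smul]; congr 1; ext; simp)
      (by intro a b c; rw [← map_add]; congr 1; ext; simp [TensorProduct.add_tmul])
      (by intro a b c; rw [← map_smul]; congr 1)

theorem tensorSplit_tmul (U V : GrVect K) {p q : ℤ} (u : U.deg p) (v : V.deg q) :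
    tensorSplit U V ((u : U.carrier) ⊗ₜ[K] (v : V.carrier)) =
      DirectSum.lof K ℤ (fun n => tensorDeg U V n) (p + q)
        ⟨(u : U.carrier) ⊗ₜ[K] (v : V.carrier), tmul_mem U V rfl u.2 v.2⟩ := by
  simp only [tensorSplit, TensorProduct.lift.tmul, fromPieces_apply, LinearMap.flip_apply]
  rfl

theorem lof_congr {U V : GrVect K} {m n : ℤ} (h : m = n) (z : U.carrier ⊗[K] V.carrier)
    (hm : z ∈ tensorDeg U V m) (hn : z ∈ tensorDeg U V n) :
    DirectSum.lof K ℤ (fun n => tensorDeg U V n) m ⟨z, hm⟩ =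
      DirectSum.lof K ℤ (fun n => tensorDeg U V n) n ⟨z, hn⟩ := by
  subst h; rfl

theorem tensorSplit_mem (U V : GrVect K) {n : ℤ} {z : U.carrier ⊗[K] V.carrier}
    (hz : z ∈ tensorDeg U V n) :
    tensorSplit U V z = DirectSum.lof K ℤ (fun n => tensorDeg U V n) n ⟨z, hz⟩ := by
  have key : ∃ hz : z ∈ tensorDeg U V n,
      tensorSplit U V z = DirectSum.lof K ℤ (fun n => tensorDeg U V n) n ⟨z, hz⟩ := by
    refine Submodule.iSup_induction _ (motive := fun z => ∃ hz : z ∈ tensorDeg U V n,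
      tensorSplit U V z = DirectSum.lof K ℤ (fun n => tensorDeg U V n) n ⟨z, hz⟩) hz ?_ ?_ ?_
    · intro p x hx
      rw [Submodule.map₂_eq_span_image2] at hx
      refine Submodule.span_induction ?_ ?_ ?_ ?_ hx
      · rintro _ ⟨u, hu, v, hv, rfl⟩
        refine ⟨tmul_mem U V (by omega) hu hv, ?_⟩
        have := tensorSplit_tmul U V ⟨u, hu⟩ ⟨v, hv⟩
        exact this.trans (lof_congr (by omega) _ _ _)
      · exact ⟨zero_mem _, by rw [map_zero]; exact (map_zero _).symm⟩
      · rintro x y _ _ ⟨hx, ex⟩ ⟨hy, ey⟩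
        exact ⟨add_mem hx hy, by rw [map_add, ex, ey, ← map_add]; rfl⟩
      · rintro c x _ ⟨hx, ex⟩
        exact ⟨Submodule.smul_mem _ c hx, by rw [map_smul, ex, ← map_smul]; rfl⟩
    · exact ⟨zero_mem _, by rw [map_zero]; exact (map_zero _).symm⟩
    · rintro x y ⟨hx, ex⟩ ⟨hy, ey⟩
      exact ⟨add_mem hx hy, by rw [map_add, ex, ey, ← map_add]; rfl⟩
  exact key.2

/-- The tensor product of graded vector spaces. -/
abbrev tensor (U V : GrVect K) : GrVect K where
  carrier := U.carrier ⊗[K] V.carrier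
  deg := tensorDeg U V
  internal := by
    constructor
    · intro x y hxy
      have h : tensorSplit U V ∘ₗ DirectSum.coeLinearMap (tensorDeg U V) = LinearMap.id := by
        apply DirectSum.linearMap_ext
        intro d
        ext x : 1
        simp only [LinearMap.comp_apply, DirectSum.coeLinearMap_lof, LinearMap.id_apply]
        exact tensorSplit_mem U V x.2
      have hx := LinearMap.congr_fun h x
      have hy := LinearMap.congr_fun h y
      simp only [LinearMap.comp_apply, LinearMap.id_apply] at hx hy
      rw [← hx, ← hy]
      exact congrArg (tensorSplit U V) hxy
    · have h : DirectSum.coeLinearMap (tensorDeg U V) ∘ₗ tensorSplit U V = LinearMap.id := by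
        apply TensorProduct.ext
        apply U.hom_ext
        intro p u
        apply V.hom_ext
        intro q v
        change DirectSum.coeLinearMap (tensorDeg U V) (tensorSplit U V
          ((u : U.carrier) ⊗ₜ[K] (v : V.carrier))) = (u : U.carrier) ⊗ₜ[K] (v : V.carrier)
        rw [tensorSplit_tmul, DirectSum.coeLinearMap_lof]
      exact fun z => ⟨tensorSplit U V z, LinearMap.congr_fun h z⟩

/-- The ground field, in degree `0`. -/
abbrev ground (K : Type u) [Field K] : GrVect K where
  carrier := K
  deg n := if n = 0 then ⊤ else ⊥
  internal := by
    rw [DirectSum.isInternal_submodule_iff_iSupIndep_and_iSup_eq_top]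
    constructor
    · intro i
      rcases eq_or_ne i 0 with rfl | hi
      · have : (⨆ j, ⨆ (_ : j ≠ (0 : ℤ)), (if j = 0 then ⊤ else ⊥ : Submodule K K)) = ⊥ := by
          simp only [iSup_eq_bot]
          intro j hj
          simp [hj]
        rw [this]
        exact disjoint_bot_right
      · simp [hi]
    · exact eq_top_iff.mpr (le_iSup_of_le 0 (by simp))

/-- The Koszul swap `u ⊗ v ↦ (-1) ^ (|u| |v|) v ⊗ u`. -/
def swap (U V : GrVect K) :
    U.carrier ⊗[K] V.carrier →ₗ[K] V.carrier ⊗[K] U.carrier :=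
  (TensorProduct.comm K U.carrier V.carrier).toLinearMap ∘ₗ
    (TensorProduct.map (U.scaleOp fun d => if Even d then 1 else 0) LinearMap.id +
      TensorProduct.map (U.scaleOp fun d => if Even d then 0 else 1) (V.sgn 1))

theorem swap_tmul (U V : GrVect K) {p q : ℤ} {u : U.carrier} {v : V.carrier}
    (hu : u ∈ U.deg p) (hv : v ∈ V.deg q) :
    swap U V (u ⊗ₜ[K] v) = (-1 : K) ^ (p * q) • (v ⊗ₜ[K] u) := by
  rcases Int.even_or_odd p with hp | hp
  · simp [swap, scaleOp_apply _ _ hu, hp, Even.neg_one_zpow (hp.mul_right q)]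
  · have h : (-1 : K) ^ (p * q) = (-1 : K) ^ q := by rw [zpow_mul, hp.neg_one_zpow]
    have hp' : ¬ Even p := Int.not_even_iff_odd.mpr hp
    simp [swap, scaleOp_apply _ _ hu, hp', sgn_apply _ _ hv, h, TensorProduct.smul_tmul']

/-- The tensor powers `V ⊗ (V ⊗ (⋯ ⊗ (V ⊗ K)))`. -/
def tpow (V : GrVect K) : ℕ → GrVect K
  | 0 => ground K
  | n + 1 => V.tensor (V.tpow n)

/-- The Koszul transposition of the tensor factors `i` and `i + 1` (counted from `0`) of a tensor
power; the identity if there are no such factors. -/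
def swapAt (V : GrVect K) : (w : ℕ) → ℕ → ((V.tpow w).carrier →ₗ[K] (V.tpow w).carrier)
  | 0, _ => LinearMap.id
  | 1, _ => LinearMap.id
  | w + 2, 0 =>
    (TensorProduct.assoc K V.carrier V.carrier (V.tpow w).carrier).toLinearMap ∘ₗ
      TensorProduct.map (swap V V) LinearMap.id ∘ₗ
        (TensorProduct.assoc K V.carrier V.carrier (V.tpow w).carrier).symm.toLinearMap
  | w + 2, i + 1 => TensorProduct.map LinearMap.id (swapAt V (w + 1) i)

/-- The symmetric power, as the subspace of (graded) symmetric tensors. -/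
def Sym (V : GrVect K) (w : ℕ) : Submodule K (V.tpow w).carrier where
  carrier := {z | ∀ i, V.swapAt w i z = z}
  add_mem' h h' i := by rw [map_add, h i, h' i]
  zero_mem' i := map_zero _
  smul_mem' c _ h i := by rw [map_smul, h i]

/-- The symmetriser `V^{⊗ p} ⊗ V^{⊗ q} → V^{⊗ n}` for `p + q = n` (and `0` if `p + q ≠ n`): the sum,
with Koszul signs, of all ways to shuffle the factors of the first tensor into those of the
second, keeping the order within each. It maps pairs of symmetric tensors to symmetric tensors. -/
def symmetriser (V : GrVect K) : (n p q : ℕ) →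
    ((V.tpow p).carrier ⊗[K] (V.tpow q).carrier →ₗ[K] (V.tpow n).carrier)
  | 0, 0, 0 => LinearMap.mul' K K
  | 0, 0, _ + 1 => 0
  | 0, _ + 1, _ => 0
  | n + 1, p, q =>
    (match p with
      | 0 => 0
      | p + 1 =>
        TensorProduct.map LinearMap.id (symmetriser V n p q) ∘ₗ
          (TensorProduct.assoc K V.carrier (V.tpow p).carrier (V.tpow q).carrier).toLinearMap) +
    (match q with
      | 0 => 0
      | q + 1 =>
        TensorProduct.map LinearMap.id (symmetriser V n p q) ∘ₗ
          (TensorProduct.assoc K V.carrier (V.tpow p).carrier (V.tpow q).carrier).toLinearMap ∘ₗ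
          TensorProduct.map (swap (V.tpow p) V) LinearMap.id ∘ₗ
          (TensorProduct.assoc K (V.tpow p).carrier V.carrier (V.tpow q).carrier).symm.toLinearMap)

end GrVect

/-! ### Families of multilinear maps on homogeneous elements -/

/-- A homogeneous element together with its degree. -/
structure HEl {K : Type u} [Field K] (g : GrVect K) where
  d : ℤ
  x : g.deg d

section Families

variable {K : Type u} [Field K] {g : GrVect K}

/-- The total degree of a list of homogeneous elements. -/
def degSum (l : List (HEl g)) : ℤ := (l.map HEl.d).sum

@[simp] theorem degSum_nil : degSum ([] : List (HEl g)) = 0 := rfl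

@[simp] theorem degSum_cons (x : HEl g) (l : List (HEl g)) :
    degSum (x :: l) = x.d + degSum l := by simp [degSum]

@[simp] theorem degSum_append (a b : List (HEl g)) :
    degSum (a ++ b) = degSum a + degSum b := by simp [degSum]

/-- All shuffles of the list `l = [x₁, …, xₙ]`: the list of all `(s, a, b)` with
`a = [x_σ(1), …, x_σ(p)]` and `b = [x_σ(p+1), …, x_σ(n)]`, where `σ` runs over the `(p,q)`-shuffles
with `p + q = n` and where `s = sgn(σ)` times the Koszul sign of `σ`. -/
def shuffles : List (HEl g) → List (K × List (HEl g) × List (HEl g))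
  | [] => [(1, [], [])]
  | x :: l =>
    (shuffles l).map (fun s => (s.1, x :: s.2.1, s.2.2)) ++
    (shuffles l).map (fun s =>
      (s.1 * (-1 : K) ^ ((s.2.1.length : ℤ) + x.d * degSum s.2.1), s.2.1, x :: s.2.2))

variable {X Y Z : Type u} [AddCommGroup X] [Module K X] [AddCommGroup Y] [Module K Y]
  [AddCommGroup Z] [Module K Z]

/-- Families of multilinear maps `{g^{⊗ k} → X}` for all `k ≥ 0`, given by their values on
homogeneous elements. -/
def Fam (g : GrVect K) (X : Type u) [AddCommGroup X] [Module K X] :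
    Submodule K (List (HEl g) → X) where
  carrier := {f | ∀ (a b : List (HEl g)) (d : ℤ),
    IsLinearMap K fun x : g.deg d => f (a ++ ⟨d, x⟩ :: b)}
  add_mem' hf hf' a b d := ((hf a b d).mk' _ + (hf' a b d).mk' _).isLinear
  zero_mem' _ _ d := (0 : g.deg d →ₗ[K] X).isLinear
  smul_mem' c _ hf a b d := (c • (hf a b d).mk' _).isLinear

/-- Graded skew-symmetry in all the entries. -/
def IsSkew (f : List (HEl g) → X) : Prop :=
  ∀ (a b : List (HEl g)) (x y : HEl g),
    f (a ++ x :: y :: b) = (-(-1 : K) ^ (x.d * y.d)) • f (a ++ y :: x :: b)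

/-- Sum over all shuffles `(a, b)` of the inputs of `± B (G a) (F b)`, where `m` and `n` are the
degrees of `G` and `F`, so that the components of `G` and `F` with `p` and `q` inputs have degrees
`m - p` and `n - q`. The sign is `(-1) ^ ((m - p) q)` times the Koszul sign `(-1) ^ ((n - q) |a|)`
for moving `F` past `a`. The bilinear map `B` may depend on the degree `n - q + |b|` of `F b`. -/
def convFun (m n : ℤ) (B : ℤ → X →ₗ[K] Y →ₗ[K] Z) (G : List (HEl g) → X) (F : List (HEl g) → Y) :
    List (HEl g) → Z := fun l =>
  ((shuffles l).map fun s =>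
    (s.1 * (-1 : K) ^ ((m - s.2.1.length) * s.2.2.length + (n - s.2.2.length) * degSum s.2.1)) •
      B (n - s.2.2.length + degSum s.2.2) (G s.2.1) (F s.2.2)).sum

theorem negOnePow_congr {i j : ℤ} (h : Even (i - j)) : (-1 : K) ^ i = (-1 : K) ^ j := by
  have : i = j + (i - j) := by ring
  rw [this, zpow_add₀ (by norm_num), h.neg_one_zpow, mul_one]

theorem convFun_cons (m n : ℤ) (B : ℤ → X →ₗ[K] Y →ₗ[K] Z) (G : List (HEl g) → X)
    (F : List (HEl g) → Y) (x : HEl g) (l : List (HEl g)) :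
    convFun m n B G F (x :: l) =
      (-1 : K) ^ (n * x.d) • convFun (m + x.d - 1) n B (fun a => G (x :: a)) F l +
      (-1 : K) ^ m • convFun m (n + x.d - 1) B G (fun b => F (x :: b)) l := by
  have h1 : (-1 : K) ≠ 0 := by norm_num
  simp only [convFun, shuffles, List.map_append, List.map_map, List.sum_append, List.smul_sum]
  congr 2
  · refine List.map_congr_left fun s _ => ?_
    simp only [Function.comp_apply, smul_smul, degSum_cons, List.length_cons]
    congr 1
    rw [mul_left_comm, ← zpow_add₀ h1]
    congr 1
    apply negOnePow_congr
    push_cast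
    exact ⟨-(s.2.2.length * x.d), by ring⟩
  · refine List.map_congr_left fun s _ => ?_
    simp only [Function.comp_apply, smul_smul, degSum_cons, List.length_cons]
    rw [mul_assoc, ← zpow_add₀ h1, mul_left_comm, ← zpow_add₀ h1]
    push_cast
    congr 2
    · ring_nf
    · congr 2
      ring

theorem isLinearMap_sum {A : Type u} [AddCommGroup A] [Module K A] {S : Type u} (L : List S)
    (φ : S → A → X) (h : ∀ s, IsLinearMap K (φ s)) :
    IsLinearMap K fun y => (L.map fun s => φ s y).sum := by
  induction L with
  | nil => exact (0 : A →ₗ[K] X).isLinear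
  | cons s L ih =>
    simp only [List.map_cons, List.sum_cons]
    exact ((h s).mk' _ + ih.mk' _).isLinear

theorem mem_Fam_cons {f : List (HEl g) → X} (hf : f ∈ Fam g X) (x : HEl g) :
    (fun l => f (x :: l)) ∈ Fam g X := fun a b d => hf (x :: a) b d

theorem convFun_mem (m n : ℤ) (B : ℤ → X →ₗ[K] Y →ₗ[K] Z) {G : List (HEl g) → X}
    {F : List (HEl g) → Y} (hG : G ∈ Fam g X) (hF : F ∈ Fam g Y) :
    convFun m n B G F ∈ Fam g Z := by
  intro a
  induction a generalizing m n G F with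
  | nil =>
    intro b d
    have e : (fun y : g.deg d => convFun m n B G F ([] ++ ⟨d, y⟩ :: b)) = fun y =>
        (-1 : K) ^ (n * d) • convFun (m + d - 1) n B (fun a => G (⟨d, y⟩ :: a)) F b +
        (-1 : K) ^ m • convFun m (n + d - 1) B G (fun a => F (⟨d, y⟩ :: a)) b := by
      funext y
      exact convFun_cons m n B G F ⟨d, y⟩ b
    rw [e]
    have h1 : IsLinearMap K fun y : g.deg d =>
        convFun (m + d - 1) n B (fun a => G (⟨d, y⟩ :: a)) F b :=
      isLinearMap_sum _ _ fun s =>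
        ((_ : K) • ((B _).flip (F s.2.2) ∘ₗ (hG [] s.2.1 d).mk' _)).isLinear
    have h2 : IsLinearMap K fun y : g.deg d =>
        convFun m (n + d - 1) B G (fun a => F (⟨d, y⟩ :: a)) b :=
      isLinearMap_sum _ _ fun s =>
        ((_ : K) • (B _ (G s.2.1) ∘ₗ (hF [] s.2.2 d).mk' _)).isLinear
    exact ((-1 : K) ^ (n * d) • h1.mk' _ + (-1 : K) ^ m • h2.mk' _).isLinear
  | cons x a ih =>
    intro b d
    have e : (fun y : g.deg d => convFun m n B G F ((x :: a) ++ ⟨d, y⟩ :: b)) =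
        (-1 : K) ^ (n * x.d) • (ih (m + x.d - 1) n (mem_Fam_cons hG x) hF b d).mk' _ +
        (-1 : K) ^ m • (ih m (n + x.d - 1) hG (mem_Fam_cons hF x) b d).mk' _ := by
      funext y
      exact convFun_cons m n B G F x _
    rw [e]
    exact ((-1 : K) ^ (n * x.d) • (ih (m + x.d - 1) n (mem_Fam_cons hG x) hF b d).mk' _ +
        (-1 : K) ^ m • (ih m (n + x.d - 1) hG (mem_Fam_cons hF x) b d).mk' _).isLinear

/-- `convFun` as a family of multilinear maps. -/
def conv (m n : ℤ) (B : ℤ → X →ₗ[K] Y →ₗ[K] Z) (G : Fam g X) (F : Fam g Y) : Fam g Z :=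
  ⟨convFun m n B G F, convFun_mem m n B G.2 F.2⟩

/-- Fixes all the entries except the last one, which becomes an arbitrary vector. -/
def last (f : Fam g X) (a : List (HEl g)) : g.carrier →ₗ[K] X :=
  g.fromPieces fun d => (f.2 a [] d).mk' _

theorem last_apply (f : Fam g X) (a : List (HEl g)) (y : HEl g) :
    last f a (y.x : g.carrier) = f.1 (a ++ [y]) := g.fromPieces_apply _ y.x

theorem last_mem (f : Fam g X) : last f ∈ Fam g (g.carrier →ₗ[K] X) := by
  intro a b d
  constructor
  · intro x y
    apply g.hom_ext
    intro e z
    have h := (f.2 a (b ++ [⟨e, z⟩]) d).map_add x y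
    simpa [last, g.fromPieces_apply] using h
  · intro c x
    apply g.hom_ext
    intro e z
    have h := (f.2 a (b ++ [⟨e, z⟩]) d).map_smul c x
    simpa [last, g.fromPieces_apply] using h

/-- Postcomposition of a family with linear maps that may depend on the number of inputs. -/
def postcomp (φ : ℕ → X →ₗ[K] Y) (f : Fam g X) : Fam g Y :=
  ⟨fun l => φ l.length (f.1 l), fun a b d => by
    have h := (φ (a ++ (⟨d, 0⟩ : HEl g) :: b).length ∘ₗ (f.2 a b d).mk' _).isLinear
    simpa [Function.comp_def] using h⟩

/-- The family whose only nonzero component is the one without inputs. -/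
def strict (φ : X) : Fam g X :=
  ⟨fun l => match l with
    | [] => φ
    | _ :: _ => 0, fun a b d => by
    cases a <;> exact (0 : g.deg d →ₗ[K] X).isLinear⟩

end Families

/-! ### Homotopy Lie algebras and 2-shifted Poisson structures -/

section Structures

variable {K : Type u} [Field K]

/-- The homogeneous element `f a`, for a family `f` of degree `n` of maps with values in `g`. -/
def homogeneousValue {g : GrVect K} {f : List (HEl g) → g.carrier} {n : ℤ}
    (h : ∀ l, f l ∈ g.deg (degSum l + n - l.length)) (a : List (HEl g)) : HEl g :=
  ⟨degSum a + n - a.length, ⟨f a, h a⟩⟩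

/-- A homotopy Lie algebra structure on `g`: skew-symmetric brackets `ℓ^i : ⋀^i g → g[2-i]`, for
`i ≥ 1`, subject to the generalised Jacobi identity
`∑ ± ℓ^j (ℓ^k (x_σ(1), …, x_σ(k)), x_σ(k+1), …, x_σ(i)) = 0`. -/
structure HomotopyLie (g : GrVect K) where
  ell : Fam g g.carrier
  ell_nil : ell.1 [] = 0
  ell_deg : ∀ l, ell.1 l ∈ g.deg (degSum l + 2 - l.length)
  ell_skew : IsSkew ell.1
  jacobi : ∀ l, ((shuffles l).map fun s => (s.1 * (-1 : K) ^ (s.2.2.length : ℤ)) •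
    ell.1 (homogeneousValue ell_deg s.2.1 :: s.2.2)).sum = 0

variable {g : GrVect K}

/-- The brackets `π₁^i = (-1) ^ (i-1) ℓ^i`, as maps to the first tensor power of `g`. -/
def HomotopyLie.piOne (L : HomotopyLie g) : Fam g (g.tpow 1).carrier :=
  postcomp (fun i => (-1 : K) ^ ((i : ℤ) - 1) • (TensorProduct.rid K g.carrier).symm.toLinearMap)
    L.ell

/-- The family `π₁, π₂, π₃, …`, where `π₁` is given by the brackets. -/
def fullPi (L : HomotopyLie g) (p : ∀ w : ℕ, Fam g (g.tpow (w + 2)).carrier) :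
    ∀ w : ℕ, Fam g (g.tpow (w + 1)).carrier
  | 0 => L.piOne
  | w + 1 => p w

/-- A 2-shifted Poisson structure in the homotopy Lie algebra `(g, ℓ)`: skew-symmetric maps
`π_w^i : ⋀^i g → (Sym^w g)[4-2w-i]` for `w ≥ 2` and `i ≥ 0` (here `p w` is `π_{w+2}`) that satisfy
the Maurer-Cartan equation, which in weight `w + 2` says that the sum over `w₁ - 1 + w₂ = w + 2` and
`(j-1) + k = i` of
`(-1)^{j(k-1)} Σ⁺_{w₁,w₂-1} (π_{w₁}^j ⊗ 1_{w₂-1}) (1_{j-1} ⊗ π_{w₂}^k) Σ_{j-1,k}` vanishes.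
Below `w₁ = q.1 + 1`, `w₂ = q.2 + 1`, `j = a.length + 1` and `k = b.length` for a shuffle `(a, b)`;
the second power of `-1` is the Koszul sign for moving `π_{w₂}^k` past `a`. -/
structure ShiftedPoisson (L : HomotopyLie g) where
  p : ∀ w : ℕ, Fam g (g.tpow (w + 2)).carrier
  p_deg : ∀ w l, (p w).1 l ∈ (g.tpow (w + 2)).deg (degSum l + 4 - 2 * ((w : ℤ) + 2) - l.length)
  p_sym : ∀ w l, (p w).1 l ∈ g.Sym (w + 2)
  p_skew : ∀ w, IsSkew (p w).1
  maurerCartan : ∀ (w : ℕ) (l : List (HEl g)),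
    ∑ q ∈ Finset.HasAntidiagonal.antidiagonal (w + 1), ((shuffles l).map fun s =>
      (s.1 * (-1 : K) ^ (((s.2.1.length : ℤ) + 1) * ((s.2.2.length : ℤ) - 1)) *
        (-1 : K) ^ ((4 - 2 * ((q.2 : ℤ) + 1) - s.2.2.length) * degSum s.2.1)) •
        g.symmetriser (w + 2) (q.1 + 1) q.2
          (TensorProduct.map (last (fullPi L p q.1) s.2.1) LinearMap.id
            ((fullPi L p q.2).1 s.2.2))).sum = 0

/-! ### Intertwiners -/

/-- Families of linear maps `{g^{⊗ k} ⊗ U → V}`, `k ≥ 0`; the component with `k` inputs from `g` is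
the component `f^{k+1}` of an intertwiner. -/
abbrev IFam (g U V : GrVect K) : Type u := Fam g (U.carrier →ₗ[K] V.carrier)

/-- The space of intertwiners `U ⇝ V[n]`. -/
def Hom (g U V : GrVect K) (n : ℤ) : Submodule K (IFam g U V) where
  carrier := {f | (∀ l e, ∀ u ∈ U.deg e, f.1 l u ∈ V.deg (degSum l + e + n - l.length)) ∧
    IsSkew f.1}
  add_mem' {f h} hf hh := ⟨fun l e u hu => add_mem (hf.1 l e u hu) (hh.1 l e u hu),
    fun a b x y => by
      have h1 := hf.2 a b x y
      have h2 := hh.2 a b x y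
      simp only [Submodule.coe_add, Pi.add_apply, smul_add, h1, h2]⟩
  zero_mem' := ⟨fun l e u _ => zero_mem _, fun a b x y => by simp⟩
  smul_mem' c f hf := ⟨fun l e u hu => Submodule.smul_mem _ c (hf.1 l e u hu),
    fun a b x y => by
      have h1 := hf.2 a b x y
      simp only [Submodule.coe_smul, Pi.smul_apply, h1, smul_comm c]⟩

variable {U V W U' V' : GrVect K}

/-- The identity intertwiner. -/
def one (g U : GrVect K) : IFam g U U := strict LinearMap.id

/-- The symmetric braiding. -/
def braid (g U V : GrVect K) : IFam g (U.tensor V) (V.tensor U) := strict (GrVect.swap U V)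

/-- The associator. -/
def assoc (g U V W : GrVect K) :
    IFam g ((U.tensor V).tensor W) (U.tensor (V.tensor W)) :=
  strict (TensorProduct.assoc K U.carrier V.carrier W.carrier).toLinearMap

/-- The inverse associator. -/
def assocInv (g U V W : GrVect K) :
    IFam g (U.tensor (V.tensor W)) ((U.tensor V).tensor W) :=
  strict (TensorProduct.assoc K U.carrier V.carrier W.carrier).symm.toLinearMap

/-- The juxtaposition of an intertwiner of degree `m` after one of degree `n`. -/
def comp (m n : ℤ) (G : IFam g V W) (F : IFam g U V) : IFam g U W :=
  conv m n (fun _ => LinearMap.llcomp K U.carrier V.carrier W.carrier) G F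

/-- The odot product of intertwiners of degrees `m` and `n`; a component of `h` is moved past `u`
in `(f ⊗ h) (u ⊗ v) = (-1) ^ (|h| |u|) f u ⊗ h v`. -/
def odot (m n : ℤ) (f : IFam g U U') (h : IFam g V V') :
    IFam g (U.tensor V) (U'.tensor V') :=
  conv m n (fun k => TensorProduct.mapBilinear (.id K) U.carrier V.carrier U'.carrier V'.carrier ∘ₗ
    LinearMap.lcomp K U'.carrier (U.sgn k)) f h

/-- The intertwiner `ϱ_f : g ⊗ U ⇝ V`, with `ϱ_f^i = (-1) ^ i f^{i+1}`. -/
def varrho (f : IFam g U V) : IFam g (g.tensor U) V :=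
  postcomp (fun k => (-1 : K) ^ (k + 1) •
    TensorProduct.uncurry (.id K) g.carrier U.carrier V.carrier) ⟨last f, last_mem f⟩

/-- The intertwiner `ℓ_U : U ⇝ (g ⊗ U)[2]`, given by the maps `ℓ^i ⊗ 1_U`. -/
def ellAt (L : HomotopyLie g) (U : GrVect K) : IFam g U (g.tensor U) :=
  postcomp (fun _ => TensorProduct.mk K g.carrier U.carrier) L.ell

/-! ### The tensor product of two representations is a representation -/

theorem shuffles_lengths {l : List (HEl g)} {s : K × List (HEl g) × List (HEl g)}
    (hs : s ∈ shuffles l) :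
    s.2.1.length + s.2.2.length = l.length ∧ degSum s.2.1 + degSum s.2.2 = degSum l := by
  induction l generalizing s with
  | nil =>
    simp only [shuffles, List.mem_singleton] at hs
    subst hs
    simp
  | cons x l ih =>
    simp only [shuffles, List.mem_append, List.mem_map] at hs
    rcases hs with ⟨t, ht, rfl⟩ | ⟨t, ht, rfl⟩ <;> have := ih ht <;>
      simp only [List.length_cons, degSum_cons] <;> omega

theorem sum_shuffles_of_right {X : Type u} [AddCommGroup X] [Module K X] (l : List (HEl g))
    (φ : K × List (HEl g) × List (HEl g) → X) (h : ∀ s, s.2.2 ≠ [] → φ s = 0) :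
    ((shuffles l).map φ).sum = φ (1, l, []) := by
  induction l generalizing φ with
  | nil => simp [shuffles]
  | cons x l ih =>
    simp only [shuffles, List.map_append, List.map_map, List.sum_append]
    rw [ih (φ ∘ fun s => (s.1, x :: s.2.1, s.2.2)) (fun s hs => h _ hs), List.sum_eq_zero, add_zero]
    · rfl
    · intro y hy
      obtain ⟨s, _, rfl⟩ := List.mem_map.mp hy
      exact h _ (by simp)

theorem sum_shuffles_of_left {X : Type u} [AddCommGroup X] [Module K X] (l : List (HEl g))
    (φ : K × List (HEl g) × List (HEl g) → X) (h : ∀ s, s.2.1 ≠ [] → φ s = 0) :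
    ((shuffles l).map φ).sum = φ (1, [], l) := by
  induction l generalizing φ with
  | nil => simp [shuffles]
  | cons x l ih =>
    simp only [shuffles, List.map_append, List.map_map, List.sum_append]
    rw [add_comm, ih (φ ∘ fun s =>
      (s.1 * (-1 : K) ^ ((s.2.1.length : ℤ) + x.d * degSum s.2.1), s.2.1, x :: s.2.2))
      (fun s hs => h _ hs), List.sum_eq_zero, add_zero]
    · simp
    · intro y hy
      obtain ⟨s, _, rfl⟩ := List.mem_map.mp hy
      exact h _ (by simp)

theorem sum_shuffles_symm {X : Type u} [AddCommGroup X] [Module K X] (l : List (HEl g))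
    (φ : K × List (HEl g) × List (HEl g) → X) :
    ((shuffles l).map φ).sum = ((shuffles l).map fun s =>
      φ (s.1 * (-1 : K) ^ ((s.2.1.length : ℤ) * s.2.2.length + degSum s.2.1 * degSum s.2.2),
        s.2.2, s.2.1)).sum := by
  have h1 : (-1 : K) ≠ 0 := by norm_num
  induction l generalizing φ with
  | nil => simp [shuffles]
  | cons x l ih =>
    simp only [shuffles, List.map_append, List.map_map, List.sum_append]
    rw [ih (φ ∘ fun s => (s.1, x :: s.2.1, s.2.2)), ih (φ ∘ fun s =>
      (s.1 * (-1 : K) ^ ((s.2.1.length : ℤ) + x.d * degSum s.2.1), s.2.1, x :: s.2.2)), add_comm]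
    congr 2 <;> refine List.map_congr_left fun s _ => ?_ <;>
      simp only [Function.comp_apply, mul_assoc, ← zpow_add₀ h1, List.length_cons, degSum_cons] <;>
      congr 3 <;> apply negOnePow_congr <;> push_cast
    · exact ⟨0, by ring⟩
    · exact ⟨-(s.2.1.length + x.d * degSum s.2.1), by ring⟩

theorem sgn_zero (U : GrVect K) : U.sgn 0 = LinearMap.id := by
  apply U.hom_ext
  intro d x
  simp [U.sgn_apply 0 x.2]

theorem sgn_comp_sgn (U : GrVect K) (i j : ℤ) : U.sgn i ∘ₗ U.sgn j = U.sgn (i + j) := by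
  apply U.hom_ext
  intro d x
  simp only [LinearMap.comp_apply, U.sgn_apply _ x.2, map_smul, smul_smul]
  rw [← zpow_add₀ (by norm_num)]
  ring_nf

theorem odot_one_apply (m : ℤ) (f : IFam g U U') (l : List (HEl g)) :
    (odot m 0 f (one g V)).1 l = TensorProduct.map (f.1 l) LinearMap.id := by
  change ((shuffles l).map _).sum = _
  rw [sum_shuffles_of_right]
  · simp [one, strict, sgn_zero]
    rfl
  · rintro ⟨s, a, _ | ⟨x, b⟩⟩ hs
    · exact absurd rfl hs
    · simp [one, strict]

theorem one_odot_apply (n : ℤ) (h : IFam g V V') (l : List (HEl g)) :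
    (odot 0 n (one g U) h).1 l =
      TensorProduct.map (U.sgn (n - l.length + degSum l)) (h.1 l) := by
  change ((shuffles l).map _).sum = _
  rw [sum_shuffles_of_left]
  · simp [one, strict]
    rfl
  · rintro ⟨s, _ | ⟨x, a⟩, b⟩ hs
    · exact absurd rfl hs
    · simp [one, strict]

/-- The structure maps `ρ_{U,V} = ρ_U ⊙ 1_V + 1_U ⊙ ρ_V` on a tensor product. -/
def rhoTensor (rU : IFam g U U) (rV : IFam g V V) : IFam g (U.tensor V) (U.tensor V) :=
  odot 1 0 rU (one g V) + odot 0 1 (one g U) rV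

theorem rhoTensor_apply (rU : IFam g U U) (rV : IFam g V V) (l : List (HEl g)) :
    (rhoTensor rU rV).1 l = TensorProduct.map (rU.1 l) LinearMap.id +
      TensorProduct.map (U.sgn (1 - l.length + degSum l)) (rV.1 l) := by
  rw [← odot_one_apply 1 rU l, ← one_odot_apply 1 rV l]
  rfl

theorem rhoTensor_mem {rU : IFam g U U} {rV : IFam g V V} (hU : rU ∈ Hom g U U 1)
    (hV : rV ∈ Hom g V V 1) : rhoTensor rU rV ∈ Hom g (U.tensor V) (U.tensor V) 1 := by
  constructor
  · intro l e z hz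
    let T := ((U.tensor V).deg (degSum l + e + 1 - l.length)).comap ((rhoTensor rU rV).1 l)
    suffices h : (U.tensor V).deg e ≤ T from h hz
    refine iSup_le fun p => Submodule.map₂_le.mpr fun u hu v hv => ?_
    change (rhoTensor rU rV).1 l (u ⊗ₜ[K] v) ∈
      GrVect.tensorDeg U V (degSum l + e + 1 - l.length)
    rw [rhoTensor_apply]
    refine Submodule.add_mem _ ?_ ?_
    · exact GrVect.tmul_mem U V (by ring) (hU.1 l p u hu) hv
    · refine GrVect.tmul_mem U V (p := p) (q := degSum l + (e - p) + 1 - l.length) (by ring) ?_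
        (hV.1 l (e - p) v hv)
      rw [U.sgn_apply _ hu]
      exact Submodule.smul_mem _ _ hu
  · intro a b x y
    have hl : ((a ++ x :: y :: b).length : ℤ) = (a ++ y :: x :: b).length := by simp
    have hd : degSum (a ++ x :: y :: b) = degSum (a ++ y :: x :: b) := by
      simp only [degSum_append, degSum_cons]; ring
    rw [rhoTensor_apply, rhoTensor_apply, hl, hd, hU.2 a b x y, hV.2 a b x y,
      TensorProduct.map_smul_left, TensorProduct.map_smul_right, smul_add]

theorem comp_apply (m n : ℤ) (G : IFam g V W) (F : IFam g U V) (l : List (HEl g)) :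
    (comp m n G F).1 l = ((shuffles l).map fun s =>
    (s.1 * (-1 : K) ^ ((m - s.2.1.length) * s.2.2.length + (n - s.2.2.length) * degSum s.2.1)) •
      (G.1 s.2.1 ∘ₗ F.1 s.2.2)).sum := rfl

theorem map_comp_apply {Z : Type u} [AddCommGroup Z] [Module K Z]
    (φ : (U.carrier →ₗ[K] W.carrier) →ₗ[K] Z)
    (m n : ℤ) (G : IFam g V W) (F : IFam g U V) (l : List (HEl g)) :
    φ ((comp m n G F).1 l) = ((shuffles l).map fun s =>
    (s.1 * (-1 : K) ^ ((m - s.2.1.length) * s.2.2.length + (n - s.2.2.length) * degSum s.2.1)) •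
      φ (G.1 s.2.1 ∘ₗ F.1 s.2.2)).sum := by
  simp only [comp_apply, map_list_sum, List.map_map, Function.comp_def, map_smul]

theorem sgn_comp_of_graded {n : ℤ} {f : IFam g U U} (hf : f ∈ Hom g U U n) (i : ℤ)
    (l : List (HEl g)) : U.sgn i ∘ₗ f.1 l =
      (-1 : K) ^ (i * (degSum l + n - l.length)) • (f.1 l ∘ₗ U.sgn i) := by
  apply U.hom_ext
  intro d u
  simp only [LinearMap.comp_apply, LinearMap.smul_apply, U.sgn_apply _ u.2,
    U.sgn_apply _ (hf.1 l d u u.2), map_smul, smul_smul]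
  rw [← zpow_add₀ (by norm_num)]
  ring_nf

theorem varrho_comp_ell (L : HomotopyLie g) (f : IFam g U V) (a b : List (HEl g)) :
    (varrho f).1 a ∘ₗ (ellAt L U).1 b =
      (-1 : K) ^ (a.length + 1) • f.1 (a ++ [homogeneousValue L.ell_deg b]) := by
  rw [← last_apply]
  ext u
  rfl

/-- The map `A ↦ A ⊗ 1`. -/
def mapLeft (U V : GrVect K) : (U.carrier →ₗ[K] U.carrier) →ₗ[K]
    ((U.tensor V).carrier →ₗ[K] (U.tensor V).carrier) :=
  (TensorProduct.mapBilinear (.id K) U.carrier V.carrier U.carrier V.carrier).flip LinearMap.id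

/-- The map `B ↦ T ⊗ B`. -/
def mapRight (U V : GrVect K) (T : U.carrier →ₗ[K] U.carrier) : (V.carrier →ₗ[K] V.carrier) →ₗ[K]
    ((U.tensor V).carrier →ₗ[K] (U.tensor V).carrier) :=
  TensorProduct.mapBilinear (.id K) U.carrier V.carrier U.carrier V.carrier T

theorem mapLeft_apply (U V : GrVect K) (A : U.carrier →ₗ[K] U.carrier) :
    mapLeft U V A = TensorProduct.map A LinearMap.id := rfl

theorem mapRight_apply (U V : GrVect K) (T : U.carrier →ₗ[K] U.carrier)
    (B : V.carrier →ₗ[K] V.carrier) : mapRight U V T B = TensorProduct.map T B := rfl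

theorem rhoTensor_comp_ell (L : HomotopyLie g) (rU : IFam g U U) (rV : IFam g V V)
    (l : List (HEl g)) :
    (comp 0 2 (varrho (rhoTensor rU rV)) (ellAt L (U.tensor V))).1 l =
      mapLeft U V ((comp 0 2 (varrho rU) (ellAt L U)).1 l) +
      mapRight U V (U.sgn (2 - l.length + degSum l)) ((comp 0 2 (varrho rV) (ellAt L V)).1 l) := by
  rw [map_comp_apply, map_comp_apply, comp_apply, ← List.sum_map_add]
  congr 1
  refine List.map_congr_left fun s hs => ?_
  obtain ⟨e1, e2⟩ := shuffles_lengths hs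
  rw [← smul_add]
  congr 1
  rw [varrho_comp_ell, varrho_comp_ell, varrho_comp_ell, rhoTensor_apply, smul_add,
    map_smul, map_smul, mapLeft_apply, mapRight_apply]
  congr 4
  rw [← e1, ← e2]
  simp [homogeneousValue]
  ring

theorem rhoTensor_comp_rhoTensor {rU : IFam g U U} {rV : IFam g V V}
    (hU : rU ∈ Hom g U U 1) (l : List (HEl g)) :
    (comp 1 1 (rhoTensor rU rV) (rhoTensor rU rV)).1 l =
      mapLeft U V ((comp 1 1 rU rU).1 l) +
      mapRight U V (U.sgn (2 - l.length + degSum l)) ((comp 1 1 rV rV).1 l) := by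
  have h1 : (-1 : K) ≠ 0 := by norm_num
  let c (s : K × List (HEl g) × List (HEl g)) : K :=
    s.1 * (-1 : K) ^ ((1 - s.2.1.length : ℤ) * s.2.2.length + (1 - s.2.2.length) * degSum s.2.1)
  let k (a : List (HEl g)) : ℤ := 1 - a.length + degSum a
  let Φ (a b : List (HEl g)) : (U.tensor V).carrier →ₗ[K] (U.tensor V).carrier :=
    TensorProduct.map (rU.1 a ∘ₗ U.sgn (k b)) (rV.1 b)
  have e : ∀ s ∈ shuffles l,
      c s • ((rhoTensor rU rV).1 s.2.1 ∘ₗ (rhoTensor rU rV).1 s.2.2) =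
      (c s • mapLeft U V (rU.1 s.2.1 ∘ₗ rU.1 s.2.2) +
        c s • mapRight U V (U.sgn (2 - l.length + degSum l)) (rV.1 s.2.1 ∘ₗ rV.1 s.2.2)) +
      (c s • Φ s.2.1 s.2.2 + (c s * (-1 : K) ^ (k s.2.1 * k s.2.2)) • Φ s.2.2 s.2.1) := by
    intro s hs
    obtain ⟨e1, e2⟩ := shuffles_lengths hs
    have e3 : U.sgn (k s.2.1) ∘ₗ rU.1 s.2.2 =
        (-1 : K) ^ (k s.2.1 * k s.2.2) • (rU.1 s.2.2 ∘ₗ U.sgn (k s.2.1)) := by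
      rw [sgn_comp_of_graded hU]
      congr 2
      simp only [k]
      ring
    have e4 : U.sgn (k s.2.1) ∘ₗ U.sgn (k s.2.2) = U.sgn (2 - l.length + degSum l) := by
      rw [sgn_comp_sgn, ← e1, ← e2]
      congr 1
      simp only [k]
      push_cast
      ring
    have main : (rhoTensor rU rV).1 s.2.1 ∘ₗ (rhoTensor rU rV).1 s.2.2 =
        (mapLeft U V (rU.1 s.2.1 ∘ₗ rU.1 s.2.2) +
        mapRight U V (U.sgn (2 - l.length + degSum l)) (rV.1 s.2.1 ∘ₗ rV.1 s.2.2)) +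
        (Φ s.2.1 s.2.2 + (-1 : K) ^ (k s.2.1 * k s.2.2) • Φ s.2.2 s.2.1) := by
      rw [rhoTensor_apply, rhoTensor_apply, LinearMap.add_comp, LinearMap.comp_add,
        LinearMap.comp_add]
      simp only [← TensorProduct.map_comp, LinearMap.id_comp, LinearMap.comp_id]
      rw [show U.sgn (1 - (s.2.1.length : ℤ) + degSum s.2.1) = U.sgn (k s.2.1) from rfl,
        show U.sgn (1 - (s.2.2.length : ℤ) + degSum s.2.2) = U.sgn (k s.2.2) from rfl, e3, e4,
        TensorProduct.map_smul_left, mapLeft_apply, mapRight_apply]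
      abel
    rw [main, mul_smul (c s), smul_add (c s), smul_add (c s), smul_add (c s)]
  rw [map_comp_apply, map_comp_apply, comp_apply]
  change ((shuffles l).map fun s => c s • ((rhoTensor rU rV).1 s.2.1 ∘ₗ
    (rhoTensor rU rV).1 s.2.2)).sum = _
  rw [List.map_congr_left e, List.sum_map_add, List.sum_map_add, List.sum_map_add]
  have z : ((shuffles l).map fun s => c s • Φ s.2.1 s.2.2).sum +
      ((shuffles l).map fun s => (c s * (-1 : K) ^ (k s.2.1 * k s.2.2)) • Φ s.2.2 s.2.1).sum = 0 := by
    rw [sum_shuffles_symm l fun s => (c s * (-1 : K) ^ (k s.2.1 * k s.2.2)) • Φ s.2.2 s.2.1,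
      ← List.sum_map_add]
    apply List.sum_eq_zero
    intro y hy
    obtain ⟨s, _, rfl⟩ := List.mem_map.mp hy
    rw [← add_smul]
    convert zero_smul K _
    simp only [c, k, mul_assoc, ← zpow_add₀ h1]
    rw [← mul_add]
    convert mul_zero s.1
    have hneg : ∀ j : ℤ, -((-1 : K) ^ j) = (-1 : K) ^ (1 + j) := fun j => by
      rw [zpow_one_add₀ h1]; ring
    rw [add_eq_zero_iff_eq_neg, hneg]
    apply negOnePow_congr
    exact ⟨s.2.2.length - s.2.1.length * s.2.2.length - 1 - degSum s.2.1 * degSum s.2.2 -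
      degSum s.2.2 + s.2.1.length * degSum s.2.2, by ring⟩
  rw [z, add_zero]

theorem rhoTensor_square (L : HomotopyLie g) {rU : IFam g U U} {rV : IFam g V V}
    (hU : rU ∈ Hom g U U 1)
    (eU : comp 1 1 rU rU = comp 0 2 (varrho rU) (ellAt L U))
    (eV : comp 1 1 rV rV = comp 0 2 (varrho rV) (ellAt L V)) :
    comp 1 1 (rhoTensor rU rV) (rhoTensor rU rV) =
      comp 0 2 (varrho (rhoTensor rU rV)) (ellAt L (U.tensor V)) := by
  apply Subtype.ext
  funext l
  rw [rhoTensor_comp_rhoTensor hU, rhoTensor_comp_ell, eU, eV]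

/-- A representation of the homotopy Lie algebra `(g, ℓ)`: a graded vector space `V` with an
intertwiner `ρ : V ⇝ V[1]` such that `ρ ρ = ϱ_ρ ℓ_V`. -/
structure HRep (L : HomotopyLie g) where
  V : GrVect K
  rho : IFam g V V
  rho_mem : rho ∈ Hom g V V 1
  rho_rho : comp 1 1 rho rho = comp 0 2 (varrho rho) (ellAt L V)

/-- The monoidal product of representations. -/
abbrev HRep.tensor {L : HomotopyLie g} (U V : HRep L) : HRep L where
  V := U.V.tensor V.V
  rho := rhoTensor U.rho V.rho
  rho_mem := rhoTensor_mem U.rho_mem V.rho_mem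
  rho_rho := rhoTensor_square L U.rho_mem U.rho_rho V.rho_rho

/-! ### The homotopy 2-category of representations -/

variable {L : HomotopyLie g}

/-- The differential `∂ f = ρ_V f - (-1) ^ n f ρ_U - ϱ_f ℓ_U` of an intertwiner `f : U ⇝ V[n]`. -/
def diff (U V : HRep L) (n : ℤ) (f : IFam g U.V V.V) : IFam g U.V V.V :=
  comp 1 n V.rho f - (-1 : K) ^ n • comp n 1 f U.rho - comp (n - 1) 2 (varrho f) (ellAt L U.V)

/-- Equivariant maps: the intertwiners of degree `0` with vanishing differential. They are the
morphisms of degree `0` of the homotopy 2-category. -/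
def IsEquivariant (U V : HRep L) (f : IFam g U.V V.V) : Prop :=
  f ∈ Hom g U.V V.V 0 ∧ diff U V 0 f = 0

/-- Equality of morphisms of degree `-1` of the homotopy 2-category: equality of intertwiners of
degree `-1` up to differentials of intertwiners of degree `-2`. -/
def HEq₂ (U V : HRep L) (f h : IFam g U.V V.V) : Prop :=
  ∃ k ∈ Hom g U.V V.V (-2), f - h = diff U V (-2) k

/-- The data of a pseudonatural transformation `t : ⊙ ⇒ ⊙` of the monoidal product of the homotopy
2-category: the components `t_{U,V}` and `t_{f,h}`. -/
structure Transf (L : HomotopyLie g) where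
  obj : ∀ U V : HRep L, IFam g (U.V.tensor V.V) (U.V.tensor V.V)
  hom : ∀ U U' V V' : HRep L, IFam g U.V U'.V → IFam g V.V V'.V →
    IFam g (U.V.tensor V.V) (U'.V.tensor V'.V)

/-- The axioms of a pseudonatural transformation `t : ⊙ ⇒ ⊙`. -/
structure IsPseudonatural (t : Transf L) : Prop where
  obj_mem : ∀ U V, IsEquivariant (U.tensor V) (U.tensor V) (t.obj U V)
  hom_mem : ∀ U U' V V' f h, IsEquivariant U U' f → IsEquivariant V V' h →
    t.hom U U' V V' f h ∈ Hom g (U.tensor V).V (U'.tensor V').V (-1)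
  hom_add_left : ∀ U U' V V' f f' h,
    IsEquivariant U U' f → IsEquivariant U U' f' → IsEquivariant V V' h →
    HEq₂ (U.tensor V) (U'.tensor V') (t.hom U U' V V' (f + f') h)
      (t.hom U U' V V' f h + t.hom U U' V V' f' h)
  hom_add_right : ∀ U U' V V' f h h',
    IsEquivariant U U' f → IsEquivariant V V' h → IsEquivariant V V' h' →
    HEq₂ (U.tensor V) (U'.tensor V') (t.hom U U' V V' f (h + h'))
      (t.hom U U' V V' f h + t.hom U U' V V' f h')
  hom_smul_left : ∀ U U' V V' (c : K) f h, IsEquivariant U U' f → IsEquivariant V V' h →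
    HEq₂ (U.tensor V) (U'.tensor V') (t.hom U U' V V' (c • f) h) (c • t.hom U U' V V' f h)
  hom_smul_right : ∀ U U' V V' (c : K) f h, IsEquivariant U U' f → IsEquivariant V V' h →
    HEq₂ (U.tensor V) (U'.tensor V') (t.hom U U' V V' f (c • h)) (c • t.hom U U' V V' f h)
  /-- `(f ⊙ h) t_{U,V} - t_{U',V'} (f ⊙ h) = ∂ t_{f,h}` if `f` and `h` have degree `0`. -/
  natural : ∀ U U' V V' f h, IsEquivariant U U' f → IsEquivariant V V' h →
    comp 0 0 (odot 0 0 f h) (t.obj U V) - comp 0 0 (t.obj U' V') (odot 0 0 f h) =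
      diff (U.tensor V) (U'.tensor V') (-1) (t.hom U U' V V' f h)
  /-- `(f ⊙ h) t_{U,V} - t_{U',V'} (f ⊙ h) = t_{∂f,h}` if `f` has degree `-1`. -/
  natural_left : ∀ (U U' V V' : HRep L) (f : IFam g U.V U'.V) (h : IFam g V.V V'.V),
    f ∈ Hom g U.V U'.V (-1) → IsEquivariant V V' h →
    HEq₂ (U.tensor V) (U'.tensor V')
      (comp (-1) 0 (odot (-1) 0 f h) (t.obj U V) - comp 0 (-1) (t.obj U' V') (odot (-1) 0 f h))
      (t.hom U U' V V' (diff U U' (-1) f) h)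
  /-- `(f ⊙ h) t_{U,V} - t_{U',V'} (f ⊙ h) = t_{f,∂h}` if `h` has degree `-1`. -/
  natural_right : ∀ (U U' V V' : HRep L) (f : IFam g U.V U'.V) (h : IFam g V.V V'.V),
    IsEquivariant U U' f → h ∈ Hom g V.V V'.V (-1) →
    HEq₂ (U.tensor V) (U'.tensor V')
      (comp (-1) 0 (odot 0 (-1) f h) (t.obj U V) - comp 0 (-1) (t.obj U' V') (odot 0 (-1) f h))
      (t.hom U U' V V' f (diff V V' (-1) h))
  /-- `t_{f'f,h'h} = t_{f',h'} (f ⊙ h) + (f' ⊙ h') t_{f,h}`. -/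
  hom_comp : ∀ U U' U'' V V' V'' f f' h h', IsEquivariant U U' f → IsEquivariant U' U'' f' →
    IsEquivariant V V' h → IsEquivariant V' V'' h' →
    HEq₂ (U.tensor V) (U''.tensor V'') (t.hom U U'' V V'' (comp 0 0 f' f) (comp 0 0 h' h))
      (comp (-1) 0 (t.hom U' U'' V' V'' f' h') (odot 0 0 f h) +
        comp 0 (-1) (odot 0 0 f' h') (t.hom U U' V V' f h))

/-- The conjugate `U ⊗ (V ⊗ W) → (U ⊗ V) ⊗ W → (U' ⊗ V') ⊗ W' → U' ⊗ (V' ⊗ W')` of an intertwiner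
of degree `n` by the associators. -/
def toRight (n : ℤ) {U V W U' V' W' : GrVect K}
    (F : IFam g ((U.tensor V).tensor W) ((U'.tensor V').tensor W')) :
    IFam g (U.tensor (V.tensor W)) (U'.tensor (V'.tensor W')) :=
  comp 0 n (assoc g U' V' W') (comp n 0 F (assocInv g U V W))

/-- The conjugate `(U ⊗ V) ⊗ W → U ⊗ (V ⊗ W) → U' ⊗ (V' ⊗ W') → (U' ⊗ V') ⊗ W'` of an intertwiner
of degree `n` by the associators. -/
def toLeft (n : ℤ) {U V W U' V' W' : GrVect K}
    (F : IFam g (U.tensor (V.tensor W)) (U'.tensor (V'.tensor W'))) :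
    IFam g ((U.tensor V).tensor W) ((U'.tensor V').tensor W') :=
  comp 0 n (assocInv g U' V' W') (comp n 0 F (assoc g U V W))

/-- `(1_U' ⊙ γ_{W',V'}) F (1_U ⊙ γ_{V,W})`, for `F` of degree `n`. -/
def conjRight (n : ℤ) {U V W U' V' W' : GrVect K}
    (F : IFam g (U.tensor (W.tensor V)) (U'.tensor (W'.tensor V'))) :
    IFam g (U.tensor (V.tensor W)) (U'.tensor (V'.tensor W')) :=
  comp 0 n (odot 0 0 (one g U') (braid g W' V'))
    (comp n 0 F (odot 0 0 (one g U) (braid g V W)))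

/-- `(γ_{V',U'} ⊙ 1_W') F (γ_{U,V} ⊙ 1_W)`, for `F` of degree `n`. -/
def conjLeft (n : ℤ) {U V W U' V' W' : GrVect K}
    (F : IFam g ((V.tensor U).tensor W) ((V'.tensor U').tensor W')) :
    IFam g ((U.tensor V).tensor W) ((U'.tensor V').tensor W') :=
  comp 0 n (odot 0 0 (braid g V' U') (one g W'))
    (comp n 0 F (odot 0 0 (braid g U V) (one g W)))

/-- A pseudonatural transformation `t : ⊙ ⇒ ⊙` is an infinitesimal 2-braiding if it satisfies the
left and the right infinitesimal hexagon relations. -/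
structure IsInfinitesimal2Braiding (t : Transf L) : Prop extends IsPseudonatural t where
  left_obj : ∀ U V W : HRep L, t.obj U (V.tensor W) =
    toRight 0 (odot 0 0 (t.obj U V) (one g W.V)) +
      conjRight 0 (toRight 0 (odot 0 0 (t.obj U W) (one g V.V)))
  left_hom : ∀ (U U' V V' W W' : HRep L) f h k,
    IsEquivariant U U' f → IsEquivariant V V' h → IsEquivariant W W' k →
    HEq₂ (U.tensor (V.tensor W)) (U'.tensor (V'.tensor W'))
      (t.hom U U' (V.tensor W) (V'.tensor W') f (odot 0 0 h k))
      (toRight (-1) (odot (-1) 0 (t.hom U U' V V' f h) k) +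
        conjRight (-1) (toRight (-1) (odot (-1) 0 (t.hom U U' W W' f k) h)))
  right_obj : ∀ U V W : HRep L, t.obj (U.tensor V) W =
    toLeft 0 (odot 0 0 (one g U.V) (t.obj V W)) +
      conjLeft 0 (toLeft 0 (odot 0 0 (one g V.V) (t.obj U W)))
  right_hom : ∀ (U U' V V' W W' : HRep L) f h k,
    IsEquivariant U U' f → IsEquivariant V V' h → IsEquivariant W W' k →
    HEq₂ ((U.tensor V).tensor W) ((U'.tensor V').tensor W')
      (t.hom (U.tensor V) (U'.tensor V') W W' (odot 0 0 f h) k)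
      (toLeft (-1) (odot 0 (-1) f (t.hom V V' W W' h k)) +
        conjLeft (-1) (toLeft (-1) (odot 0 (-1) h (t.hom U U' W W' f k))))

/-- `γ`-equivariance: `γ_{U,V} t_{U,V} = t_{V,U} γ_{U,V}` and
`γ_{U',V'} t_{f,h} = t_{h,f} γ_{U,V}`. -/
structure IsGammaEquivariant (t : Transf L) : Prop where
  obj : ∀ U V : HRep L, comp 0 0 (braid g U.V V.V) (t.obj U V) =
    comp 0 0 (t.obj V U) (braid g U.V V.V)
  hom : ∀ (U U' V V' : HRep L) f h, IsEquivariant U U' f → IsEquivariant V V' h →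
    HEq₂ (U.tensor V) (V'.tensor U')
      (comp 0 (-1) (braid g U'.V V'.V) (t.hom U U' V V' f h))
      (comp (-1) 0 (t.hom V V' U U' h f) (braid g U.V V.V))

/-- Total `γ`-equivariance: `t_{γ_{U,V}, 1_W} = 0`. -/
def IsTotallyGammaEquivariant (t : Transf L) : Prop :=
  ∀ U V W : HRep L, HEq₂ ((U.tensor V).tensor W) ((V.tensor U).tensor W)
    (t.hom (U.tensor V) (V.tensor U) W W (braid g U.V V.V) (one g W.V)) 0

/-- Coherence:
`t_{t_{U,V}, 1_W} + t_{1_U, t_{V,W}} + (1_U ⊙ γ_{W,V}) t_{t_{U,W}, 1_V} (1_U ⊙ γ_{V,W}) = 0`. -/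
def IsCoherent (t : Transf L) : Prop :=
  ∀ U V W : HRep L, HEq₂ (U.tensor (V.tensor W)) (U.tensor (V.tensor W))
    (toRight (-1) (t.hom (U.tensor V) (U.tensor V) W W (t.obj U V) (one g W.V)) +
      t.hom U U (V.tensor W) (V.tensor W) (one g U.V) (t.obj V W) +
      conjRight (-1) (toRight (-1)
        (t.hom (U.tensor W) (U.tensor W) V V (t.obj U W) (one g V.V)))) 0

/-! ### The transformation induced by a 2-shifted Poisson structure -/

/-- The intertwiner `ϖ₂ : K ⇝ g ⊗ g`, with `ϖ₂^i = (-1) ^ i π₂^{i-1}`. -/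
def varpi (P : ShiftedPoisson L) : IFam g (GrVect.ground K) (g.tensor g) :=
  postcomp (fun k => (-1 : K) ^ (k + 1) •
    ((LinearMap.ringLmapEquivSelf K K (g.carrier ⊗[K] g.carrier)).symm.toLinearMap ∘ₗ
      TensorProduct.map LinearMap.id (TensorProduct.rid K g.carrier).toLinearMap)) (P.p 0)

/-- The intertwiner `1_U ⊙ ϖ₂ ⊙ 1_V : U ⊗ V ⇝ (U ⊗ g) ⊗ (g ⊗ V)`. -/
def insertion (P : ShiftedPoisson L) (U V : GrVect K) :
    IFam g (U.tensor V) ((U.tensor g).tensor (g.tensor V)) :=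
  comp 0 0 (strict ((TensorProduct.assoc K (U.carrier ⊗[K] g.carrier) g.carrier
      V.carrier).toLinearMap ∘ₗ TensorProduct.map
        (TensorProduct.assoc K U.carrier g.carrier g.carrier).symm.toLinearMap LinearMap.id))
    (comp 0 0 (odot 0 0 (odot 0 0 (one g U) (varpi P)) (one g V))
      (strict (TensorProduct.map (TensorProduct.rid K U.carrier).symm.toLinearMap LinearMap.id)))

/-- The action `ϱ_U : g ⊗ U ⇝ U` of a representation, with `ϱ_U^i = (-1) ^ (i-1) ρ_U^{i+1}`. -/
def varrhoObj (U : HRep L) : IFam g (g.tensor U.V) U.V := -varrho U.rho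

/-- The right action `λ_U = ϱ_U γ_{U,g} : U ⊗ g ⇝ U`. -/
def lamObj (U : HRep L) : IFam g (U.V.tensor g) U.V := comp 0 0 (varrhoObj U) (braid g U.V g)

/-- The intertwiner `λ_f = ϱ_f γ_{U,g}`, for `f` of degree `0`. -/
def lam (f : IFam g U V) : IFam g (U.tensor g) V := comp (-1) 0 (varrho f) (braid g U g)

/-- The transformation `t` with `t_{U,V} = (λ_U ⊙ ϱ_V) (1_U ⊙ ϖ₂ ⊙ 1_V)` and
`t_{f,h} = (λ_f ⊙ h ϱ_V + λ_{U'} (f ⊙ 1_g) ⊙ ϱ_h) (1_U ⊙ ϖ₂ ⊙ 1_V)`. -/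
def inducedTransf (P : ShiftedPoisson L) : Transf L where
  obj U V := comp 0 0 (odot 0 0 (lamObj U) (varrhoObj V)) (insertion P U.V V.V)
  hom U U' V _ f h := comp (-1) 0
    (odot (-1) 0 (lam f) (comp 0 0 h (varrhoObj V)) +
      odot 0 (-1) (comp 0 0 (lamObj U') (odot 0 0 f (one g g))) (varrho h))
    (insertion P U.V V.V)

end Structures

end HLie

end

/-! The whole proof runs on one operation. The derivative `varrho` turns an intertwiner F into ϱ_F,
whose last input from 𝔤 has become part of the module. It is an odd derivation for composition
(`varrho_comp`), and its square is skew under the swap of the two new factors of 𝔤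
(`varrho_varrho_swp`). Let `biv` : T ⇝ 𝔤 ⊗ (𝔤 ⊗ T) be the insertion of π₂. The bracket {F, G} = ϱ_F
(1 ⊙ ϱ_G) `biv`, called `brk`, then gives t_{U,V} = {ρ_U ⊙ 1, 1 ⊙ ρ_V} and t_{f,h} = -(1 ⊙ h){f ⊙ 1,
1 ⊙ ρ_V} - {ρ_{U'} ⊙ 1, 1 ⊙ h}(f ⊙ 1) (`inducedTransf_obj`, `inducedTransf_hom`). Since π₂ is
symmetric, the bracket is graded symmetric on arguments that commute up to Koszul signs
(`brk_swap`).

Weight two of the Maurer-Cartan equation says that `biv` is closed (`pdiff_biv`), so the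
differential of a bracket only involves the differentials of ϱ_F and ϱ_G. These are given by ∂ϱ_F =
-ϱ_{∂F} + ϱ_{ρ_V}(1 ⊙ F) - F ϱ_{ρ_U} (`pdiff_varrho`). On U ⊗ V the structure map is a sum R + S of
two anticommuting actions, and an F acting on the first factor commutes with S. Hence ∂{F, S} =
-{∂F, S} + {R', S'}F - F{R, S} (`pdiff_brk_action_right`), with a mirror image for the second
factor; this is pseudonaturality. For equivariant f and h the differential of {f ⊙ 1, 1 ⊙ h} has
four terms (`pdiff_brk_of_closed`). They are the defect of t with respect to composition, and also
with respect to γ.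

Associators and braidings have no inputs from 𝔤, so their derivatives vanish and brackets can be
transported along them. Bilinearity, the hexagons and total γ-equivariance therefore hold without
any homotopy.

Coherence is a Jacobi identity up to homotopy. Let A, B, C be the actions on the three factors of U
⊗ V ⊗ W. In {{A,B},C} + {A,{B,C}} + {{A,C},B} all second derivatives cancel, by their skewness and
the symmetry of the bivectors. What remains is ϱ_A ϱ_B ϱ_C applied to a symmetrisation of π₂ ∘ π₂
(`brk_jacobi`). By weight three of the Maurer-Cartan equation this symmetrisation is the
differential of the insertion `tri` of π₃ (`pdiff_tri`). As ϱ_A, ϱ_B, ϱ_C are closed, the sum is the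
differential of ϱ_A ϱ_B ϱ_C `tri` (`brk_jacobi_eq_pdiff`). -/

noncomputable section
namespace HLie

/-! ### Convolution over shuffles: bilinearity, skew-symmetry, associativity. -/

section Convolution

variable {K : Type u} [Field K] {g : GrVect K}
variable {X Y Z : Type u} [AddCommGroup X] [Module K X] [AddCommGroup Y] [Module K Y]
  [AddCommGroup Z] [Module K Z]

/-- Comparing exponents in `ZMod 2` turns the sign checks below into polynomial identities over the
field with two elements. -/
theorem neg_one_zpow_congr {i j : ℤ} (h : (i : ZMod 2) = (j : ZMod 2)) :
    (-1 : K) ^ i = (-1 : K) ^ j :=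
  negOnePow_congr (by
    rw [← ZMod.intCast_eq_zero_iff_even, Int.cast_sub, h, sub_self])

theorem convFun_add_left (m n : ℤ) (B : ℤ → X →ₗ[K] Y →ₗ[K] Z) (G G' : List (HEl g) → X)
    (F : List (HEl g) → Y) : convFun m n B (G + G') F = convFun m n B G F + convFun m n B G' F := by
  funext l
  simp only [convFun, Pi.add_apply, map_add, LinearMap.add_apply, smul_add, List.sum_map_add]

theorem convFun_add_right (m n : ℤ) (B : ℤ → X →ₗ[K] Y →ₗ[K] Z) (G : List (HEl g) → X)
    (F F' : List (HEl g) → Y) :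
    convFun m n B G (F + F') = convFun m n B G F + convFun m n B G F' := by
  funext l
  simp only [convFun, Pi.add_apply, map_add, smul_add, List.sum_map_add]

theorem convFun_smul_left (m n : ℤ) (B : ℤ → X →ₗ[K] Y →ₗ[K] Z) (c : K) (G : List (HEl g) → X)
    (F : List (HEl g) → Y) : convFun m n B (c • G) F = c • convFun m n B G F := by
  funext l
  simp only [convFun, Pi.smul_apply, map_smul, LinearMap.smul_apply, List.smul_sum, List.map_map,
    Function.comp_def, smul_comm c]

theorem convFun_smul_right (m n : ℤ) (B : ℤ → X →ₗ[K] Y →ₗ[K] Z) (c : K) (G : List (HEl g) → X)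
    (F : List (HEl g) → Y) : convFun m n B G (c • F) = c • convFun m n B G F := by
  funext l
  simp only [convFun, Pi.smul_apply, map_smul, List.smul_sum, List.map_map,
    Function.comp_def, smul_comm c]

theorem IsSkew.cons {f : List (HEl g) → X} (hf : IsSkew f) (x : HEl g) :
    IsSkew fun l => f (x :: l) := fun a b y z => hf (x :: a) b y z

/-- Two adjacent inputs go both into G, both into F, or one into each. The first two cases are the
skewness of G and F; the mixed shuffles come in pairs that the transposition exchanges. Removing the
inputs in front of the pair shifts the degrees, hence the generalisation over m and n. -/
theorem convFun_skew (m n : ℤ) (B : ℤ → X →ₗ[K] Y →ₗ[K] Z) {G : List (HEl g) → X}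
    {F : List (HEl g) → Y} (hG : IsSkew G) (hF : IsSkew F) : IsSkew (convFun m n B G F) := by
  have h1 : (-1 : K) ≠ 0 := by norm_num
  intro a
  induction a generalizing m n G F with
  | nil =>
    intro b x y
    have eG : (fun a => G (x :: y :: a)) = (-(-1 : K) ^ (x.d * y.d)) • fun a => G (y :: x :: a) :=
      funext fun a => hG [] a x y
    have eF : (fun a => F (x :: y :: a)) = (-(-1 : K) ^ (x.d * y.d)) • fun a => F (y :: x :: a) :=
      funext fun a => hF [] a x y
    simp only [List.nil_append, convFun_cons, eG, eF, convFun_smul_left, convFun_smul_right,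
      Pi.smul_apply, smul_add, smul_smul]
    rw [show m + x.d - 1 + y.d - 1 = m + y.d - 1 + x.d - 1 by ring,
      show n + x.d - 1 + y.d - 1 = n + y.d - 1 + x.d - 1 by ring]
    have key : ∀ (i j : ℤ), (i : ZMod 2) = (j : ZMod 2) + 1 → (-1 : K) ^ i = -(-1 : K) ^ j := by
      intro i j h
      rw [neg_one_zpow_congr (j := j + 1) (by rw [h]; push_cast; ring), zpow_add₀ h1]
      simp
    -- The mixed terms: x goes into G and y into F, read off in the two possible orders. The
    -- identity after this one has the roles of x and y exchanged.
    have c2 : (-1 : K) ^ (n * x.d) * (-1) ^ (m + x.d - 1) =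
        -(-1) ^ (x.d * y.d) * ((-1) ^ m * (-1) ^ ((n + y.d - 1) * x.d)) := by
      simp only [neg_mul, ← zpow_add₀ h1]
      apply key
      push_cast
      grind
    have c3 : (-1 : K) ^ m * (-1) ^ ((n + x.d - 1) * y.d) =
        -(-1) ^ (x.d * y.d) * ((-1) ^ (n * y.d) * (-1) ^ (m + y.d - 1)) := by
      simp only [neg_mul, ← zpow_add₀ h1]
      apply key
      push_cast
      grind
    rw [c2, c3]
    module
  | cons z a ih =>
    intro b x y
    simp only [List.cons_append, convFun_cons, smul_add]
    rw [ih _ _ (hG.cons z) hF b x y, ih _ _ hG (hF.cons z) b x y, smul_comm, smul_comm ((-1 : K) ^ m)]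

/-- Composition of families of linear maps, on the level of functions. -/
theorem convFun_assoc {A B C D : Type u} [AddCommGroup A] [Module K A] [AddCommGroup B] [Module K B]
    [AddCommGroup C] [Module K C] [AddCommGroup D] [Module K D]
    (m n p mn np : ℤ) (hmn : mn = m + n) (hnp : np = n + p)
    (H : List (HEl g) → C →ₗ[K] D) (G : List (HEl g) → B →ₗ[K] C) (F : List (HEl g) → A →ₗ[K] B)
    (l : List (HEl g)) :
    convFun mn p (fun _ => LinearMap.llcomp K A B D)
      (convFun m n (fun _ => LinearMap.llcomp K B C D) H G) F l =
    convFun m np (fun _ => LinearMap.llcomp K A C D) H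
      (convFun n p (fun _ => LinearMap.llcomp K A B C) G F) l := by
  have h1 : (-1 : K) ≠ 0 := by norm_num
  -- The first input goes into H, G or F, which gives three terms on each side. The map that
  -- receives it changes its degree by `x.d - 1`, and the induction hypothesis applies to each term.
  induction l generalizing m n p mn np H G F with
  | nil =>
    simp [convFun, shuffles]
    rfl
  | cons x l ih =>
    have e1 : (fun a => convFun m n (fun _ => LinearMap.llcomp K B C D) H G (x :: a)) =
        (-1 : K) ^ (n * x.d) • convFun (m + x.d - 1) n (fun _ => LinearMap.llcomp K B C D)
          (fun a => H (x :: a)) G +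
        (-1 : K) ^ m • convFun m (n + x.d - 1) (fun _ => LinearMap.llcomp K B C D) H
          (fun a => G (x :: a)) := funext fun a => convFun_cons ..
    have e2 : (fun a => convFun n p (fun _ => LinearMap.llcomp K A B C) G F (x :: a)) =
        (-1 : K) ^ (p * x.d) • convFun (n + x.d - 1) p (fun _ => LinearMap.llcomp K A B C)
          (fun a => G (x :: a)) F +
        (-1 : K) ^ n • convFun n (p + x.d - 1) (fun _ => LinearMap.llcomp K A B C) G
          (fun a => F (x :: a)) := funext fun a => convFun_cons ..
    rw [convFun_cons, convFun_cons, e1, e2]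
    simp only [convFun_add_left, convFun_add_right, convFun_smul_left, convFun_smul_right,
      Pi.add_apply, Pi.smul_apply, smul_add, smul_smul]
    rw [ih (m + x.d - 1) n p _ np (by rw [hmn]; ring) hnp,
      ih m (n + x.d - 1) p _ (np + x.d - 1) (by rw [hmn]; ring) (by rw [hnp]; ring),
      ih m n (p + x.d - 1) mn (np + x.d - 1) hmn (by rw [hnp]; ring), add_assoc]
    subst hmn hnp
    simp only [← zpow_add₀ h1]
    ring_nf

end Convolution
end HLie
end

noncomputable section
namespace HLie

/-! ### Composition of intertwiners, maps without inputs, and the derivative. -/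

section Intertwiners

variable {K : Type u} [Field K] {g U V W U' V' W' : GrVect K}

theorem neg_one_ne_zero' : (-1 : K) ≠ 0 := by norm_num

theorem IFam.ext {F G : IFam g U V} (h : ∀ l, F.1 l = G.1 l) : F = G := Subtype.ext (funext h)

theorem IFam.add_apply (F G : IFam g U V) (l : List (HEl g)) : (F + G).1 l = F.1 l + G.1 l := rfl

theorem IFam.neg_apply (F : IFam g U V) (l : List (HEl g)) : (-F).1 l = -F.1 l := rfl

theorem IFam.smul_apply (c : K) (F : IFam g U V) (l : List (HEl g)) : (c • F).1 l = c • F.1 l := rfl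

theorem IFam.neg_one_smul (F : IFam g U V) : (-1 : K) • F = -F := _root_.neg_one_smul K F

theorem GrVect.tensor_hom_ext {X : Type u} [AddCommGroup X] [Module K X]
    {φ ψ : U.carrier ⊗[K] V.carrier →ₗ[K] X}
    (h : ∀ (p : ℤ), ∀ u ∈ U.deg p, ∀ (q : ℤ), ∀ v ∈ V.deg q, φ (u ⊗ₜ v) = ψ (u ⊗ₜ v)) :
    φ = ψ := by
  apply TensorProduct.ext
  apply U.hom_ext
  intro p u
  apply V.hom_ext
  intro q v
  exact h p u u.2 q v v.2

theorem GrVect.tensor_hom_ext_left {X : Type u} [AddCommGroup X] [Module K X]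
    {φ ψ : U.carrier ⊗[K] V.carrier →ₗ[K] X}
    (h : ∀ (p : ℤ) (u : U.deg p) (v : V.carrier), φ ((u : U.carrier) ⊗ₜ v) = ψ ((u : U.carrier) ⊗ₜ v)) :
    φ = ψ := by
  apply TensorProduct.ext
  apply U.hom_ext
  intro p u
  ext v
  exact h p u v

section Comp

variable (m n : ℤ)

theorem comp_add_left (G G' : IFam g V W) (F : IFam g U V) :
    comp m n (G + G') F = comp m n G F + comp m n G' F := by
  refine IFam.ext fun l => ?_
  rw [IFam.add_apply, comp_apply, comp_apply, comp_apply, ← List.sum_map_add]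
  simp only [IFam.add_apply, LinearMap.add_comp, smul_add]

theorem comp_add_right (G : IFam g V W) (F F' : IFam g U V) :
    comp m n G (F + F') = comp m n G F + comp m n G F' := by
  refine IFam.ext fun l => ?_
  rw [IFam.add_apply, comp_apply, comp_apply, comp_apply, ← List.sum_map_add]
  simp only [IFam.add_apply, LinearMap.comp_add, smul_add]

theorem comp_smul_left (c : K) (G : IFam g V W) (F : IFam g U V) :
    comp m n (c • G) F = c • comp m n G F := by
  refine IFam.ext fun l => ?_
  rw [IFam.smul_apply, comp_apply, comp_apply, List.smul_sum, List.map_map]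
  simp only [IFam.smul_apply, LinearMap.smul_comp, Function.comp_def, smul_comm c]

theorem comp_smul_right (c : K) (G : IFam g V W) (F : IFam g U V) :
    comp m n G (c • F) = c • comp m n G F := by
  refine IFam.ext fun l => ?_
  rw [IFam.smul_apply, comp_apply, comp_apply, List.smul_sum, List.map_map]
  simp only [IFam.smul_apply, LinearMap.comp_smul, Function.comp_def, smul_comm c]

theorem comp_neg_left (G : IFam g V W) (F : IFam g U V) : comp m n (-G) F = -comp m n G F := by
  rw [← IFam.neg_one_smul, comp_smul_left, IFam.neg_one_smul]

theorem comp_neg_right (G : IFam g V W) (F : IFam g U V) : comp m n G (-F) = -comp m n G F := by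
  rw [← IFam.neg_one_smul, comp_smul_right, IFam.neg_one_smul]

theorem comp_sub_left (G G' : IFam g V W) (F : IFam g U V) :
    comp m n (G - G') F = comp m n G F - comp m n G' F := by
  rw [sub_eq_add_neg, comp_add_left, comp_neg_left, sub_eq_add_neg]

theorem comp_sub_right (G : IFam g V W) (F F' : IFam g U V) :
    comp m n G (F - F') = comp m n G F - comp m n G F' := by
  rw [sub_eq_add_neg, comp_add_right, comp_neg_right, sub_eq_add_neg]

theorem comp_zero_left (F : IFam g U V) : comp m n (0 : IFam g V W) F = 0 := by
  rw [← sub_self (0 : IFam g V W), comp_sub_left, sub_self]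

theorem comp_zero_right (G : IFam g V W) : comp m n G (0 : IFam g U V) = 0 := by
  rw [← sub_self (0 : IFam g U V), comp_sub_right, sub_self]

variable {m n}

/-- The total degrees are variables tied by equations, so that numerals such as `-1` can stand where
a sum of degrees is meant. -/
theorem comp_assoc {p mn np : ℤ} (hmn : mn = m + n) (hnp : np = n + p) (H : IFam g W W')
    (G : IFam g V W) (F : IFam g U V) :
    comp mn p (comp m n H G) F = comp m np H (comp n p G F) :=
  IFam.ext fun l => convFun_assoc m n p mn np hmn hnp H.1 G.1 F.1 l

theorem strict_nil {X : Type u} [AddCommGroup X] [Module K X] (φ : X) :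
    (strict φ : Fam g X).1 [] = φ := rfl

theorem strict_cons {X : Type u} [AddCommGroup X] [Module K X] (φ : X) (x : HEl g)
    (l : List (HEl g)) : (strict φ : Fam g X).1 (x :: l) = 0 := rfl

theorem strict_of_ne_nil {X : Type u} [AddCommGroup X] [Module K X] (φ : X) {l : List (HEl g)}
    (h : l ≠ []) : (strict φ : Fam g X).1 l = 0 := by
  cases l with
  | nil => exact absurd rfl h
  | cons x l => rfl

theorem strict_comp_apply (φ : V.carrier →ₗ[K] W.carrier) (F : IFam g U V) (l : List (HEl g)) :
    (comp 0 n (strict φ) F).1 l = φ ∘ₗ F.1 l := by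
  rw [comp_apply, sum_shuffles_of_left]
  · simp [strict_nil φ]
  · intro s hs
    rw [strict_of_ne_nil φ hs, LinearMap.zero_comp, smul_zero]

theorem comp_strict_apply (F : IFam g V W) (φ : U.carrier →ₗ[K] V.carrier) (l : List (HEl g)) :
    (comp m 0 F (strict φ)).1 l = F.1 l ∘ₗ φ := by
  rw [comp_apply, sum_shuffles_of_right]
  · simp [strict_nil]
  · intro s hs
    rw [strict_of_ne_nil φ hs, LinearMap.comp_zero, smul_zero]

theorem one_comp (F : IFam g U V) : comp 0 n (one g V) F = F :=
  IFam.ext fun l => by rw [one, strict_comp_apply, LinearMap.id_comp]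

theorem comp_one (F : IFam g U V) : comp m 0 F (one g U) = F :=
  IFam.ext fun l => by rw [one, comp_strict_apply, LinearMap.comp_id]

theorem strict_comp_strict (φ : V.carrier →ₗ[K] W.carrier) (ψ : U.carrier →ₗ[K] V.carrier) :
    comp 0 0 (strict φ : IFam g V W) (strict ψ : IFam g U V) = (strict (φ ∘ₗ ψ) : IFam g U W) := by
  refine IFam.ext fun l => ?_
  rw [strict_comp_apply]
  cases l with
  | nil => exact rfl
  | cons x l => exact LinearMap.comp_zero φ

theorem comp_skew {G : IFam g V W} {F : IFam g U V} (hG : IsSkew G.1) (hF : IsSkew F.1) :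
    IsSkew (comp m n G F).1 := by
  have := convFun_skew m n (fun _ => LinearMap.llcomp K U.carrier V.carrier W.carrier) hG hF
  exact this

theorem comp_mem {mn : ℤ} (hmn : mn = m + n) {G : IFam g V W} {F : IFam g U V} (hG : G ∈ Hom g V W m)
    (hF : F ∈ Hom g U V n) : comp m n G F ∈ Hom g U W mn := by
  refine ⟨fun l e u hu => ?_, comp_skew hG.2 hF.2⟩
  rw [comp_apply]
  have : ∀ (L : List (K × List (HEl g) × List (HEl g))), (∀ s ∈ L, s ∈ shuffles l) →
      (L.map fun s => (s.1 * (-1 : K) ^ ((m - s.2.1.length) * s.2.2.length +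
        (n - s.2.2.length) * degSum s.2.1)) • (G.1 s.2.1 ∘ₗ F.1 s.2.2)).sum u ∈
        W.deg (degSum l + e + mn - l.length) := by
    intro L
    induction L with
    | nil => intro _; simp
    | cons s L ih =>
      intro h
      rw [List.map_cons, List.sum_cons, LinearMap.add_apply]
      refine add_mem ?_ (ih fun t ht => h t (List.mem_cons_of_mem _ ht))
      obtain ⟨e1, e2⟩ := shuffles_lengths (h s List.mem_cons_self)
      have := hG.1 s.2.1 _ _ (hF.1 s.2.2 e u hu)
      rw [LinearMap.smul_apply]
      refine Submodule.smul_mem _ _ ?_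
      have e3 : degSum l + e + mn - l.length =
          degSum s.2.1 + (degSum s.2.2 + e + n - s.2.2.length) + m - s.2.1.length := by
        rw [hmn, ← e1, ← e2]
        push_cast
        ring
      rw [e3]
      exact this
  exact this _ fun _ h => h

theorem strict_mem {φ : U.carrier →ₗ[K] V.carrier}
    (h : ∀ e, ∀ u ∈ U.deg e, φ u ∈ V.deg e) : (strict φ : IFam g U V) ∈ Hom g U V 0 := by
  constructor
  · intro l e u hu
    cases l with
    | nil => simpa [strict_nil] using h e u hu
    | cons x l => simp [strict_cons]
  · intro a b x y
    rw [strict_of_ne_nil φ (by simp), strict_of_ne_nil φ (by simp), smul_zero]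

theorem one_mem : one g U ∈ Hom g U U 0 := strict_mem fun _ _ h => h

end Comp

/-! ### The derivative of an intertwiner -/

theorem varrho_tmul (f : IFam g U V) (l : List (HEl g)) {d : ℤ} (y : g.deg d) (u : U.carrier) :
    (varrho f).1 l ((y : g.carrier) ⊗ₜ u) = (-1 : K) ^ (l.length + 1) • f.1 (l ++ [⟨d, y⟩]) u := by
  rw [← last_apply]
  rfl

theorem varrho_ext {f h : IFam g (g.tensor U) V}
    (e : ∀ l d (y : g.deg d) u, f.1 l ((y : g.carrier) ⊗ₜ u) = h.1 l ((y : g.carrier) ⊗ₜ u)) :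
    f = h :=
  IFam.ext fun l => GrVect.tensor_hom_ext_left (e l)

theorem varrho_add (f h : IFam g U V) : varrho (f + h) = varrho f + varrho h :=
  varrho_ext fun l d y u => by
    rw [IFam.add_apply, LinearMap.add_apply, varrho_tmul, varrho_tmul, varrho_tmul, ← smul_add,
      IFam.add_apply, LinearMap.add_apply]

theorem varrho_smul (c : K) (f : IFam g U V) : varrho (c • f) = c • varrho f :=
  varrho_ext fun l d y u => by
    rw [IFam.smul_apply, LinearMap.smul_apply, varrho_tmul, varrho_tmul, smul_comm,
      IFam.smul_apply, LinearMap.smul_apply]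

theorem varrho_neg (f : IFam g U V) : varrho (-f) = -varrho f := by
  rw [← IFam.neg_one_smul, varrho_smul, IFam.neg_one_smul]

theorem varrho_sub (f h : IFam g U V) : varrho (f - h) = varrho f - varrho h := by
  rw [sub_eq_add_neg, varrho_add, varrho_neg, sub_eq_add_neg]

theorem varrho_strict (φ : U.carrier →ₗ[K] V.carrier) : varrho (strict φ : IFam g U V) = 0 :=
  varrho_ext fun l d y u => by
    rw [varrho_tmul, strict_of_ne_nil φ (by simp)]
    simp

theorem varrho_mem {n n' : ℤ} (hn : n' = n - 1) {f : IFam g U V} (hf : f ∈ Hom g U V n) :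
    varrho f ∈ Hom g (g.tensor U) V n' := by
  constructor
  · intro l e z hz
    let T := (V.deg (degSum l + e + n' - l.length)).comap ((varrho f).1 l)
    suffices h : (g.tensor U).deg e ≤ T from h hz
    refine iSup_le fun p => Submodule.map₂_le.mpr fun y hy u hu => ?_
    change (varrho f).1 l (y ⊗ₜ[K] u) ∈ V.deg (degSum l + e + n' - l.length)
    rw [varrho_tmul f l ⟨y, hy⟩]
    refine Submodule.smul_mem _ _ ?_
    convert hf.1 (l ++ [⟨p, y, hy⟩]) _ u hu using 2
    rw [hn]
    simp
    ring
  · intro a b x y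
    apply GrVect.tensor_hom_ext_left
    intro d z u
    rw [LinearMap.smul_apply, varrho_tmul, varrho_tmul, List.append_assoc, List.append_assoc,
      List.cons_append, List.cons_append, List.cons_append, List.cons_append, hf.2, smul_comm]
    simp

/-- `shuffles` recurses on the first input, but `varrho` singles out the last one; this is the
recursion from the other end. The last input either ends the first block, having moved past the
whole second block at the cost of a sign, or ends the second block for free. -/
theorem sum_shuffles_concat {X : Type u} [AddCommGroup X] [Module K X] (l : List (HEl g))
    (y : HEl g) (φ : K × List (HEl g) × List (HEl g) → X) :
    ((shuffles (l ++ [y])).map φ).sum =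
      ((shuffles l).map fun s => φ (s.1 * (-1 : K) ^ ((s.2.2.length : ℤ) + y.d * degSum s.2.2),
        s.2.1 ++ [y], s.2.2)).sum +
      ((shuffles l).map fun s => φ (s.1, s.2.1, s.2.2 ++ [y])).sum := by
  induction l generalizing φ with
  | nil => simp [shuffles]
  | cons x l ih =>
    simp only [List.cons_append, shuffles, List.map_append, List.map_map, List.sum_append]
    rw [ih, ih, add_add_add_comm]
    congr 2 
    · congr 1
      refine List.map_congr_left fun s _ => ?_
      simp only [Function.comp_apply, mul_assoc, ← zpow_add₀ (neg_one_ne_zero' (K := K))]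
      congr 3
      apply neg_one_zpow_congr
      simp only [List.length_append, List.length_cons, degSum_append, degSum_cons, List.length_nil,
        degSum_nil]
      push_cast
      grind

/-! ### Tensoring with identities -/

/-- The intertwiner `1_g ⊙ F` for `F` of degree `n`. -/
def up (n : ℤ) (F : IFam g U V) : IFam g (g.tensor U) (g.tensor V) := odot 0 n (one g g) F

/-- The intertwiner `1_U ⊙ h` for `h` of degree `n`. -/
def wl (n : ℤ) (U : GrVect K) (h : IFam g V V') : IFam g (U.tensor V) (U.tensor V') :=
  odot 0 n (one g U) h

/-- The intertwiner `f ⊙ 1_V`. -/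
def wr (V : GrVect K) (f : IFam g U U') : IFam g (U.tensor V) (U'.tensor V) :=
  odot 0 0 f (one g V)

theorem wl_apply (n : ℤ) (h : IFam g V V') (l : List (HEl g)) :
    (wl n U h).1 l = TensorProduct.map (U.sgn (n - l.length + degSum l)) (h.1 l) :=
  one_odot_apply n h l

theorem wl_tmul (n : ℤ) (h : IFam g V V') (l : List (HEl g)) {d : ℤ} {y : U.carrier}
    (hy : y ∈ U.deg d) (v : V.carrier) :
    (wl n U h).1 l (y ⊗ₜ v) = (-1 : K) ^ ((n - l.length + degSum l) * d) • (y ⊗ₜ h.1 l v) := by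
  rw [wl_apply, TensorProduct.map_tmul, U.sgn_apply _ hy, TensorProduct.smul_tmul']

theorem up_tmul (n : ℤ) (h : IFam g V V') (l : List (HEl g)) {d : ℤ} {y : g.carrier}
    (hy : y ∈ g.deg d) (v : V.carrier) :
    (up n h).1 l (y ⊗ₜ v) = (-1 : K) ^ ((n - l.length + degSum l) * d) • (y ⊗ₜ h.1 l v) :=
  wl_tmul n h l hy v

theorem wr_apply (f : IFam g U U') (l : List (HEl g)) :
    (wr V f).1 l = TensorProduct.map (f.1 l) LinearMap.id := odot_one_apply 0 f l

/-- The identity consumes no inputs, so the degree of f never enters a sign. This is why `wr` takes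
no degree while `wl` does. -/
theorem odot_one (m : ℤ) (f : IFam g U U') : odot m 0 f (one g V) = wr V f :=
  IFam.ext fun l => by rw [odot_one_apply, wr_apply]

/-- From here on products are composites of two whiskerings, and interchanging them is a matter of
`Commuting` squares. -/
theorem odot_eq_comp (m n : ℤ) (f : IFam g U U') (h : IFam g V V') :
    odot m n f h = comp m n (wr V' f) (wl n U h) :=
  IFam.ext fun l => by
    rw [comp_apply]
    change ((shuffles l).map _).sum = _
    refine congrArg List.sum (List.map_congr_left fun s _ => ?_)
    congr 1
    rw [wr_apply, wl_apply, ← TensorProduct.map_comp]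
    rfl

end Intertwiners

end HLie
end

noncomputable section
namespace HLie

/-! ### The derivation rule, functoriality of whiskering, and the swap of two factors of 𝔤. -/

section Derivation

variable {K : Type u} [Field K] {g U V W U' V' W' : GrVect K}

theorem comp_apply_apply (m n : ℤ) (G : IFam g V W) (F : IFam g U V) (l : List (HEl g))
    (u : U.carrier) : (comp m n G F).1 l u = ((shuffles l).map fun s =>
      (s.1 * (-1 : K) ^ ((m - s.2.1.length) * s.2.2.length + (n - s.2.2.length) * degSum s.2.1)) •
        G.1 s.2.1 (F.1 s.2.2 u)).sum :=
  map_comp_apply (LinearMap.applyₗ u) m n G F l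

/-- The derivative is an odd derivation with respect to the composition. -/
theorem varrho_comp {m n m' n' : ℤ} (hm : m' = m - 1) (hn : n' = n - 1)
    (G : IFam g V W) (F : IFam g U V) :
    varrho (comp m n G F) =
      comp m' n (varrho G) (up n F) + (-1 : K) ^ m • comp m n' G (varrho F) := by
  subst hm hn
  have h1 : (-1 : K) ≠ 0 := neg_one_ne_zero'
  refine varrho_ext fun l d y u => ?_
  -- The last input of a composite is consumed by G or by F; these are the two terms of the
  -- derivation rule.
  rw [varrho_tmul, comp_apply_apply, sum_shuffles_concat, IFam.add_apply, LinearMap.add_apply,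
    IFam.smul_apply, LinearMap.smul_apply, comp_apply_apply, comp_apply_apply, smul_add,
    List.smul_sum, List.smul_sum, List.smul_sum, List.map_map, List.map_map, List.map_map]
  congr 2
  · refine List.map_congr_left fun s hs => ?_
    obtain ⟨e1, -⟩ := shuffles_lengths hs
    simp only [Function.comp_apply]
    rw [up_tmul _ _ _ y.2, map_smul, varrho_tmul,
      smul_smul, smul_smul, smul_smul]
    congr 1
    simp only [mul_left_comm _ s.1, mul_assoc, ← zpow_add₀ h1, ← zpow_natCast]
    congr 1
    apply neg_one_zpow_congr
    simp only [← e1, List.length_append, List.length_cons, degSum_append, degSum_cons,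
      List.length_nil, degSum_nil]
    push_cast
    grind
  · refine List.map_congr_left fun s hs => ?_
    obtain ⟨e1, -⟩ := shuffles_lengths hs
    simp only [Function.comp_apply]
    rw [varrho_tmul, map_smul, smul_smul, smul_smul,
      smul_smul]
    congr 1
    simp only [mul_left_comm _ s.1, mul_assoc, ← zpow_add₀ h1, ← zpow_natCast]
    congr 1
    apply neg_one_zpow_congr
    simp only [← e1, List.length_append, List.length_cons, List.length_nil]
    push_cast
    grind

/-! ### Functoriality of tensoring with identities -/

theorem wl_comp {m n mn : ℤ} (hmn : mn = m + n) (G : IFam g V W) (F : IFam g U V) :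
    wl mn V' (comp m n G F) = comp m n (wl m V' G) (wl n V' F) := by
  refine IFam.ext fun l => ?_
  rw [wl_apply, comp_apply, comp_apply]
  change TensorProduct.mapBilinear (.id K) _ _ _ _ _ _ = _
  rw [map_list_sum, List.map_map]
  refine congrArg List.sum (List.map_congr_left fun s hs => ?_)
  obtain ⟨e1, e2⟩ := shuffles_lengths hs
  rw [wl_apply, wl_apply, ← TensorProduct.map_comp, HLie.sgn_comp_sgn, Function.comp_apply,
    map_smul, ← e1, ← e2, hmn]
  congr 1
  change TensorProduct.map _ _ = _
  congr 2
  push_cast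
  ring

theorem wr_comp (m n : ℤ) (G : IFam g V W) (F : IFam g U V) :
    wr V' (comp m n G F) = comp m n (wr V' G) (wr V' F) := by
  refine IFam.ext fun l => ?_
  rw [wr_apply, comp_apply, comp_apply]
  change (TensorProduct.mapBilinear (.id K) _ _ _ _).flip _ _ = _
  rw [map_list_sum, List.map_map]
  refine congrArg List.sum (List.map_congr_left fun s hs => ?_)
  rw [wr_apply, wr_apply, ← TensorProduct.map_comp, Function.comp_apply, map_smul,
    LinearMap.id_comp]
  rfl

theorem up_comp {m n mn : ℤ} (hmn : mn = m + n) (G : IFam g V W) (F : IFam g U V) :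
    up mn (comp m n G F) = comp m n (up m G) (up n F) := wl_comp hmn G F

section Linear

variable (n : ℤ) (c : K) (F G : IFam g U V)

theorem wl_add : wl n W (F + G) = wl n W F + wl n W G :=
  IFam.ext fun l => by
    rw [IFam.add_apply, wl_apply, wl_apply, wl_apply, IFam.add_apply, TensorProduct.map_add_right]

theorem wl_smul : wl n W (c • F) = c • wl n W F :=
  IFam.ext fun l => by
    rw [IFam.smul_apply, wl_apply, wl_apply, IFam.smul_apply, TensorProduct.map_smul_right]

theorem wl_neg : wl n W (-F) = -wl n W F := by
  rw [← IFam.neg_one_smul, wl_smul, IFam.neg_one_smul]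

theorem wl_sub : wl n W (F - G) = wl n W F - wl n W G := by
  rw [sub_eq_add_neg, wl_add, wl_neg, sub_eq_add_neg]

theorem wr_add : wr W (F + G) = wr W F + wr W G :=
  IFam.ext fun l => by
    rw [IFam.add_apply, wr_apply, wr_apply, wr_apply, IFam.add_apply, TensorProduct.map_add_left]

theorem wr_smul : wr W (c • F) = c • wr W F :=
  IFam.ext fun l => by
    rw [IFam.smul_apply, wr_apply, wr_apply, IFam.smul_apply, TensorProduct.map_smul_left]

theorem wr_neg : wr W (-F) = -wr W F := by
  rw [← IFam.neg_one_smul, wr_smul, IFam.neg_one_smul]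

theorem wr_sub : wr W (F - G) = wr W F - wr W G := by
  rw [sub_eq_add_neg, wr_add, wr_neg, sub_eq_add_neg]

theorem up_add : up n (F + G) = up n F + up n G := wl_add (W := g) n F G
theorem up_smul : up n (c • F) = c • up n F := wl_smul (W := g) n c F
theorem up_neg : up n (-F) = -up n F := wl_neg (W := g) n F
theorem up_sub : up n (F - G) = up n F - up n G := wl_sub (W := g) n F G

end Linear

theorem wl_strict (φ : U.carrier →ₗ[K] V.carrier) :
    wl 0 W (strict φ : IFam g U V) =
      (strict (TensorProduct.map LinearMap.id φ) : IFam g (W.tensor U) (W.tensor V)) := by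
  refine IFam.ext fun l => ?_
  rw [wl_apply]
  cases l with
  | nil =>
    rw [strict_nil, strict_nil]
    simp [HLie.sgn_zero]
  | cons x l => rw [strict_cons, strict_cons, TensorProduct.map_zero_right]

theorem wr_strict (φ : U.carrier →ₗ[K] V.carrier) :
    wr W (strict φ : IFam g U V) =
      (strict (TensorProduct.map φ LinearMap.id) : IFam g (U.tensor W) (V.tensor W)) := by
  refine IFam.ext fun l => ?_
  rw [wr_apply]
  cases l with
  | nil => rw [strict_nil, strict_nil]
  | cons x l => rw [strict_cons, strict_cons, TensorProduct.map_zero_left]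

theorem up_strict (φ : U.carrier →ₗ[K] V.carrier) :
    up 0 (strict φ : IFam g U V) =
      (strict (TensorProduct.map LinearMap.id φ) : IFam g (g.tensor U) (g.tensor V)) := wl_strict φ

theorem tensor_mem_of_tmul {X : GrVect K} (φ : U.carrier ⊗[K] V.carrier →ₗ[K] X.carrier) (c : ℤ)
    (h : ∀ p q, ∀ u ∈ U.deg p, ∀ v ∈ V.deg q, φ (u ⊗ₜ v) ∈ X.deg (p + q + c)) {e : ℤ}
    {z : U.carrier ⊗[K] V.carrier} (hz : z ∈ (U.tensor V).deg e) : φ z ∈ X.deg (e + c) := by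
  let T := (X.deg (e + c)).comap φ
  suffices h : (U.tensor V).deg e ≤ T from h hz
  refine iSup_le fun p => Submodule.map₂_le.mpr fun u hu v hv => ?_
  have := h p (e - p) u hu v hv
  rwa [show p + (e - p) + c = e + c by ring] at this

theorem wl_mem {n : ℤ} {F : IFam g U V} (hF : F ∈ Hom g U V n) :
    wl n W F ∈ Hom g (W.tensor U) (W.tensor V) n := by
  constructor
  · intro l e z hz
    rw [show degSum l + e + n - l.length = e + (degSum l + n - l.length) by ring]
    refine tensor_mem_of_tmul _ _ (fun p q w hw u hu => ?_) hz
    rw [wl_tmul _ _ _ hw]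
    exact Submodule.smul_mem _ _ (GrVect.tmul_mem W V (by ring) hw (hF.1 l q u hu))
  · intro a b x y
    have hl : ((a ++ x :: y :: b).length : ℤ) = (a ++ y :: x :: b).length := by simp
    have hd : degSum (a ++ x :: y :: b) = degSum (a ++ y :: x :: b) := by
      simp only [degSum_append, degSum_cons]; ring
    rw [wl_apply, wl_apply, hl, hd, hF.2 a b x y, TensorProduct.map_smul_right]

theorem wr_mem {n : ℤ} {F : IFam g U V} (hF : F ∈ Hom g U V n) :
    wr W F ∈ Hom g (U.tensor W) (V.tensor W) n := by
  constructor
  · intro l e z hz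
    rw [show degSum l + e + n - l.length = e + (degSum l + n - l.length) by ring]
    refine tensor_mem_of_tmul _ _ (fun p q u hu w hw => ?_) hz
    rw [wr_apply, TensorProduct.map_tmul]
    exact GrVect.tmul_mem V W (by ring) (hF.1 l p u hu) hw
  · intro a b x y
    rw [wr_apply, wr_apply, hF.2 a b x y, TensorProduct.map_smul_left]

theorem up_mem {n : ℤ} {F : IFam g U V} (hF : F ∈ Hom g U V n) :
    up n F ∈ Hom g (g.tensor U) (g.tensor V) n := wl_mem hF

/-! ### The swap of two factors -/

/-- The Koszul swap of the first two factors of `g ⊗ (g ⊗ T)`. -/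
def swapMap (g T : GrVect K) : g.carrier ⊗[K] (g.carrier ⊗[K] T.carrier) →ₗ[K]
    g.carrier ⊗[K] (g.carrier ⊗[K] T.carrier) :=
  (TensorProduct.assoc K g.carrier g.carrier T.carrier).toLinearMap ∘ₗ
    TensorProduct.map (GrVect.swap g g) LinearMap.id ∘ₗ
      (TensorProduct.assoc K g.carrier g.carrier T.carrier).symm.toLinearMap

theorem swapMap_tmul (g T : GrVect K) {p q : ℤ} {y z : g.carrier} (hy : y ∈ g.deg p)
    (hz : z ∈ g.deg q) (t : T.carrier) :
    swapMap g T (y ⊗ₜ (z ⊗ₜ t)) = (-1 : K) ^ (p * q) • (z ⊗ₜ (y ⊗ₜ t)) := by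
  simp [swapMap, GrVect.swap_tmul g g hy hz, TensorProduct.smul_tmul']

theorem swapMap_ext {X : Type u} [AddCommGroup X] [Module K X]
    {φ ψ : g.carrier ⊗[K] (g.carrier ⊗[K] U.carrier) →ₗ[K] X}
    (h : ∀ p q, ∀ y ∈ g.deg p, ∀ z ∈ g.deg q, ∀ u, φ (y ⊗ₜ (z ⊗ₜ u)) = ψ (y ⊗ₜ (z ⊗ₜ u))) :
    φ = ψ := by
  apply TensorProduct.ext
  apply g.hom_ext
  intro p y
  apply TensorProduct.ext
  apply g.hom_ext
  intro q z
  ext u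
  exact h p q y y.2 z z.2 u

theorem swapMap_comp_swapMap (g T : GrVect K) : swapMap g T ∘ₗ swapMap g T = LinearMap.id :=
  swapMap_ext (U := T) fun p q y hy z hz t => by
    rw [LinearMap.comp_apply, swapMap_tmul g T hy hz, map_smul, swapMap_tmul g T hz hy, smul_smul,
      ← zpow_add₀ neg_one_ne_zero', mul_comm q p, Even.neg_one_zpow ⟨_, rfl⟩, one_smul]
    rfl

/-- The swap of the first two factors, as an intertwiner. -/
def swp (g T : GrVect K) : IFam g (g.tensor (g.tensor T)) (g.tensor (g.tensor T)) :=
  strict (swapMap g T)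

theorem swp_comp_swp : comp 0 0 (swp g U) (swp g U) = one g (g.tensor (g.tensor U)) := by
  rw [swp, strict_comp_strict, swapMap_comp_swapMap]
  rfl

theorem comp_swp_swp {n : ℤ} (F : IFam g V (g.tensor (g.tensor U))) :
    comp 0 n (swp g U) (comp 0 n (swp g U) F) = F := by
  rw [← comp_assoc (mn := 0) (np := n) (by simp) (by simp) (swp g U) (swp g U) F, swp_comp_swp, one_comp]

theorem swp_natural (n : ℤ) (F : IFam g U V) :
    comp 0 n (swp g V) (up n (up n F)) = comp n 0 (up n (up n F)) (swp g U) := by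
  refine IFam.ext fun l => ?_
  rw [swp, swp, strict_comp_apply, comp_strict_apply]
  refine swapMap_ext fun p q y hy z hz u => ?_
  rw [LinearMap.comp_apply, LinearMap.comp_apply, swapMap_tmul g U hy hz, up_tmul _ _ _ hy,
    up_tmul _ _ _ hz, map_smul, TensorProduct.tmul_smul, map_smul, swapMap_tmul g V hy hz, map_smul,
    up_tmul _ _ _ hz, up_tmul _ _ _ hy, TensorProduct.tmul_smul]
  module

/-- The derivative of `1_g ⊙ F`. -/
theorem varrho_up {n n' : ℤ} (hn : n' = n - 1) (F : IFam g U V) :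
    varrho (up n F) = comp n' 0 (up n' (varrho F)) (swp g U) := by
  subst hn
  refine IFam.ext fun l => ?_
  rw [swp, comp_strict_apply]
  refine swapMap_ext fun p q y hy z hz u => ?_
  rw [LinearMap.comp_apply, swapMap_tmul g U hy hz, varrho_tmul _ l ⟨y, hy⟩, up_tmul _ _ _ hz,
    map_smul, up_tmul _ _ _ hz, varrho_tmul _ l ⟨y, hy⟩, TensorProduct.tmul_smul]
  simp only [smul_smul, ← zpow_natCast, ← zpow_add₀ (neg_one_ne_zero' (K := K))]
  congr 1
  apply neg_one_zpow_congr
  simp only [List.length_append, List.length_cons, degSum_append, degSum_cons,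
      List.length_nil, degSum_nil]
  push_cast
  grind

/-- The second derivative is skew-symmetric. -/
theorem varrho_varrho_swp {F : IFam g U V} (hF : IsSkew F.1) (n : ℤ) :
    comp n 0 (varrho (varrho F)) (swp g U) = -varrho (varrho F) := by
  refine IFam.ext fun l => ?_
  rw [swp, comp_strict_apply, IFam.neg_apply]
  refine swapMap_ext fun p q y hy z hz u => ?_
  rw [LinearMap.comp_apply, swapMap_tmul g U hy hz, LinearMap.neg_apply, map_smul,
    varrho_tmul _ l ⟨z, hz⟩, varrho_tmul _ l ⟨y, hy⟩, varrho_tmul _ _ ⟨z, hz⟩,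
    varrho_tmul _ _ ⟨y, hy⟩, List.append_assoc, List.append_assoc, List.cons_append,
    List.cons_append, List.nil_append, hF l [] ⟨q, z, hz⟩ ⟨p, y, hy⟩]
  simp only [List.length_append, List.length_cons, List.length_nil, LinearMap.smul_apply, smul_smul,
    ← neg_smul]
  congr 1
  have e : (-1 : K) ^ (p * q) * (-1 : K) ^ (q * p) = 1 := by
    rw [← zpow_add₀ neg_one_ne_zero', mul_comm q p, Even.neg_one_zpow ⟨_, rfl⟩]
  linear_combination (-(-1 : K) ^ (l.length + 1) * (-1) ^ (l.length + (0 + 1) + 1)) * e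

end Derivation

end HLie
end

noncomputable section
namespace HLie

/-! ### Insertion of a family of tensors in front of a module. -/

section Insertion

variable {K : Type u} [Field K] {g U V W U' V' W' Y : GrVect K}

/-- The intertwiner `u ↦ ω ⊗ u` given by a family `ω` of elements of `Y`. -/
def ins (ω : Fam g Y.carrier) (T : GrVect K) : IFam g T (Y.tensor T) :=
  postcomp (fun _ => TensorProduct.mk K Y.carrier T.carrier) ω

/-- A family of homogeneous maps of degree `w`. -/
def IsHomogeneous (Y : GrVect K) (w : ℤ) (ω : List (HEl g) → Y.carrier) : Prop :=
  ∀ l, ω l ∈ Y.deg (degSum l + w - l.length)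

theorem ins_apply (ω : Fam g Y.carrier) (l : List (HEl g)) (u : U.carrier) :
    (ins ω U).1 l u = ω.1 l ⊗ₜ u := rfl

theorem ins_mem {w : ℤ} {ω : Fam g Y.carrier} (h : IsHomogeneous Y w ω.1) (hs : IsSkew ω.1) :
    ins ω U ∈ Hom g U (Y.tensor U) w := by
  constructor
  · intro l e u hu
    exact GrVect.tmul_mem Y U (by ring) (h l) hu
  · intro a b x y
    ext u
    rw [LinearMap.smul_apply, ins_apply, ins_apply, hs, TensorProduct.smul_tmul']

/-- Both sides insert ω and apply F; they differ in which of the two takes its inputs first, so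
`sum_shuffles_symm` matches the sums. The sign (-1)^{wn} of the interchange disappears because w is
even. -/
theorem ins_natural {w : ℤ} (hw : Even w) {ω : Fam g Y.carrier} (h : IsHomogeneous Y w ω.1) (n : ℤ)
    (F : IFam g U V) :
    comp n w (wl n Y F) (ins ω U) = comp w n (ins ω V) F := by
  have h1 : (-1 : K) ≠ 0 := neg_one_ne_zero'
  have hw2 : (w : ZMod 2) = 0 := (ZMod.intCast_eq_zero_iff_even).2 hw
  refine IFam.ext fun l => ?_
  ext u
  rw [comp_apply_apply, comp_apply_apply, sum_shuffles_symm]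
  refine congrArg List.sum (List.map_congr_left fun s hs => ?_)
  dsimp only
  rw [ins_apply, ins_apply, wl_tmul _ _ _ (h s.2.1), smul_smul]
  congr 1
  simp only [mul_assoc, ← zpow_add₀ h1]
  congr 1
  apply neg_one_zpow_congr
  push_cast
  rw [hw2]
  grind

theorem ellAt_natural (L : HomotopyLie g) (n : ℤ) (F : IFam g U V) :
    comp n 2 (up n F) (ellAt L U) = comp 2 n (ellAt L V) F :=
  ins_natural (by decide) (ω := L.ell) L.ell_deg n F

theorem ellAt_apply (L : HomotopyLie g) (l : List (HEl g)) (u : U.carrier) :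
    (ellAt L U).1 l u = L.ell.1 l ⊗ₜ u := rfl

/-- The value of ℓ stands to the right of the spectator factor on one side and to its left on the
other. Since ℓ has even degree 2, the Koszul swap accounts for the whole sign. -/
theorem up_ellAt (L : HomotopyLie g) :
    up 2 (ellAt L U) = comp 0 2 (swp g U) (ellAt L (g.tensor U)) := by
  refine IFam.ext fun l => ?_
  rw [swp, strict_comp_apply]
  apply GrVect.tensor_hom_ext_left
  intro p y u
  rw [LinearMap.comp_apply, up_tmul _ _ _ y.2, ellAt_apply, ellAt_apply,
    swapMap_tmul g U (L.ell_deg l) y.2]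
  congr 1
  apply neg_one_zpow_congr
  push_cast
  grind

theorem ellAt_mem (L : HomotopyLie g) : ellAt L U ∈ Hom g U (g.tensor U) 2 :=
  ins_mem (ω := L.ell) L.ell_deg L.ell_skew

end Insertion

/-! ### Differentials -/

section Differential

variable {K : Type u} [Field K] {g U V W U' V' W' Y : GrVect K} (L : HomotopyLie g)

/-- The differential `∂ F = r_V F - (-1) ^ n F r_U - ϱ_F ℓ_U` with respect to arbitrary endomorphisms
`r_U` and `r_V` of degree `1`. -/
def pdiff (rU : IFam g U U) (rV : IFam g V V) (n : ℤ) (F : IFam g U V) : IFam g U V :=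
  comp 1 n rV F - (-1 : K) ^ n • comp n 1 F rU - comp (n - 1) 2 (varrho F) (ellAt L U)

theorem diff_eq_pdiff {L : HomotopyLie g} (U V : HRep L) (n : ℤ) (F : IFam g U.V V.V) :
    diff U V n F = pdiff L U.rho V.rho n F := rfl

/-- The structure map of `g ⊗ U`, where `g` carries the adjoint representation. -/
def rhoUp (r : IFam g U U) : IFam g (g.tensor U) (g.tensor U) :=
  up 1 r - varrho (ellAt L U)

variable {L} {rU : IFam g U U} {rV : IFam g V V} {rW : IFam g W W}

theorem pdiff_add (n : ℤ) (F G : IFam g U V) :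
    pdiff L rU rV n (F + G) = pdiff L rU rV n F + pdiff L rU rV n G := by
  simp only [pdiff, comp_add_left, comp_add_right, varrho_add, smul_add]
  abel

theorem pdiff_smul (n : ℤ) (c : K) (F : IFam g U V) :
    pdiff L rU rV n (c • F) = c • pdiff L rU rV n F := by
  simp only [pdiff, comp_smul_left, comp_smul_right, varrho_smul]
  module

theorem pdiff_neg (n : ℤ) (F : IFam g U V) : pdiff L rU rV n (-F) = -pdiff L rU rV n F := by
  rw [← IFam.neg_one_smul, pdiff_smul, IFam.neg_one_smul]

theorem pdiff_sub (n : ℤ) (F G : IFam g U V) :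
    pdiff L rU rV n (F - G) = pdiff L rU rV n F - pdiff L rU rV n G := by
  rw [sub_eq_add_neg, pdiff_add, pdiff_neg, sub_eq_add_neg]

/-- The terms through r_V cancel, so none of the endomorphisms has to be a representation. The
remaining term splits by `varrho_comp`, after ℓ has been moved past F by `ellAt_natural`. -/
theorem pdiff_comp {m n mn m' n' : ℤ} (hmn : mn = m + n) (hm : m' = m + 1) (hn : n' = n + 1)
    (G : IFam g V W) (F : IFam g U V) :
    pdiff L rU rW mn (comp m n G F) =
      comp m' n (pdiff L rV rW m G) F + (-1 : K) ^ m • comp m n' G (pdiff L rU rV n F) := by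
  subst hmn hm hn
  simp only [pdiff, comp_sub_left, comp_sub_right, comp_smul_left, comp_smul_right,
    smul_sub]
  rw [varrho_comp rfl rfl, comp_add_left, comp_smul_left,
    comp_assoc (mn := m + 1) (np := m + n) (by ring) rfl rW,
    comp_assoc (mn := m + n) (np := n + 1) rfl rfl G,
    comp_assoc (mn := m + 1) (np := 1 + n) rfl rfl G,
    comp_assoc (mn := m + 1) (np := 2 + n) (by ring) rfl,
    comp_assoc (m := m - 1) (np := n + 2) (by ring) rfl, ellAt_natural,
    comp_assoc (mn := m + n - 1) (np := n + 1) (by ring) (by ring) G,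
    zpow_add₀ (neg_one_ne_zero' (K := K)), add_comm n 2, add_comm n 1]
  module

/-- Differentiating `ellAt_natural` shows that 1_𝔤 ⊙ F commutes up to sign with the adjoint part
`varrho (ellAt L _)` of `rhoUp`. The adjoint parts therefore cancel, and only `up 1 r` and the
ℓ-term contribute. -/
theorem pdiff_up {n n' : ℤ} (hn : n' = n + 1) (F : IFam g U V) :
    pdiff L (rhoUp L rU) (rhoUp L rV) n (up n F) = up n' (pdiff L rU rV n F) := by
  subst hn
  have e := congrArg varrho (ellAt_natural L n F)
  rw [varrho_comp (m' := n - 1) (n' := 1) rfl (by norm_num),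
    varrho_comp (m' := 1) (n' := n - 1) (by norm_num) rfl, varrho_up rfl, up_ellAt,
    comp_assoc (np := 2) (by ring) (by norm_num), comp_swp_swp, ellAt_natural] at e
  rw [show ((-1 : K) ^ (2 : ℤ)) = 1 by norm_num, one_smul] at e
  simp only [pdiff, rhoUp, comp_sub_left, comp_sub_right, up_sub, up_smul, smul_sub]
  rw [varrho_up rfl, comp_assoc (np := 2) (by ring) (by norm_num), ← up_ellAt,
    up_comp (by ring), up_comp rfl, up_comp (by ring)]
  have e' := sub_eq_zero.2 e
  rw [← sub_eq_zero]
  rw [← e']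
  module

/-- Every differential of a bracket comes from this formula. The sign of ϱ_{∂F} is that of moving ∂
past the odd operation ϱ. The term ϱ_F ℓ of ∂F yields the second derivative of F on 1 ⊙ ℓ, which by
skewness is minus the second derivative on ℓ, that is, the ℓ-term of ∂ϱ_F. -/
theorem pdiff_varrho {n n' : ℤ} (hn : n' = n - 1) {F : IFam g U V}
    (hF : IsSkew F.1) :
    pdiff L (rhoUp L rU) rV n' (varrho F) = -varrho (pdiff L rU rV n F) +
      comp 0 n (varrho rV) (up n F) - comp n 0 F (varrho rU) := by
  subst hn
  simp only [pdiff, rhoUp, varrho_sub, varrho_smul, comp_sub_right]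
  rw [varrho_comp (m' := 0) (n' := n - 1) (by norm_num) rfl,
    varrho_comp (m' := n - 1) (n' := 0) rfl (by norm_num),
    varrho_comp (m' := n - 1 - 1) (n' := 1) rfl (by norm_num), up_ellAt,
    ← comp_assoc (m := n - 1 - 1) (n := 0) (mn := n - 1 - 1) (by ring) (by norm_num),
    varrho_varrho_swp hF, comp_neg_left, zpow_sub_one₀ (neg_one_ne_zero' (K := K)) n]
  have h1 : ((-1 : K))⁻¹ = -1 := by norm_num
  have h2 : (-1 : K) ^ n * (-1) ^ n = 1 := by
    rw [← zpow_add₀ neg_one_ne_zero', Even.neg_one_zpow ⟨_, rfl⟩]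
  simp only [smul_add, smul_smul, h1, h2, zpow_one, mul_neg, mul_one]
  module

theorem pdiff_mem {n n' : ℤ} (hn : n' = n + 1) {F : IFam g U V} (hF : F ∈ Hom g U V n)
    (hU : rU ∈ Hom g U U 1) (hV : rV ∈ Hom g V V 1) : pdiff L rU rV n F ∈ Hom g U V n' := by
  subst hn
  exact Submodule.sub_mem _ (Submodule.sub_mem _ (comp_mem (by ring) hV hF)
    (Submodule.smul_mem _ _ (comp_mem rfl hF hU)))
    (comp_mem (by ring) (varrho_mem rfl hF) (ellAt_mem L))

end Differential

/-! ### Commuting squares -/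

section Commuting

variable {K : Type u} [Field K] {g A B C D : GrVect K}

/-- All components of `F` and `F'`, of degree `m`, commute with those of `H` and `H'`, of degree `n`,
up to the Koszul sign: `F : A ⇝ B`, `H : A ⇝ C`, `F' : C ⇝ D` and `H' : B ⇝ D` form a square. -/
def Commuting (m n : ℤ) (F : IFam g A B) (F' : IFam g C D) (H : IFam g A C) (H' : IFam g B D) :
    Prop :=
  ∀ a b, H'.1 b ∘ₗ F.1 a =
    (-1 : K) ^ ((m - a.length + degSum a) * (n - b.length + degSum b)) • (F'.1 a ∘ₗ H.1 b)

variable {m n : ℤ} {F : IFam g A B} {F' : IFam g C D} {H : IFam g A C} {H' : IFam g B D}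

/-- The componentwise condition is what a single component of `varrho` can use; the identity of
composites follows by summing it over the shuffles, with the two blocks exchanged. -/
theorem Commuting.comp_eq (h : Commuting m n F F' H H') :
    comp n m H' F = (-1 : K) ^ (m * n) • comp m n F' H := by
  have h1 : (-1 : K) ≠ 0 := neg_one_ne_zero'
  refine IFam.ext fun l => ?_
  rw [IFam.smul_apply, comp_apply, comp_apply, sum_shuffles_symm, List.smul_sum, List.map_map]
  refine congrArg List.sum (List.map_congr_left fun s hs => ?_)
  simp only [Function.comp_apply]
  rw [h s.2.1 s.2.2, smul_smul, smul_smul]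
  congr 1
  simp only [mul_left_comm _ s.1, mul_assoc, ← zpow_add₀ h1]
  congr 1
  apply neg_one_zpow_congr
  push_cast
  grind

theorem Commuting.symm (h : Commuting m n F F' H H') : Commuting n m H H' F F' := by
  intro b a
  rw [h a b, smul_smul, ← zpow_add₀ neg_one_ne_zero', Even.neg_one_zpow, one_smul]
  exact ⟨(m - a.length + degSum a) * (n - b.length + degSum b), by ring⟩

/-- A componentwise condition survives when the last entry of F is fixed; that entry is the factor
of 𝔤 which `up n H` carries along. -/
theorem Commuting.varrho {m' : ℤ} (hm : m' = m - 1) (h : Commuting m n F F' H H') :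
    Commuting m' n (varrho F) (varrho F') (up n H) H' := by
  subst hm
  intro a b
  apply GrVect.tensor_hom_ext_left
  intro d y u
  have e := LinearMap.congr_fun (h (a ++ [⟨d, y⟩]) b) u
  rw [LinearMap.comp_apply, LinearMap.smul_apply, LinearMap.comp_apply] at e
  rw [LinearMap.comp_apply, LinearMap.smul_apply, LinearMap.comp_apply, up_tmul _ _ _ y.2,
    map_smul, varrho_tmul, varrho_tmul, map_smul, e]
  simp only [smul_smul, ← zpow_natCast, ← zpow_add₀ (neg_one_ne_zero' (K := K))]
  congr 1
  apply neg_one_zpow_congr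
  simp only [List.length_append, List.length_cons, degSum_append, degSum_cons,
      List.length_nil, degSum_nil]
  push_cast
  grind

theorem Commuting.up (h : Commuting m n F F' H H') :
    Commuting m n (up m F) (up m F') (up n H) (up n H') := by
  intro a b
  apply GrVect.tensor_hom_ext_left
  intro d y u
  have e := LinearMap.congr_fun (h a b) u
  rw [LinearMap.comp_apply, LinearMap.smul_apply, LinearMap.comp_apply] at e
  rw [LinearMap.comp_apply, LinearMap.smul_apply, LinearMap.comp_apply, up_tmul _ _ _ y.2,
    up_tmul _ _ _ y.2, map_smul, map_smul, up_tmul _ _ _ y.2, up_tmul _ _ _ y.2, e,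
    TensorProduct.tmul_smul]
  module

/-- Both sides of the square are differentiated in turn. The `swp` appears because the two new
factors of 𝔤 arise in opposite orders. This is the source of the symmetry of the bracket. -/
theorem Commuting.swap (h : Commuting m n F F' H H') {m' n' : ℤ} (hm : m' = m - 1)
    (hn : n' = n - 1) :
    comp n' m' (HLie.varrho H') (HLie.up m' (HLie.varrho F)) =
      (-1 : K) ^ (m' * n') •
        comp m' n' (HLie.varrho F') (comp n' 0 (HLie.up n' (HLie.varrho H)) (swp g A)) := by
  rw [((h.varrho hm).symm.varrho hn).symm.comp_eq, varrho_up hn]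

/-- The basic commuting square: operations on different tensor factors. The others on tensor
products are mostly derived from it or concern strict maps. -/
theorem wr_wl_commuting {U U' V V' : GrVect K} {f : IFam g U U'} (hf : f ∈ Hom g U U' m)
    (h : IFam g V V') : Commuting m n (wr V f) (wr V' f) (wl n U h) (wl n U' h) := by
  intro a b
  apply GrVect.tensor_hom_ext_left
  intro d u v
  rw [LinearMap.comp_apply, LinearMap.smul_apply, LinearMap.comp_apply, wr_apply,
    TensorProduct.map_tmul, LinearMap.id_apply, wl_tmul _ _ _ (hf.1 a d u u.2), wl_tmul _ _ _ u.2,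
    map_smul, wr_apply, TensorProduct.map_tmul, LinearMap.id_apply, smul_smul,
    ← zpow_add₀ (neg_one_ne_zero' (K := K))]
  congr 1
  apply neg_one_zpow_congr
  push_cast
  grind

end Commuting

end HLie
end

noncomputable section
namespace HLie

/-! ### Tensor powers, symmetrisers of low weight, and grafting of tensors onto a module. -/

section Tensors

variable {K : Type u} [Field K] {g T U V X : GrVect K}

/-- The tensor `x ⊗ z` as an element of the next tensor power. -/
def tcons {n : ℕ} (x : g.carrier) (z : (g.tpow n).carrier) : (g.tpow (n + 1)).carrier :=
  (x ⊗ₜ z : g.carrier ⊗[K] (g.tpow n).carrier)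

/-- The generator of the zeroth tensor power. -/
def tnil (g : GrVect K) : (g.tpow 0).carrier := (1 : K)

theorem tcons_add {n : ℕ} (x : g.carrier) (z z' : (g.tpow n).carrier) :
    tcons x (z + z') = tcons x z + tcons x z' := TensorProduct.tmul_add x z z'

theorem tcons_smul {n : ℕ} (c : K) (x : g.carrier) (z : (g.tpow n).carrier) :
    tcons x (c • z) = c • tcons x z := TensorProduct.tmul_smul c x z

theorem tnil_mem : tnil g ∈ (g.tpow 0).deg 0 := by
  change (1 : K) ∈ (if (0 : ℤ) = 0 then ⊤ else ⊥ : Submodule K K)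
  simp

theorem tcons_mem {n : ℕ} {d e f : ℤ} (h : d + e = f) {x : g.carrier} {z : (g.tpow n).carrier}
    (hx : x ∈ g.deg d) (hz : z ∈ (g.tpow n).deg e) : tcons x z ∈ (g.tpow (n + 1)).deg f :=
  GrVect.tmul_mem g (g.tpow n) h hx hz

theorem tpow_zero_ext {Y : Type u} [AddCommGroup Y] [Module K Y]
    {φ ψ : (g.tpow 0).carrier →ₗ[K] Y} (h : φ (tnil g) = ψ (tnil g)) : φ = ψ :=
  LinearMap.ext_ring (R := K) (f := φ) (g := ψ) h

theorem tpow_succ_ext {n : ℕ} {Y : Type u} [AddCommGroup Y] [Module K Y]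
    {φ ψ : (g.tpow (n + 1)).carrier →ₗ[K] Y}
    (h : ∀ d, ∀ x ∈ g.deg d, ∀ z, φ (tcons x z) = ψ (tcons x z)) : φ = ψ :=
  GrVect.tensor_hom_ext_left (U := g) (V := g.tpow n) fun d x z => h d x x.2 z

theorem tpow_two_ext {Y : Type u} [AddCommGroup Y] [Module K Y]
    {φ ψ : (g.tpow 2).carrier →ₗ[K] Y}
    (h : ∀ d, ∀ x ∈ g.deg d, ∀ e, ∀ y ∈ g.deg e,
      φ (tcons x (tcons y (tnil g))) = ψ (tcons x (tcons y (tnil g)))) : φ = ψ := by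
  refine tpow_succ_ext fun d x hx => LinearMap.congr_fun (f := φ ∘ₗ
    TensorProduct.mk K g.carrier (g.tpow 1).carrier x) (g := ψ ∘ₗ
    TensorProduct.mk K g.carrier (g.tpow 1).carrier x) ?_
  refine tpow_succ_ext fun e y hy => LinearMap.congr_fun (f := φ ∘ₗ
    TensorProduct.mk K g.carrier (g.tpow 1).carrier x ∘ₗ
      TensorProduct.mk K g.carrier (g.tpow 0).carrier y) (g := ψ ∘ₗ
    TensorProduct.mk K g.carrier (g.tpow 1).carrier x ∘ₗ
      TensorProduct.mk K g.carrier (g.tpow 0).carrier y) ?_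
  exact tpow_zero_ext (h d x hx e y hy)

theorem tpow_three_ext {Y : Type u} [AddCommGroup Y] [Module K Y]
    {φ ψ : (g.tpow 3).carrier →ₗ[K] Y}
    (h : ∀ d, ∀ x ∈ g.deg d, ∀ e, ∀ y ∈ g.deg e, ∀ f, ∀ z ∈ g.deg f,
      φ (tcons x (tcons y (tcons z (tnil g)))) = ψ (tcons x (tcons y (tcons z (tnil g))))) :
    φ = ψ := by
  refine tpow_succ_ext fun d x hx => LinearMap.congr_fun (f := φ ∘ₗ
    TensorProduct.mk K g.carrier (g.tpow 2).carrier x) (g := ψ ∘ₗ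
    TensorProduct.mk K g.carrier (g.tpow 2).carrier x) ?_
  exact tpow_two_ext fun e y hy f z hz => h d x hx e y hy f z hz

/-! ### The symmetriser -/

theorem symmetriser_zero : g.symmetriser 0 0 0 (tnil g ⊗ₜ tnil g) = tnil g :=
  mul_one (1 : K)

theorem symmetriser_succ_zero (n p : ℕ) (x : g.carrier) (z : (g.tpow p).carrier) :
    g.symmetriser (n + 1) (p + 1) 0 (tcons x z ⊗ₜ tnil g) =
      tcons x (g.symmetriser n p 0 (z ⊗ₜ tnil g)) := by
  change (x ⊗ₜ (g.symmetriser n p 0 (z ⊗ₜ tnil g)) : g.carrier ⊗[K] (g.tpow n).carrier) +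
    (0 : g.carrier ⊗[K] (g.tpow n).carrier) = _
  exact add_zero _

theorem symmetriser_zero_succ (n q : ℕ) (y : g.carrier) (z : (g.tpow q).carrier) :
    g.symmetriser (n + 1) 0 (q + 1) (tnil g ⊗ₜ tcons y z) =
      tcons y (g.symmetriser n 0 q (tnil g ⊗ₜ z)) := by
  have h : ∀ y : g.carrier, GrVect.swap (g.tpow 0) g (tnil g ⊗ₜ[K] y) = y ⊗ₜ tnil g := by
    refine fun y => LinearMap.congr_fun (f := GrVect.swap (g.tpow 0) g ∘ₗ
      TensorProduct.mk K _ g.carrier (tnil g))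
        (g := (TensorProduct.mk K g.carrier _).flip (tnil g)) ?_ y
    apply g.hom_ext
    intro e y
    have := GrVect.swap_tmul (g.tpow 0) g tnil_mem y.2
    simpa using this
  change (0 : g.carrier ⊗[K] (g.tpow n).carrier) + TensorProduct.map LinearMap.id
    (g.symmetriser n 0 q) (TensorProduct.assoc K g.carrier (g.tpow 0).carrier (g.tpow q).carrier
      (GrVect.swap (g.tpow 0) g (tnil g ⊗ₜ[K] y) ⊗ₜ z)) = _
  rw [h, zero_add]
  rfl

theorem symmetriser_succ_succ (n p q : ℕ) (x : g.carrier) (z : (g.tpow p).carrier) {d e : ℤ}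
    (y : g.carrier) (w : (g.tpow q).carrier) (hx : tcons x z ∈ (g.tpow (p + 1)).deg d)
    (hy : y ∈ g.deg e) :
    g.symmetriser (n + 1) (p + 1) (q + 1) (tcons x z ⊗ₜ tcons y w) =
      tcons x (g.symmetriser n p (q + 1) (z ⊗ₜ tcons y w)) +
        (-1 : K) ^ (d * e) • tcons y (g.symmetriser n (p + 1) q (tcons x z ⊗ₜ w)) := by
  have h := GrVect.swap_tmul (g.tpow (p + 1)) g hx hy
  change (x ⊗ₜ g.symmetriser n p (q + 1) (z ⊗ₜ tcons y w) : g.carrier ⊗[K] (g.tpow n).carrier) +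
    TensorProduct.map LinearMap.id
    (g.symmetriser n (p + 1) q)
      (TensorProduct.assoc K g.carrier (g.tpow (p + 1)).carrier (g.tpow q).carrier
      (GrVect.swap (g.tpow (p + 1)) g (tcons x z ⊗ₜ[K] y) ⊗ₜ w)) = _
  rw [h, ← TensorProduct.smul_tmul', map_smul, map_smul]
  rfl

theorem symmetriser_zero_right (n : ℕ) (z : (g.tpow n).carrier) :
    g.symmetriser n n 0 (z ⊗ₜ tnil g) = z := by
  induction n with
  | zero =>
    refine LinearMap.congr_fun (f := g.symmetriser 0 0 0 ∘ₗ (TensorProduct.mk K _ _).flip (tnil g))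
      (g := LinearMap.id) (tpow_zero_ext ?_) z
    exact symmetriser_zero
  | succ n ih =>
    refine LinearMap.congr_fun (f := g.symmetriser (n + 1) (n + 1) 0 ∘ₗ
      (TensorProduct.mk K _ _).flip (tnil g)) (g := LinearMap.id) (tpow_succ_ext ?_) z
    intro d x _ z
    change g.symmetriser (n + 1) (n + 1) 0 (tcons x z ⊗ₜ tnil g) = tcons x z
    rw [symmetriser_succ_zero, ih]

/-- Besides the symmetrisers with empty second argument, the Maurer-Cartan equation in weights two
and three only involves those of type (1,1), (1,2) and (2,1). -/
theorem symmetriser_one_one {d e : ℤ} {x y : g.carrier} (hx : x ∈ g.deg d) (hy : y ∈ g.deg e) :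
    g.symmetriser 2 1 1 (tcons x (tnil g) ⊗ₜ tcons y (tnil g)) =
      tcons x (tcons y (tnil g)) + (-1 : K) ^ (d * e) • tcons y (tcons x (tnil g)) := by
  rw [symmetriser_succ_succ 1 0 0 x (tnil g) y (tnil g) (tcons_mem (add_zero d) hx tnil_mem) hy,
    symmetriser_zero_succ, symmetriser_succ_zero, symmetriser_zero]

theorem symmetriser_one_two {d e f : ℤ} {x y z : g.carrier} (hx : x ∈ g.deg d) (hy : y ∈ g.deg e)
    (hz : z ∈ g.deg f) :
    g.symmetriser 3 1 2 (tcons x (tnil g) ⊗ₜ tcons y (tcons z (tnil g))) =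
      tcons x (tcons y (tcons z (tnil g))) +
        (-1 : K) ^ (d * e) • tcons y (tcons x (tcons z (tnil g))) +
          (-1 : K) ^ (d * e + d * f) • tcons y (tcons z (tcons x (tnil g))) := by
  rw [symmetriser_succ_succ 2 0 1 x (tnil g) y _ (tcons_mem (add_zero d) hx tnil_mem) hy,
    symmetriser_zero_succ, symmetriser_zero_succ, symmetriser_zero, symmetriser_one_one hx hz,
    tcons_add, tcons_smul, smul_add, smul_smul, ← zpow_add₀ neg_one_ne_zero', add_assoc]

theorem symmetriser_two_one {d e f : ℤ} {x y z : g.carrier} (hx : x ∈ g.deg d) (hy : y ∈ g.deg e)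
    (hz : z ∈ g.deg f) :
    g.symmetriser 3 2 1 (tcons x (tcons y (tnil g)) ⊗ₜ tcons z (tnil g)) =
      tcons x (tcons y (tcons z (tnil g))) +
        (-1 : K) ^ (e * f) • tcons x (tcons z (tcons y (tnil g))) +
          (-1 : K) ^ ((d + e) * f) • tcons z (tcons x (tcons y (tnil g))) := by
  rw [symmetriser_succ_succ 2 1 0 x _ z (tnil g)
    (tcons_mem rfl hx (tcons_mem (add_zero e) hy tnil_mem)) hz, symmetriser_one_one hy hz,
    symmetriser_zero_right, tcons_add, tcons_smul]

/-! ### Inserting tensors -/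

/-- The extension of `P ⊗ T → X` to `(g ⊗ P) ⊗ T → g ⊗ X`. -/
def graftStep (n : ℕ) (J : (g.tpow n).carrier ⊗[K] T.carrier →ₗ[K] X.carrier) :
    (g.tpow (n + 1)).carrier ⊗[K] T.carrier →ₗ[K] g.carrier ⊗[K] X.carrier :=
  TensorProduct.map LinearMap.id J ∘ₗ
    (TensorProduct.assoc K g.carrier (g.tpow n).carrier T.carrier).toLinearMap

/-- The action of the ground field. -/
def graftZero (g T : GrVect K) : (g.tpow 0).carrier ⊗[K] T.carrier →ₗ[K] T.carrier :=
  (TensorProduct.lid K T.carrier).toLinearMap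

theorem graftZero_tmul (u : T.carrier) : graftZero g T (tnil g ⊗ₜ u) = u :=
  one_smul K u

/-- The map `(x ⊗ y) ⊗ u ↦ x ⊗ (y ⊗ u)`. -/
def graftTwo (g T : GrVect K) : (g.tpow 2).carrier ⊗[K] T.carrier →ₗ[K]
    g.carrier ⊗[K] (g.carrier ⊗[K] T.carrier) :=
  graftStep (X := g.tensor T) 1 (graftStep 0 (graftZero g T))

/-- The map `(x ⊗ y ⊗ z) ⊗ u ↦ x ⊗ (y ⊗ (z ⊗ u))`. -/
def graftThree (g T : GrVect K) : (g.tpow 3).carrier ⊗[K] T.carrier →ₗ[K]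
    g.carrier ⊗[K] (g.carrier ⊗[K] (g.carrier ⊗[K] T.carrier)) :=
  graftStep (X := g.tensor (g.tensor T)) 2 (graftTwo g T)

theorem graftTwo_tmul (x y : g.carrier) (u : T.carrier) :
    graftTwo g T (tcons x (tcons y (tnil g)) ⊗ₜ u) = x ⊗ₜ (y ⊗ₜ u) :=
  congrArg (fun t => x ⊗ₜ[K] (y ⊗ₜ[K] t)) (graftZero_tmul u)

theorem graftThree_tmul (x y z : g.carrier) (u : T.carrier) :
    graftThree g T (tcons x (tcons y (tcons z (tnil g))) ⊗ₜ u) = x ⊗ₜ (y ⊗ₜ (z ⊗ₜ u)) :=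
  congrArg (fun t => x ⊗ₜ[K] (y ⊗ₜ[K] (z ⊗ₜ[K] t))) (graftZero_tmul u)

theorem graftTwo_natural (n : ℤ) (F : IFam g U V) :
    comp 0 n (strict (graftTwo g V) : IFam g ((g.tpow 2).tensor V) (g.tensor (g.tensor V)))
        (wl n (g.tpow 2) F) =
      comp n 0 (up n (up n F)) (strict (graftTwo g U)) := by
  refine IFam.ext fun l => ?_
  rw [strict_comp_apply, comp_strict_apply]
  apply TensorProduct.ext
  refine tpow_two_ext fun d x hx e y hy => ?_
  ext u
  change graftTwo g V ((wl n (g.tpow 2) F).1 l (tcons x (tcons y (tnil g)) ⊗ₜ u)) =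
    (up n (up n F)).1 l (graftTwo g U (tcons x (tcons y (tnil g)) ⊗ₜ u))
  rw [wl_tmul _ _ _ (tcons_mem rfl hx (tcons_mem (add_zero e) hy tnil_mem)), map_smul,
    graftTwo_tmul, graftTwo_tmul, up_tmul _ _ _ hx, up_tmul _ _ _ hy, TensorProduct.tmul_smul,
    smul_smul, ← zpow_add₀ neg_one_ne_zero', mul_add]

theorem graftThree_natural (n : ℤ) (F : IFam g U V) :
    comp 0 n (strict (graftThree g V) :
        IFam g ((g.tpow 3).tensor V) (g.tensor (g.tensor (g.tensor V)))) (wl n (g.tpow 3) F) =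
      comp n 0 (up n (up n (up n F))) (strict (graftThree g U)) := by
  refine IFam.ext fun l => ?_
  rw [strict_comp_apply, comp_strict_apply]
  apply TensorProduct.ext
  refine tpow_three_ext fun d x hx e y hy f z hz => ?_
  ext u
  change graftThree g V ((wl n (g.tpow 3) F).1 l (tcons x (tcons y (tcons z (tnil g))) ⊗ₜ u)) =
    (up n (up n (up n F))).1 l (graftThree g U (tcons x (tcons y (tcons z (tnil g))) ⊗ₜ u))
  rw [wl_tmul _ _ _ (tcons_mem rfl hx (tcons_mem rfl hy (tcons_mem (add_zero f) hz tnil_mem))),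
    map_smul, graftThree_tmul, graftThree_tmul, up_tmul _ _ _ hx, up_tmul _ _ _ hy,
    up_tmul _ _ _ hz, TensorProduct.tmul_smul, TensorProduct.tmul_smul, TensorProduct.tmul_smul,
    smul_smul, smul_smul, ← zpow_add₀ neg_one_ne_zero', ← zpow_add₀ neg_one_ne_zero', mul_add,
    mul_add, add_assoc]

theorem swapAt_zero_tcons {w : ℕ} {d e : ℤ} {x y : g.carrier} (hx : x ∈ g.deg d)
    (hy : y ∈ g.deg e) (z : (g.tpow w).carrier) :
    g.swapAt (w + 2) 0 (tcons x (tcons y z)) = (-1 : K) ^ (d * e) • tcons y (tcons x z) :=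
  swapMap_tmul g (g.tpow w) hx hy z

theorem swapAt_succ_tcons {w i : ℕ} (x : g.carrier) (z : (g.tpow (w + 1)).carrier) :
    g.swapAt (w + 2) (i + 1) (tcons x z) = tcons x (g.swapAt (w + 1) i z) := rfl

theorem graftTwo_swap (z : (g.tpow 2).carrier) (u : T.carrier) :
    swapMap g T (graftTwo g T (z ⊗ₜ u)) = graftTwo g T (g.swapAt 2 0 z ⊗ₜ u) := by
  refine LinearMap.congr_fun (f := swapMap g T ∘ₗ graftTwo g T ∘ₗ (TensorProduct.mk K _ _).flip u)
    (g := graftTwo g T ∘ₗ (TensorProduct.mk K _ _).flip u ∘ₗ g.swapAt 2 0) ?_ z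
  refine tpow_two_ext fun d x hx e y hy => ?_
  change swapMap g T (graftTwo g T (tcons x (tcons y (tnil g)) ⊗ₜ u)) =
    graftTwo g T (g.swapAt 2 0 (tcons x (tcons y (tnil g))) ⊗ₜ u)
  rw [graftTwo_tmul, swapMap_tmul g T hx hy, swapAt_zero_tcons hx hy,
    ← TensorProduct.smul_tmul', map_smul, graftTwo_tmul]

theorem graftThree_swap (z : (g.tpow 3).carrier) (u : T.carrier) :
    swapMap g (g.tensor T) (graftThree g T (z ⊗ₜ u)) = graftThree g T (g.swapAt 3 0 z ⊗ₜ u) := by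
  refine LinearMap.congr_fun (f := swapMap g (g.tensor T) ∘ₗ graftThree g T ∘ₗ
      (TensorProduct.mk K _ _).flip u)
    (g := graftThree g T ∘ₗ (TensorProduct.mk K _ _).flip u ∘ₗ g.swapAt 3 0) ?_ z
  refine tpow_three_ext fun d x hx e y hy f z hz => ?_
  change swapMap g (g.tensor T) (graftThree g T (tcons x (tcons y (tcons z (tnil g))) ⊗ₜ u)) =
    graftThree g T (g.swapAt 3 0 (tcons x (tcons y (tcons z (tnil g)))) ⊗ₜ u)
  rw [graftThree_tmul, swapMap_tmul g (g.tensor T) hx hy, swapAt_zero_tcons hx hy,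
    ← TensorProduct.smul_tmul', map_smul, graftThree_tmul]

theorem graftThree_swap_succ (z : (g.tpow 3).carrier) (u : T.carrier) :
    TensorProduct.map LinearMap.id (swapMap g T) (graftThree g T (z ⊗ₜ u)) =
      graftThree g T (g.swapAt 3 1 z ⊗ₜ u) := by
  refine LinearMap.congr_fun (f := TensorProduct.map LinearMap.id (swapMap g T) ∘ₗ
      graftThree g T ∘ₗ (TensorProduct.mk K _ _).flip u)
    (g := graftThree g T ∘ₗ (TensorProduct.mk K _ _).flip u ∘ₗ g.swapAt 3 1) ?_ z
  refine tpow_three_ext fun d x hx e y hy f z hz => ?_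
  change TensorProduct.map LinearMap.id (swapMap g T)
      (graftThree g T (tcons x (tcons y (tcons z (tnil g))) ⊗ₜ u)) =
    graftThree g T (g.swapAt 3 1 (tcons x (tcons y (tcons z (tnil g)))) ⊗ₜ u)
  rw [graftThree_tmul, TensorProduct.map_tmul, swapMap_tmul g T hy hz, swapAt_succ_tcons,
    swapAt_zero_tcons hy hz, tcons_smul, ← TensorProduct.smul_tmul', map_smul, graftThree_tmul,
    TensorProduct.tmul_smul, LinearMap.id_apply]

end Tensors

end HLie
end

noncomputable section
namespace HLie

/-! ### Bivector, trivector, and the Maurer-Cartan equation in weights two and three. -/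

section Poisson

variable {K : Type u} [Field K] {g T U V : GrVect K} {L : HomotopyLie g} (P : ShiftedPoisson L)

/-- The family `(-1) ^ (k + 1) f`, where `k` is the number of inputs. -/
def altSign {X : Type u} [AddCommGroup X] [Module K X] (f : Fam g X) : Fam g X :=
  postcomp (fun k => (-1 : K) ^ (k + 1) • LinearMap.id) f

theorem altSign_apply {X : Type u} [AddCommGroup X] [Module K X] (f : Fam g X) (l : List (HEl g)) :
    (altSign f).1 l = (-1 : K) ^ (l.length + 1) • f.1 l := rfl

theorem altSign_skew {X : Type u} [AddCommGroup X] [Module K X] {f : Fam g X} (hf : IsSkew f.1) :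
    IsSkew (altSign f).1 := fun a b x y => by
  rw [altSign_apply, altSign_apply, hf a b x y, smul_comm]
  simp

/-- The insertion `T ⇝ g ⊗ (g ⊗ T)` of the bivector. -/
def biv (T : GrVect K) : IFam g T (g.tensor (g.tensor T)) :=
  comp 0 0 (strict (graftTwo g T)) (ins (Y := g.tpow 2) (altSign (P.p 0)) T)

/-- The insertion `T ⇝ g ⊗ (g ⊗ (g ⊗ T))` of the trivector. -/
def tri (T : GrVect K) : IFam g T (g.tensor (g.tensor (g.tensor T))) :=
  comp 0 (-2) (strict (graftThree g T)) (ins (Y := g.tpow 3) (altSign (P.p 1)) T)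

theorem biv_apply (l : List (HEl g)) (u : T.carrier) :
    (biv P T).1 l u = (-1 : K) ^ (l.length + 1) • graftTwo g T ((P.p 0).1 l ⊗ₜ u) := by
  rw [biv, strict_comp_apply, LinearMap.comp_apply, ins_apply, altSign_apply,
    ← TensorProduct.smul_tmul', map_smul]

theorem tri_apply (l : List (HEl g)) (u : T.carrier) :
    (tri P T).1 l u = (-1 : K) ^ (l.length + 1) • graftThree g T ((P.p 1).1 l ⊗ₜ u) := by
  rw [tri, strict_comp_apply, LinearMap.comp_apply, ins_apply, altSign_apply,
    ← TensorProduct.smul_tmul', map_smul]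

theorem isHomogeneous_biv : IsHomogeneous (g.tpow 2) 0 (altSign (P.p 0)).1 := fun l => by
  have h := P.p_deg 0 l
  rw [show degSum l + 4 - 2 * (((0 : ℕ) : ℤ) + 2) - l.length = degSum l + 0 - l.length by
    push_cast; ring] at h
  exact Submodule.smul_mem _ _ h

theorem isHomogeneous_tri : IsHomogeneous (g.tpow 3) (-2) (altSign (P.p 1)).1 := fun l => by
  have h := P.p_deg 1 l
  rw [show degSum l + 4 - 2 * (((1 : ℕ) : ℤ) + 2) - l.length = degSum l + (-2) - l.length by
    push_cast; ring] at h
  exact Submodule.smul_mem _ _ h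

/-- The bivector has total degree 0, so it passes every intertwiner without a sign. -/
theorem biv_natural (n : ℤ) (F : IFam g U V) :
    comp n 0 (up n (up n F)) (biv P U) = comp 0 n (biv P V) F := by
  rw [biv, biv, ← comp_assoc (mn := n) (by ring) (by ring), ← graftTwo_natural,
    comp_assoc (np := n) (by ring) (by ring),
    ins_natural Even.zero (isHomogeneous_biv P), comp_assoc (by ring) (by ring)]

theorem tri_natural (n : ℤ) (F : IFam g U V) :
    comp n (-2) (up n (up n (up n F))) (tri P U) = comp (-2) n (tri P V) F := by
  rw [tri, tri, ← comp_assoc (mn := n) (by ring) (by ring), ← graftThree_natural,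
    comp_assoc (mn := n) (np := n + -2) (by ring) rfl,
    ins_natural (by decide) (isHomogeneous_tri P),
    comp_assoc (mn := -2) (np := n + -2) (by ring) (by ring)]

theorem graftStep_mem {X : GrVect K} {n : ℕ}
    {J : (g.tpow n).carrier ⊗[K] T.carrier →ₗ[K] X.carrier}
    (hJ : ∀ e, ∀ z ∈ ((g.tpow n).tensor T).deg e, J z ∈ X.deg e) (e : ℤ)
    (z : (g.tpow (n + 1)).carrier ⊗[K] T.carrier) (hz : z ∈ ((g.tpow (n + 1)).tensor T).deg e) :
    graftStep n J z ∈ (g.tensor X).deg e := by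
  rw [← add_zero e]
  refine tensor_mem_of_tmul (X := g.tensor X) _ _ (fun p q w hw u hu => ?_) hz
  have h := tensor_mem_of_tmul (U := g) (V := g.tpow n) (X := g.tensor X)
    (graftStep n J ∘ₗ (TensorProduct.mk K (g.tpow (n + 1)).carrier T.carrier).flip u) q
    (fun p' q' x hx y hy => GrVect.tmul_mem g X (q := q' + q) (by ring) hx
      (hJ _ _ (GrVect.tmul_mem (g.tpow n) T rfl hy hu))) hw
  rwa [add_zero]

theorem graftZero_mem (e : ℤ) (z : (g.tpow 0).carrier ⊗[K] T.carrier)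
    (hz : z ∈ ((g.tpow 0).tensor T).deg e) : graftZero g T z ∈ T.deg e := by
  rw [← add_zero e]
  refine tensor_mem_of_tmul (X := T) _ _ (fun p q c hc u hu => ?_) hz
  change K at c
  change c • u ∈ _
  change c ∈ (if p = 0 then ⊤ else ⊥ : Submodule K K) at hc
  by_cases hp : p = 0
  · subst hp
    rw [zero_add, add_zero]
    exact Submodule.smul_mem _ _ hu
  · rw [if_neg hp, Submodule.mem_bot] at hc
    rw [hc, zero_smul]
    exact zero_mem _

theorem graftTwo_mem (e : ℤ) (z : (g.tpow 2).carrier ⊗[K] T.carrier)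
    (hz : z ∈ ((g.tpow 2).tensor T).deg e) :
    graftTwo g T z ∈ (g.tensor (g.tensor T)).deg e :=
  graftStep_mem (X := g.tensor T) (graftStep_mem graftZero_mem) e z hz

theorem graftThree_mem (e : ℤ) (z : (g.tpow 3).carrier ⊗[K] T.carrier)
    (hz : z ∈ ((g.tpow 3).tensor T).deg e) :
    graftThree g T z ∈ (g.tensor (g.tensor (g.tensor T))).deg e :=
  graftStep_mem (X := g.tensor (g.tensor T)) graftTwo_mem e z hz

theorem biv_mem : biv P T ∈ Hom g T (g.tensor (g.tensor T)) 0 :=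
  comp_mem (by ring) (strict_mem graftTwo_mem)
    (ins_mem (isHomogeneous_biv P) (altSign_skew (P.p_skew 0)))

theorem tri_mem : tri P T ∈ Hom g T (g.tensor (g.tensor (g.tensor T))) (-2) :=
  comp_mem (by ring) (strict_mem graftThree_mem)
    (ins_mem (isHomogeneous_tri P) (altSign_skew (P.p_skew 1)))

theorem biv_swap : comp 0 0 (swp g T) (biv P T) = biv P T := by
  refine IFam.ext fun l => ?_
  rw [swp, strict_comp_apply]
  ext u
  rw [LinearMap.comp_apply, biv_apply, map_smul, graftTwo_swap, P.p_sym 0 l 0]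

theorem tri_swap : comp 0 (-2) (swp g (g.tensor T)) (tri P T) = tri P T := by
  refine IFam.ext fun l => ?_
  rw [swp, strict_comp_apply]
  ext u
  rw [LinearMap.comp_apply, tri_apply, map_smul, graftThree_swap, P.p_sym 1 l 0]

theorem tri_up_swap : comp 0 (-2) (up 0 (swp g T)) (tri P T) = tri P T := by
  refine IFam.ext fun l => ?_
  rw [swp, up_strict, strict_comp_apply]
  ext u
  rw [LinearMap.comp_apply, tri_apply, map_smul, graftThree_swap_succ, P.p_sym 1 l 1]

/-! ### The Maurer-Cartan equation -/

theorem last_piOne (L : HomotopyLie g) (a : List (HEl g)) (y : HEl g) :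
    last L.piOne a y.x =
      (-1 : K) ^ a.length • tcons (n := 0) (L.ell.1 (a ++ [y])) (tnil g) := by
  rw [last_apply]
  change (-1 : K) ^ (((a ++ [y]).length : ℤ) - 1) •
    (L.ell.1 (a ++ [y]) ⊗ₜ[K] (1 : K) : g.carrier ⊗[K] K) = _
  rw [List.length_append, List.length_singleton]
  push_cast
  rw [add_sub_cancel_right, zpow_natCast]
  rfl

theorem varrho_ellAt_tmul (L : HomotopyLie g) (a : List (HEl g)) {d : ℤ} (y : g.deg d)
    (u : T.carrier) : (varrho (ellAt L T)).1 a ((y : g.carrier) ⊗ₜ u) =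
      (-1 : K) ^ (a.length + 1) • (L.ell.1 (a ++ [⟨d, y⟩]) ⊗ₜ u) := by
  rw [varrho_tmul, ellAt_apply]

theorem comp_swp_tmul (n : ℤ) (F : IFam g (g.tensor (g.tensor T)) V) (a : List (HEl g)) {d e : ℤ}
    {x y : g.carrier} (hx : x ∈ g.deg d) (hy : y ∈ g.deg e) (u : T.carrier) :
    (comp n 0 F (swp g T)).1 a (x ⊗ₜ (y ⊗ₜ u)) = (-1 : K) ^ (d * e) • F.1 a (y ⊗ₜ (x ⊗ₜ u)) := by
  rw [swp, comp_strict_apply, LinearMap.comp_apply, swapMap_tmul g T hx hy, map_smul]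

/-- Only the first factor of z is bracketed, and the symmetriser puts the result in either place. On
a symmetric z this becomes the full adjoint action, because `biv_swap` absorbs the `swp`. The minus
sign compares (-1)^{i-1} in π₁^i with (-1)^i in `varrho`. -/
theorem graftTwo_adjoint (L : HomotopyLie g) (a : List (HEl g)) (z : (g.tpow 2).carrier)
    (u : T.carrier) :
    graftTwo g T (g.symmetriser 2 1 1 (TensorProduct.map (last L.piOne a) LinearMap.id
      (z : g.carrier ⊗[K] (g.tpow 1).carrier)) ⊗ₜ u) =
    -((varrho (ellAt L (g.tensor T)) + comp 1 0 (up 1 (varrho (ellAt L T))) (swp g T)).1 a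
      (graftTwo g T (z ⊗ₜ u))) := by
  refine LinearMap.congr_fun (f := graftTwo g T ∘ₗ (TensorProduct.mk K _ _).flip u ∘ₗ
    g.symmetriser 2 1 1 ∘ₗ TensorProduct.map (last L.piOne a) LinearMap.id)
    (g := -((varrho (ellAt L (g.tensor T)) + comp 1 0 (up 1 (varrho (ellAt L T))) (swp g T)).1 a ∘ₗ
      graftTwo g T ∘ₗ (TensorProduct.mk K _ _).flip u)) ?_ z
  refine tpow_two_ext fun d x hx e y hy => ?_
  change graftTwo g T (g.symmetriser 2 1 1 (last L.piOne a x ⊗ₜ tcons y (tnil g)) ⊗ₜ u) =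
    -((varrho (ellAt L (g.tensor T)) + comp 1 0 (up 1 (varrho (ellAt L T))) (swp g T)).1 a
      (graftTwo g T (tcons x (tcons y (tnil g)) ⊗ₜ u)))
  have hv := L.ell_deg (a ++ [(⟨d, ⟨x, hx⟩⟩ : HEl g)])
  rw [last_piOne L a ⟨d, x, hx⟩, ← TensorProduct.smul_tmul', map_smul,
    symmetriser_one_one hv hy, ← TensorProduct.smul_tmul',
    TensorProduct.add_tmul, ← TensorProduct.smul_tmul', map_smul, map_add, map_smul,
    graftTwo_tmul, graftTwo_tmul, graftTwo_tmul, IFam.add_apply, LinearMap.add_apply,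
    comp_swp_tmul _ _ _ hx hy, varrho_ellAt_tmul L a ⟨x, hx⟩, up_tmul _ _ _ hy, varrho_ellAt_tmul L a ⟨x, hx⟩,
    TensorProduct.tmul_smul]
  simp only [smul_add, neg_add, smul_smul, ← neg_smul]
  congr 2
  · ring
  · rw [pow_succ, ← zpow_natCast]
    simp only [mul_one, mul_neg, neg_neg, ← zpow_add₀ (neg_one_ne_zero' (K := K))]
    apply neg_one_zpow_congr
    simp only [List.length_append, List.length_cons, degSum_append, degSum_cons,
      List.length_nil, degSum_nil]
    push_cast
    grind

theorem graftThree_adjoint (L : HomotopyLie g) (a : List (HEl g)) (z : (g.tpow 3).carrier)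
    (u : T.carrier) :
    graftThree g T (g.symmetriser 3 1 2 (TensorProduct.map (last L.piOne a) LinearMap.id
      (z : g.carrier ⊗[K] (g.tpow 2).carrier)) ⊗ₜ u) =
    -((varrho (ellAt L (g.tensor (g.tensor T))) +
      comp 1 0 (up 1 (varrho (ellAt L (g.tensor T)) +
        comp 1 0 (up 1 (varrho (ellAt L T))) (swp g T))) (swp g (g.tensor T))).1 a
      (graftThree g T (z ⊗ₜ u))) := by
  refine LinearMap.congr_fun (f := graftThree g T ∘ₗ (TensorProduct.mk K _ _).flip u ∘ₗ
    g.symmetriser 3 1 2 ∘ₗ TensorProduct.map (last L.piOne a) LinearMap.id)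
    (g := -((varrho (ellAt L (g.tensor (g.tensor T))) +
      comp 1 0 (up 1 (varrho (ellAt L (g.tensor T)) +
        comp 1 0 (up 1 (varrho (ellAt L T))) (swp g T))) (swp g (g.tensor T))).1 a ∘ₗ
      graftThree g T ∘ₗ (TensorProduct.mk K _ _).flip u)) ?_ z
  refine tpow_three_ext fun d x hx e y hy f z hz => ?_
  change graftThree g T (g.symmetriser 3 1 2 (last L.piOne a x ⊗ₜ tcons y (tcons z (tnil g))) ⊗ₜ u) =
    -((varrho (ellAt L (g.tensor (g.tensor T))) +
      comp 1 0 (up 1 (varrho (ellAt L (g.tensor T)) +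
        comp 1 0 (up 1 (varrho (ellAt L T))) (swp g T))) (swp g (g.tensor T))).1 a
      (graftThree g T (tcons x (tcons y (tcons z (tnil g))) ⊗ₜ u)))
  have hv := L.ell_deg (a ++ [(⟨d, ⟨x, hx⟩⟩ : HEl g)])
  rw [last_piOne L a ⟨d, x, hx⟩, ← TensorProduct.smul_tmul', map_smul,
    symmetriser_one_two hv hy hz, ← TensorProduct.smul_tmul',
    TensorProduct.add_tmul, TensorProduct.add_tmul, ← TensorProduct.smul_tmul',
    ← TensorProduct.smul_tmul', map_smul, map_add, map_add, map_smul, map_smul,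
    graftThree_tmul, graftThree_tmul, graftThree_tmul, graftThree_tmul,
    IFam.add_apply, LinearMap.add_apply, comp_swp_tmul (T := g.tensor T) _ _ _ hx hy,
    varrho_ellAt_tmul L a ⟨x, hx⟩, up_tmul _ _ _ hy, IFam.add_apply, LinearMap.add_apply,
    comp_swp_tmul _ _ _ hx hz, varrho_ellAt_tmul L a ⟨x, hx⟩, up_tmul _ _ _ hz, varrho_ellAt_tmul L a ⟨x, hx⟩, TensorProduct.tmul_add,
    TensorProduct.tmul_smul, TensorProduct.tmul_smul, TensorProduct.tmul_smul,
    TensorProduct.tmul_smul, TensorProduct.tmul_smul]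
  simp only [smul_add, neg_add, smul_smul, ← neg_smul, add_assoc]
  have h1 : (-1 : K) ≠ 0 := neg_one_ne_zero'
  congr 2
  · ring
  congr 1
  all_goals
    congr 1
    rw [pow_succ, ← zpow_natCast]
    simp only [mul_one, mul_neg, neg_neg, ← zpow_add₀ h1]
    apply neg_one_zpow_congr
    simp only [List.length_append, List.length_cons, degSum_append, degSum_cons,
      List.length_nil, degSum_nil]
    push_cast
    grind

/-- After the only factor of π₁ has been used as an input, just a scalar is left to symmetrise with.
-/
theorem symmetriser_last_piOne (L : HomotopyLie g) {n : ℕ} (f : Fam g (g.tpow n).carrier)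
    (a b : List (HEl g)) :
    g.symmetriser n n 0 (TensorProduct.map (last f a) LinearMap.id
      (L.piOne.1 b : g.carrier ⊗[K] (g.tpow 0).carrier)) =
    (-1 : K) ^ ((b.length : ℤ) - 1) • f.1 (a ++ [homogeneousValue L.ell_deg b]) := by
  have e : (g.symmetriser n n 0 ∘ₗ TensorProduct.map (last f a) LinearMap.id)
      ((-1 : K) ^ ((b.length : ℤ) - 1) • (L.ell.1 b ⊗ₜ[K] tnil g)) =
      (-1 : K) ^ ((b.length : ℤ) - 1) • f.1 (a ++ [homogeneousValue L.ell_deg b]) := by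
    rw [map_smul, LinearMap.comp_apply, TensorProduct.map_tmul, LinearMap.id_apply,
      symmetriser_zero_right]
    exact congrArg _ (last_apply f a (homogeneousValue L.ell_deg b))
  exact e

theorem sum_antidiagonal_one {M : Type u} [AddCommMonoid M] (D : ℕ × ℕ → M) :
    ∑ q ∈ Finset.HasAntidiagonal.antidiagonal (0 + 1), D q = D (1, 0) + D (0, 1) := by
  rw [show Finset.HasAntidiagonal.antidiagonal (0 + 1) = {(0, 1), (1, 0)} from rfl,
    Finset.sum_pair (by simp), add_comm]

theorem sum_antidiagonal_two {M : Type u} [AddCommMonoid M] (D : ℕ × ℕ → M) :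
    ∑ q ∈ Finset.HasAntidiagonal.antidiagonal (1 + 1), D q = D (2, 0) + (D (1, 1) + D (0, 2)) := by
  rw [show Finset.HasAntidiagonal.antidiagonal (1 + 1) = {(0, 2), (1, 1), (2, 0)} from rfl,
    Finset.sum_insert (by decide), Finset.sum_pair (by simp), add_comm, add_comm (D (1, 1)),
    add_assoc]

/-- The two sums are π₂ after ℓ and ℓ after π₂. -/
theorem maurerCartan_two (l : List (HEl g)) :
    ((shuffles l).map fun s : K × List (HEl g) × List (HEl g) =>
      (s.1 * (-1 : K) ^ (((s.2.1.length : ℤ) + 1) * ((s.2.2.length : ℤ) - 1)) *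
        (-1 : K) ^ ((4 - 2 * (((0 : ℕ) : ℤ) + 1) - s.2.2.length) * degSum s.2.1)) •
        (-1 : K) ^ ((s.2.2.length : ℤ) - 1) •
          (P.p 0).1 (s.2.1 ++ [homogeneousValue L.ell_deg s.2.2])).sum +
    ((shuffles l).map fun s : K × List (HEl g) × List (HEl g) =>
      (s.1 * (-1 : K) ^ (((s.2.1.length : ℤ) + 1) * ((s.2.2.length : ℤ) - 1)) *
        (-1 : K) ^ ((4 - 2 * (((1 : ℕ) : ℤ) + 1) - s.2.2.length) * degSum s.2.1)) •
        g.symmetriser 2 1 1 (TensorProduct.map (last L.piOne s.2.1) LinearMap.id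
          ((P.p 0).1 s.2.2 : g.carrier ⊗[K] (g.tpow 1).carrier))).sum = 0 := by
  refine Eq.trans ?_ ((sum_antidiagonal_one _).symm.trans (P.maurerCartan 0 l))
  exact congrArg₂ (· + ·) (congrArg List.sum (List.map_congr_left fun s _ =>
    congrArg _ (symmetriser_last_piOne L (P.p 0) _ _).symm)) rfl

/-- The outer sums combine π₃ with ℓ. The middle one is π₂ ∘ π₂, which is the obstruction to a
strict Jacobi identity. -/
theorem maurerCartan_three (l : List (HEl g)) :
    ((shuffles l).map fun s : K × List (HEl g) × List (HEl g) =>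
      (s.1 * (-1 : K) ^ (((s.2.1.length : ℤ) + 1) * ((s.2.2.length : ℤ) - 1)) *
        (-1 : K) ^ ((4 - 2 * (((0 : ℕ) : ℤ) + 1) - s.2.2.length) * degSum s.2.1)) •
        (-1 : K) ^ ((s.2.2.length : ℤ) - 1) •
          (P.p 1).1 (s.2.1 ++ [homogeneousValue L.ell_deg s.2.2])).sum +
    (((shuffles l).map fun s : K × List (HEl g) × List (HEl g) =>
      (s.1 * (-1 : K) ^ (((s.2.1.length : ℤ) + 1) * ((s.2.2.length : ℤ) - 1)) *
        (-1 : K) ^ ((4 - 2 * (((1 : ℕ) : ℤ) + 1) - s.2.2.length) * degSum s.2.1)) •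
        g.symmetriser 3 2 1 (TensorProduct.map (last (P.p 0) s.2.1) LinearMap.id
          ((P.p 0).1 s.2.2 : g.carrier ⊗[K] (g.tpow 1).carrier))).sum +
    ((shuffles l).map fun s : K × List (HEl g) × List (HEl g) =>
      (s.1 * (-1 : K) ^ (((s.2.1.length : ℤ) + 1) * ((s.2.2.length : ℤ) - 1)) *
        (-1 : K) ^ ((4 - 2 * (((2 : ℕ) : ℤ) + 1) - s.2.2.length) * degSum s.2.1)) •
        g.symmetriser 3 1 2 (TensorProduct.map (last L.piOne s.2.1) LinearMap.id
          ((P.p 1).1 s.2.2 : g.carrier ⊗[K] (g.tpow 2).carrier))).sum) = 0 := by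
  refine Eq.trans ?_ ((sum_antidiagonal_two _).symm.trans (P.maurerCartan 1 l))
  exact congrArg₂ (· + ·) (congrArg List.sum (List.map_congr_left fun s _ =>
    congrArg _ (symmetriser_last_piOne L (P.p 1) _ _).symm)) rfl

/-- The signs of `varrho` and of `altSign` refer to numbers of inputs that differ by one, so their
product is always -1. -/
theorem varrho_biv (a : List (HEl g)) : (varrho (biv P T)).1 a =
    -(graftTwo g T ∘ₗ TensorProduct.map (last (P.p 0) a) LinearMap.id) := by
  refine GrVect.tensor_hom_ext_left (U := g) (V := T) fun d x u => ?_
  rw [varrho_tmul, biv_apply, smul_smul]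
  change _ = -(graftTwo g T (last (P.p 0) a (x : g.carrier) ⊗ₜ u))
  have e := last_apply (P.p 0) a ⟨d, x⟩
  rw [e, List.length_append, List.length_singleton, ← pow_add,
    Odd.neg_one_pow (n := a.length + 1 + (a.length + 1 + 1)) ⟨a.length + 1, by ring⟩,
    neg_one_smul]

/-- The sum of the ways to move the third tensor factor to the left. -/
def cycleSum (g T : GrVect K) : g.carrier ⊗[K] (g.carrier ⊗[K] (g.carrier ⊗[K] T.carrier)) →ₗ[K]
    g.carrier ⊗[K] (g.carrier ⊗[K] (g.carrier ⊗[K] T.carrier)) :=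
  LinearMap.id + TensorProduct.map LinearMap.id (swapMap g T) +
    swapMap g (g.tensor T) ∘ₗ TensorProduct.map LinearMap.id (swapMap g T)

theorem cycleSum_tmul {d d' e : ℤ} {x x' y : g.carrier} (hx : x ∈ g.deg d) (hx' : x' ∈ g.deg d')
    (hy : y ∈ g.deg e) (u : T.carrier) : cycleSum g T (x ⊗ₜ (x' ⊗ₜ (y ⊗ₜ u))) =
      x ⊗ₜ (x' ⊗ₜ (y ⊗ₜ u)) + (-1 : K) ^ (d' * e) • x ⊗ₜ (y ⊗ₜ (x' ⊗ₜ u)) +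
        (-1 : K) ^ ((d + d') * e) • y ⊗ₜ (x ⊗ₜ (x' ⊗ₜ u)) := by
  rw [cycleSum, LinearMap.add_apply,
    LinearMap.add_apply, LinearMap.id_apply, LinearMap.comp_apply, TensorProduct.map_tmul,
    LinearMap.id_apply, swapMap_tmul g T hx' hy, TensorProduct.tmul_smul, map_smul,
    swapMap_tmul g (g.tensor T) hx hy, smul_smul, ← zpow_add₀ neg_one_ne_zero', add_mul,
    add_comm (d * e)]

/-- The untouched factor of z can take any of three places among the two factors produced by f. It
starts in the last place, and `cycleSum` moves it to the left. -/
theorem graftThree_product (f : Fam g (g.tpow 2).carrier) (a : List (HEl g))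
    (z : (g.tpow 2).carrier)
    (u : T.carrier) :
    graftThree g T (g.symmetriser 3 2 1 (TensorProduct.map (last f a) LinearMap.id
      (z : g.carrier ⊗[K] (g.tpow 1).carrier)) ⊗ₜ u) =
    cycleSum g T
      (graftTwo g (g.tensor T) (TensorProduct.map (last f a) LinearMap.id
        (graftTwo g T (z ⊗ₜ u)))) := by
  have key : ∀ {e : ℤ} (y : g.carrier), y ∈ g.deg e → ∀ w : (g.tpow 2).carrier,
      graftThree g T (g.symmetriser 3 2 1 (w ⊗ₜ tcons y (tnil g)) ⊗ₜ u) =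
      cycleSum g T
        (graftTwo g (g.tensor T) (w ⊗ₜ (y ⊗ₜ u))) := by
    intro e y hy w
    refine LinearMap.congr_fun (f := graftThree g T ∘ₗ (TensorProduct.mk K _ _).flip u ∘ₗ
      g.symmetriser 3 2 1 ∘ₗ (TensorProduct.mk K _ _).flip (tcons y (tnil g)))
      (g := cycleSum g T ∘ₗ
        graftTwo g (g.tensor T) ∘ₗ (TensorProduct.mk K _ _).flip (y ⊗ₜ u)) ?_ w
    refine tpow_two_ext fun d x hx d' x' hx' => ?_
    change graftThree g T (g.symmetriser 3 2 1
      (tcons x (tcons x' (tnil g)) ⊗ₜ tcons y (tnil g)) ⊗ₜ u) =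
      cycleSum g T
      (graftTwo g (g.tensor T) (tcons x (tcons x' (tnil g)) ⊗ₜ (y ⊗ₜ u)))
    rw [symmetriser_two_one hx hx' hy, TensorProduct.add_tmul, TensorProduct.add_tmul,
      ← TensorProduct.smul_tmul', ← TensorProduct.smul_tmul', map_add, map_add, map_smul, map_smul,
      graftThree_tmul, graftThree_tmul, graftThree_tmul, graftTwo_tmul, cycleSum_tmul hx hx' hy]
  refine LinearMap.congr_fun (f := graftThree g T ∘ₗ (TensorProduct.mk K _ _).flip u ∘ₗ
    g.symmetriser 3 2 1 ∘ₗ (TensorProduct.map (last f a) LinearMap.id :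
      g.carrier ⊗[K] (g.tpow 1).carrier →ₗ[K] (g.tpow 2).carrier ⊗[K] (g.tpow 1).carrier))
    (g := cycleSum g T ∘ₗ
      graftTwo g (g.tensor T) ∘ₗ TensorProduct.map (last f a) LinearMap.id ∘ₗ
      graftTwo g T ∘ₗ (TensorProduct.mk K (g.tpow 2).carrier T.carrier).flip u) ?_ z
  refine tpow_two_ext fun d x hx e y hy => ?_
  change graftThree g T (g.symmetriser 3 2 1 (last f a x ⊗ₜ tcons y (tnil g)) ⊗ₜ u) =
    cycleSum g T
      (graftTwo g (g.tensor T) (TensorProduct.map (last f a) LinearMap.id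
        (graftTwo g T (tcons x (tcons y (tnil g)) ⊗ₜ u))))
  rw [key y hy, graftTwo_tmul, TensorProduct.map_tmul, LinearMap.id_apply]

theorem neg_eq_zpow_smul (K : Type u) [Field K] {M : Type u} [AddCommGroup M] [Module K M] (x : M) :
    -x = (-1 : K) ^ (1 : ℤ) • x := by
  rw [zpow_one, neg_one_smul]

theorem biv_maurerCartan :
    comp (-1) 2 (varrho (biv P T)) (ellAt L T) +
      comp 1 0 (varrho (ellAt L (g.tensor T)) + comp 1 0 (up 1 (varrho (ellAt L T))) (swp g T))
        (biv P T) = 0 := by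
  have h1 : (-1 : K) ≠ 0 := neg_one_ne_zero'
  refine IFam.ext fun l => ?_
  ext u
  -- The Maurer-Cartan equation is grafted onto u and multiplied by the sign that `altSign` gives to
  -- the total number of inputs. After that the terms agree shuffle by shuffle.
  have h := congrArg (fun z => (-1 : K) ^ ((l.length : ℤ) + 1) •
    (graftTwo g T ∘ₗ (TensorProduct.mk K (g.tpow 2).carrier T.carrier).flip u) z)
    (maurerCartan_two P l)
  simp only [map_zero, smul_zero, map_add, smul_add] at h
  rw [map_list_sum, map_list_sum, List.smul_sum, List.smul_sum, List.map_map, List.map_map,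
    List.map_map, List.map_map] at h
  change _ = (0 : g.carrier ⊗[K] (g.carrier ⊗[K] T.carrier))
  rw [← h, IFam.add_apply, LinearMap.add_apply, comp_apply_apply, comp_apply_apply]
  congr 2
  · refine List.map_congr_left fun s hs => ?_
    obtain ⟨e1, -⟩ := shuffles_lengths hs
    simp only [Function.comp_apply]
    have e3 := varrho_tmul (biv P T) s.2.1 (homogeneousValue L.ell_deg s.2.2).x u
    change (varrho (biv P T)).1 s.2.1 (L.ell.1 s.2.2 ⊗ₜ u) = (-1 : K) ^ (s.2.1.length + 1) •
      (biv P T).1 (s.2.1 ++ [homogeneousValue L.ell_deg s.2.2]) u at e3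
    rw [map_smul, map_smul, ellAt_apply, e3, biv_apply, LinearMap.comp_apply,
      LinearMap.flip_apply, TensorProduct.mk_apply]
    simp only [smul_smul]
    congr 1
    simp only [mul_left_comm _ s.1, mul_assoc, ← zpow_add₀ h1, ← zpow_natCast]
    congr 1
    apply neg_one_zpow_congr
    simp only [← e1, List.length_append, List.length_singleton]
    push_cast
    grind
  · refine List.map_congr_left fun s hs => ?_
    obtain ⟨e1, -⟩ := shuffles_lengths hs
    simp only [Function.comp_apply]
    rw [map_smul, LinearMap.comp_apply,
      LinearMap.flip_apply, TensorProduct.mk_apply, graftTwo_adjoint, biv_apply, map_smul]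
    rw [neg_eq_zpow_smul K (M := g.carrier ⊗[K] (g.carrier ⊗[K] T.carrier))]
    simp only [smul_smul]
    congr 1
    simp only [mul_left_comm _ s.1, mul_assoc, ← zpow_add₀ h1, ← zpow_natCast]
    congr 1
    apply neg_one_zpow_congr
    simp only [← e1]
    push_cast
    grind

/-- The last summand is π₂ ∘ π₂: a leg of the inner bivector becomes the last input of the outer
one, which is what the derivative of `biv` expresses. -/
theorem tri_maurerCartan :
    comp (-3) 2 (varrho (tri P T)) (ellAt L T) +
      (comp 1 (-2) (varrho (ellAt L (g.tensor (g.tensor T))) +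
        comp 1 0 (up 1 (varrho (ellAt L (g.tensor T)) +
          comp 1 0 (up 1 (varrho (ellAt L T))) (swp g T))) (swp g (g.tensor T))) (tri P T) +
      comp 0 (-1) (strict (cycleSum g T)) (comp (-1) 0 (varrho (biv P (g.tensor T))) (biv P T))) =
    0 := by
  have h1 : (-1 : K) ≠ 0 := neg_one_ne_zero'
  refine IFam.ext fun l => ?_
  ext u
  have h := congrArg (fun z => (-1 : K) ^ ((l.length : ℤ) + 1) •
    (graftThree g T ∘ₗ (TensorProduct.mk K (g.tpow 3).carrier T.carrier).flip u) z)
    (maurerCartan_three P l)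
  simp only [map_zero, smul_zero, map_add, smul_add] at h
  rw [map_list_sum, map_list_sum, map_list_sum, List.smul_sum, List.smul_sum, List.smul_sum,
    List.map_map, List.map_map,
    List.map_map, List.map_map, List.map_map, List.map_map, add_comm (List.sum _) (List.sum _)] at h
  change _ = (0 : g.carrier ⊗[K] (g.carrier ⊗[K] (g.carrier ⊗[K] T.carrier)))
  rw [← h, IFam.add_apply, LinearMap.add_apply, IFam.add_apply, LinearMap.add_apply,
    strict_comp_apply, LinearMap.comp_apply, comp_apply_apply, comp_apply_apply, comp_apply_apply,
    map_list_sum, List.map_map]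
  refine congrArg₂ _ (congrArg _ (List.map_congr_left fun s hs => ?_))
    (congrArg₂ _ (congrArg _ (List.map_congr_left fun s hs => ?_))
      (congrArg _ (List.map_congr_left fun s hs => ?_)))
  · obtain ⟨e1, -⟩ := shuffles_lengths hs
    simp only [Function.comp_apply]
    have e3 := varrho_tmul (tri P T) s.2.1 (homogeneousValue L.ell_deg s.2.2).x u
    change (varrho (tri P T)).1 s.2.1 (L.ell.1 s.2.2 ⊗ₜ u) = (-1 : K) ^ (s.2.1.length + 1) •
      (tri P T).1 (s.2.1 ++ [homogeneousValue L.ell_deg s.2.2]) u at e3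
    rw [map_smul, map_smul, ellAt_apply, e3, tri_apply, LinearMap.comp_apply,
      LinearMap.flip_apply, TensorProduct.mk_apply]
    simp only [smul_smul]
    congr 1
    simp only [mul_left_comm _ s.1, mul_assoc, ← zpow_add₀ h1, ← zpow_natCast]
    congr 1
    apply neg_one_zpow_congr
    simp only [← e1, List.length_append, List.length_singleton]
    push_cast
    grind
  · obtain ⟨e1, -⟩ := shuffles_lengths hs
    simp only [Function.comp_apply]
    rw [map_smul, LinearMap.comp_apply,
      LinearMap.flip_apply, TensorProduct.mk_apply, graftThree_adjoint, tri_apply, map_smul]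
    rw [neg_eq_zpow_smul K (M := g.carrier ⊗[K] (g.carrier ⊗[K] (g.carrier ⊗[K] T.carrier)))]
    simp only [smul_smul]
    congr 1
    simp only [mul_left_comm _ s.1, mul_assoc, ← zpow_add₀ h1, ← zpow_natCast]
    congr 1
    apply neg_one_zpow_congr
    simp only [← e1]
    push_cast
    grind
  · obtain ⟨e1, -⟩ := shuffles_lengths hs
    simp only [Function.comp_apply]
    rw [map_smul, map_smul, LinearMap.comp_apply,
      LinearMap.flip_apply, TensorProduct.mk_apply, graftThree_product, biv_apply, map_smul,
      varrho_biv, LinearMap.neg_apply, LinearMap.comp_apply,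
      neg_eq_zpow_smul K (M := g.carrier ⊗[K] (g.carrier ⊗[K] (g.carrier ⊗[K] T.carrier)))]
    simp only [map_smul, smul_smul]
    congr 1
    simp only [mul_left_comm _ s.1, mul_assoc, ← zpow_add₀ h1, ← zpow_natCast]
    congr 1
    apply neg_one_zpow_congr
    simp only [← e1]
    push_cast
    grind

/-- By naturality the contributions of r cancel, so r is arbitrary. What is left is weight two of
the Maurer-Cartan equation. -/
theorem pdiff_biv (r : IFam g T T) : pdiff L r (rhoUp L (rhoUp L r)) 0 (biv P T) = 0 := by
  have h := biv_maurerCartan P (T := T)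
  rw [comp_add_left, comp_assoc (mn := 1) (np := 0) (by ring) (by ring), biv_swap] at h
  rw [pdiff, rhoUp, rhoUp, up_sub, comp_sub_left, comp_sub_left, biv_natural, zpow_zero,
    one_smul, show (0 : ℤ) - 1 = -1 by norm_num, ← neg_eq_zero, ← h]
  abel

/-- The symmetry of π₃ absorbs the swaps in the three adjoint terms. Of weight three of the
Maurer-Cartan equation only π₂ ∘ π₂ remains, so the trivector is a homotopy that kills it. -/
theorem pdiff_tri (r : IFam g T T) :
    pdiff L r (rhoUp L (rhoUp L (rhoUp L r))) (-2) (tri P T) =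
      comp 0 (-1) (strict (cycleSum g T))
        (comp (-1) 0 (varrho (biv P (g.tensor T))) (biv P T)) := by
  have h := tri_maurerCartan P (T := T)
  rw [comp_add_left, comp_assoc (mn := 1) (np := -2) (by ring) (by ring), tri_swap, up_add,
    comp_add_left, up_comp (by ring), comp_assoc (mn := 1) (np := -2) (by ring) (by ring),
    tri_up_swap] at h
  rw [pdiff, rhoUp, rhoUp, rhoUp, up_sub, up_sub, up_sub, comp_sub_left, comp_sub_left,
    comp_sub_left, tri_natural, Even.neg_one_zpow (by decide), one_smul, ← sub_eq_zero]
  rw [show (-2 : ℤ) - 1 = -3 by norm_num]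
  rw [← neg_eq_zero, ← h]
  abel

end Poisson

end HLie
end

noncomputable section
namespace HLie

/-! ### The bracket of two intertwiners. -/

section Brackets

variable {K : Type u} [Field K] {g A B C D X Y Z X' Y' Z' T : GrVect K} {L : HomotopyLie g}
  (P : ShiftedPoisson L)

theorem Commuting.add {m n : ℤ} {F : IFam g A B} {F' : IFam g C D} {H₁ H₂ : IFam g A C}
    {H₁' H₂' : IFam g B D} (h₁ : Commuting m n F F' H₁ H₁') (h₂ : Commuting m n F F' H₂ H₂') :
    Commuting m n F F' (H₁ + H₂) (H₁' + H₂') := fun a b => by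
  rw [IFam.add_apply, IFam.add_apply, LinearMap.add_comp, LinearMap.comp_add, h₁ a b, h₂ a b,
    smul_add]

theorem commuting_strict (m : ℤ) {F : IFam g A B} {F' : IFam g C D} {φ : A.carrier →ₗ[K] C.carrier}
    {φ' : B.carrier →ₗ[K] D.carrier} (h : ∀ a, φ' ∘ₗ F.1 a = F'.1 a ∘ₗ φ) :
    Commuting m 0 F F' (strict φ) (strict φ') := by
  rintro a (_ | ⟨x, b⟩)
  · rw [strict_nil, strict_nil, h]
    simp
  · rw [strict_cons, strict_cons, LinearMap.zero_comp, LinearMap.comp_zero, smul_zero]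

/-- The bracket `d F (1 ⊙ d G) ϖ` of two intertwiners of degrees `m + 1` and `n + 1`. -/
def brk (m n : ℤ) (F : IFam g Y Z) (G : IFam g X Y) : IFam g X Z :=
  comp m n (varrho F) (comp n 0 (up n (varrho G)) (biv P X))

variable {P}

theorem brk_add_left (m n : ℤ) (F F' : IFam g Y Z) (G : IFam g X Y) :
    brk P m n (F + F') G = brk P m n F G + brk P m n F' G := by
  rw [brk, varrho_add, comp_add_left]; rfl

theorem brk_add_right (m n : ℤ) (F : IFam g Y Z) (G G' : IFam g X Y) :
    brk P m n F (G + G') = brk P m n F G + brk P m n F G' := by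
  rw [brk, varrho_add, up_add, comp_add_left, comp_add_right]; rfl

theorem brk_smul_left (m n : ℤ) (c : K) (F : IFam g Y Z) (G : IFam g X Y) :
    brk P m n (c • F) G = c • brk P m n F G := by
  rw [brk, varrho_smul, comp_smul_left]; rfl

theorem brk_smul_right (m n : ℤ) (c : K) (F : IFam g Y Z) (G : IFam g X Y) :
    brk P m n F (c • G) = c • brk P m n F G := by
  rw [brk, varrho_smul, up_smul, comp_smul_left, comp_smul_right]; rfl

/-- A map without inputs has zero derivative. This removes braidings and identities from brackets.
-/
theorem brk_strict_left (m n : ℤ) (φ : Y.carrier →ₗ[K] Z.carrier) (G : IFam g X Y) :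
    brk P m n (strict φ) G = 0 := by
  rw [brk, varrho_strict, comp_zero_left]

theorem up_zero (n : ℤ) : up n (0 : IFam g X Y) = 0 := by
  rw [← zero_smul K (0 : IFam g X Y), up_smul, zero_smul]

theorem brk_strict_right (m n : ℤ) (F : IFam g Y Z) (φ : X.carrier →ₗ[K] Y.carrier) :
    brk P m n F (strict φ) = 0 := by
  rw [brk, varrho_strict, up_zero, comp_zero_left, comp_zero_right]

theorem brk_mem {m n mn m' n' : ℤ} (hmn : mn = m + n) (hm : m' = m + 1) (hn : n' = n + 1)
    {F : IFam g Y Z} {G : IFam g X Y} (hF : F ∈ Hom g Y Z m') (hG : G ∈ Hom g X Y n') :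
    brk P m n F G ∈ Hom g X Z mn :=
  comp_mem hmn (varrho_mem (by omega) hF)
    (comp_mem (by omega) (up_mem (varrho_mem (by omega) hG)) (biv_mem P))

/-- `Commuting.swap` leaves a transposition of the two legs of the bivector, which symmetry absorbs.
-/
theorem brk_swap {m n m' n' : ℤ} (hm : m' = m + 1) (hn : n' = n + 1) {F : IFam g A B}
    {F' : IFam g C D} {H : IFam g A C} {H' : IFam g B D} (h : Commuting m' n' F F' H H') :
    brk P n m H' F = (-1 : K) ^ (m * n) • brk P m n F' H := by
  rw [brk, ← comp_assoc (mn := n + m) rfl (by ring), h.swap (by omega) (by omega), comp_smul_left,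
    comp_assoc (np := n) (by ring) (by ring), comp_assoc (np := 0) (by ring) (by ring), biv_swap]
  rfl

/-- The vertical maps slide through ϱ_F, then through 1 ⊙ ϱ_G, and finally through the bivector. -/
theorem brk_natural {m n mn : ℤ} (hmn : mn = m + n) {F : IFam g Y Z} {F' : IFam g Y' Z'}
    {G : IFam g X Y} {G' : IFam g X' Y'} {H₁ : IFam g X X'} {H₂ : IFam g Y Y'} {H₃ : IFam g Z Z'}
    (hF : Commuting (m + 1) 0 F F' H₂ H₃) (hG : Commuting (n + 1) 0 G G' H₁ H₂) :
    comp 0 mn H₃ (brk P m n F G) = comp mn 0 (brk P m n F' G') H₁ := by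
  subst hmn
  have h1 := (hF.varrho (m' := m) (by ring)).comp_eq
  have h2 := (hG.varrho (m' := n) (by ring)).up.comp_eq
  rw [mul_zero, zpow_zero, one_smul] at h1 h2
  rw [brk, brk, ← comp_assoc (mn := m) (by ring) rfl, h1,
    comp_assoc (mn := m) (np := n) (by ring) (by ring),
    ← comp_assoc (m := 0) (mn := n) (np := n) (by ring) (by ring), h2,
    comp_assoc (mn := n) (np := 0) (by ring) (by ring),
    comp_assoc (mn := m + n) (np := n) (by ring) (by ring),
    comp_assoc (mn := n) (np := 0) (by ring) (by ring), biv_natural]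

/-! ### Differentials of brackets -/

variable {rX : IFam g X X} {rY : IFam g Y Y} {rZ : IFam g Z Z}

/-- The Leibniz rule, with the third term gone because the bivector is closed. -/
theorem pdiff_brk {m n mn m' n' : ℤ} (hmn : mn = m + n) (hm : m' = m + 1) (hn : n' = n + 1)
    (F : IFam g Y Z) (G : IFam g X Y) :
    pdiff L rX rZ mn (brk P m n F G) =
      comp m' n (pdiff L (rhoUp L rY) rZ m (varrho F)) (comp n 0 (up n (varrho G)) (biv P X)) +
      (-1 : K) ^ m • comp m n' (varrho F)
        (comp n' 0 (up n' (pdiff L (rhoUp L rX) rY n (varrho G))) (biv P X)) := by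
  rw [brk, pdiff_comp (rV := rhoUp L rY) hmn hm hn,
    pdiff_comp (rV := rhoUp L (rhoUp L rX)) (n' := 1) (m' := n') (by ring) hn (by norm_num),
    pdiff_biv, comp_zero_right, smul_zero, add_zero, pdiff_up hn]

/-- When the structure maps split as R + S, the part that commutes with F drops out of
`pdiff_varrho`. -/
theorem pdiff_varrho_of_commuting {m m' : ℤ} (hm : m' = m - 1) {F : IFam g X Y} (hF : IsSkew F.1)
    {R S : IFam g X X} {R' S' : IFam g Y Y} (hX : rX = R + S) (hY : rY = R' + S')
    (h : Commuting m 1 F F S S') :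
    pdiff L (rhoUp L rX) rY m' (varrho F) = -varrho (pdiff L rX rY m F) +
      comp 0 m (varrho R') (up m F) - comp m 0 F (varrho R) := by
  have h1 := (h.symm.varrho (m' := 0) (by norm_num)).comp_eq
  rw [zero_mul, zpow_zero, one_smul] at h1
  rw [pdiff_varrho hm hF, hX, hY, varrho_add, varrho_add, comp_add_left, comp_add_right, h1]
  abel

/-- The cross terms with Q cancel. Of the contributions SS, SS and -ϱ_S ℓ = -SS, one survives. -/
theorem pdiff_action {Q S : IFam g X X} (hX : rX = Q + S) (h : Commuting 1 1 Q Q S S)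
    (hS : comp 1 1 S S = comp 0 2 (varrho S) (ellAt L X)) :
    pdiff L rX rX 1 S = comp 1 1 S S := by
  have h1 := h.comp_eq
  rw [one_mul, zpow_one, IFam.neg_one_smul] at h1
  rw [pdiff, hX, comp_add_left, comp_add_right, h1, show (1 : ℤ) - 1 = 0 by norm_num, ← hS,
    zpow_one, IFam.neg_one_smul]
  abel

/-- By `pdiff_action` and the derivation rule, -ϱ_{SS} cancels against ϱ_S (1 ⊙ S) - S ϱ_S. Thus S
itself need not be closed, yet it behaves like a closed argument of the bracket. -/
theorem pdiff_varrho_action {Q S : IFam g X X} (hX : rX = Q + S) (h : Commuting 1 1 Q Q S S)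
    (hS : comp 1 1 S S = comp 0 2 (varrho S) (ellAt L X)) (hs : IsSkew S.1) :
    pdiff L (rhoUp L rX) rX 0 (varrho S) = 0 := by
  have hX' : rX = S + Q := by rw [hX, add_comm]
  rw [pdiff_varrho_of_commuting (m := 1) (by norm_num) hs hX' hX' h.symm, pdiff_action hX h hS,
    varrho_comp (m' := 0) (n' := 0) (by norm_num) (by norm_num), zpow_one, IFam.neg_one_smul]
  abel

/-! ### Permuting tensor factors -/

/-- The spectator factor is moved past both legs of the bivector, one after the other. -/
theorem up_biv : up 0 (biv P T) = comp 0 0 (swp g (g.tensor T))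
    (comp 0 0 (up 0 (swp g T)) (biv P (g.tensor T))) := by
  refine IFam.ext fun l => ?_
  refine GrVect.tensor_hom_ext_left fun d y u => ?_
  rw [swp, swp, up_strict, strict_comp_apply, strict_comp_apply, up_tmul _ _ _ y.2,
    LinearMap.comp_apply, LinearMap.comp_apply, biv_apply, biv_apply, map_smul, map_smul,
    TensorProduct.tmul_smul, smul_comm]
  congr 1
  have key : ∀ z : (g.tpow 2).carrier, ∀ e, z ∈ (g.tpow 2).deg e →
      (-1 : K) ^ (e * d) • ((y : g.carrier) ⊗ₜ[K] graftTwo g T (z ⊗ₜ u)) =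
      swapMap g (g.tensor T) (TensorProduct.map LinearMap.id (swapMap g T)
        (graftTwo g (g.tensor T) (z ⊗ₜ ((y : g.carrier) ⊗ₜ u)))) := by
    intro z e hz
    -- Writing the Koszul sign through the operator `sgn` makes both sides linear in z, so it
    -- suffices to compare pure tensors.
    have e1 : (TensorProduct.mk K g.carrier (g.carrier ⊗[K] (g.carrier ⊗[K] T.carrier)) y ∘ₗ
        graftTwo g T ∘ₗ (TensorProduct.mk K (g.tpow 2).carrier T.carrier).flip u) ∘ₗ
          (g.tpow 2).sgn d = swapMap g (g.tensor T) ∘ₗ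
        TensorProduct.map LinearMap.id (swapMap g T) ∘ₗ graftTwo g (g.tensor T) ∘ₗ
        (TensorProduct.mk K (g.tpow 2).carrier (g.carrier ⊗[K] T.carrier)).flip (y ⊗ₜ u) := by
      refine tpow_two_ext fun p x hx q x' hx' => ?_
      have h2 : tcons x (tcons x' (tnil g)) ∈ (g.tpow 2).deg (p + q) :=
        tcons_mem rfl hx (tcons_mem (add_zero q) hx' tnil_mem)
      rw [LinearMap.comp_apply, GrVect.sgn_apply _ _ h2, map_smul]
      change (-1 : K) ^ (d * (p + q)) • ((y : g.carrier) ⊗ₜ[K]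
        (graftTwo g T (tcons x (tcons x' (tnil g)) ⊗ₜ u))) = swapMap g (g.tensor T)
          (TensorProduct.map LinearMap.id (swapMap g T) (graftTwo g (g.tensor T)
            (tcons x (tcons x' (tnil g)) ⊗ₜ ((y : g.carrier) ⊗ₜ u))))
      rw [graftTwo_tmul, graftTwo_tmul, TensorProduct.map_tmul, LinearMap.id_apply,
        swapMap_tmul g T hx' y.2, TensorProduct.tmul_smul, map_smul,
        swapMap_tmul g (g.tensor T) hx y.2, smul_smul, ← zpow_add₀ neg_one_ne_zero']
      congr 1
      apply neg_one_zpow_congr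
      push_cast
      grind
    have e2 := LinearMap.congr_fun e1 z
    rw [LinearMap.comp_apply, GrVect.sgn_apply _ _ hz, map_smul, mul_comm] at e2
    exact e2
  have hz := P.p_deg 0 l
  rw [show degSum l + 4 - 2 * (((0 : ℕ) : ℤ) + 2) - l.length = degSum l - l.length by
    push_cast; ring] at hz
  rw [← key _ _ hz]
  congr 2
  ring

/-- The derivative of `up_biv`. The swaps have none, and the `swp` contributed by `varrho_up` is
moved to the other side. -/
theorem up_varrho_biv : up (-1) (varrho (biv P T)) = comp 0 (-1) (swp g (g.tensor T))
    (comp 0 (-1) (up 0 (swp g T)) (comp (-1) 0 (varrho (biv P (g.tensor T))) (swp g T))) := by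
  have h := congrArg (fun F => comp (-1) 0 (varrho F) (swp g T)) (up_biv (P := P) (T := T))
  beta_reduce at h
  rw [varrho_up (n' := -1) (by norm_num), comp_assoc (mn := -1) (np := 0) (by ring) (by ring),
    swp_comp_swp, comp_one] at h
  rw [h, varrho_comp (m' := -1) (n' := -1) (by norm_num) (by norm_num),
    varrho_comp (m' := -1) (n' := -1) (by norm_num) (by norm_num), swp, swp, up_strict,
    varrho_strict, varrho_strict, comp_zero_left, comp_zero_left, zero_add, zero_add, zpow_zero,
    one_smul, one_smul, comp_assoc (mn := -1) (np := -1) (by ring) (by ring),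
    comp_assoc (mn := -1) (np := -1) (by ring) (by ring)]

/-- The braid relation: both sides reverse the order of the three factors. -/
theorem swapMap_braid (g T : GrVect K) :
    TensorProduct.map LinearMap.id (swapMap g T) ∘ₗ swapMap g (g.tensor T) ∘ₗ
      TensorProduct.map LinearMap.id (swapMap g T) =
    swapMap g (g.tensor T) ∘ₗ TensorProduct.map LinearMap.id (swapMap g T) ∘ₗ
      swapMap g (g.tensor T) := by
  refine GrVect.tensor_hom_ext_left (U := g) (V := g.tensor (g.tensor T)) fun d x w => ?_
  refine LinearMap.congr_fun (f := (TensorProduct.map LinearMap.id (swapMap g T) ∘ₗ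
      swapMap g (g.tensor T) ∘ₗ TensorProduct.map LinearMap.id (swapMap g T)) ∘ₗ
      TensorProduct.mk K g.carrier (g.carrier ⊗[K] (g.carrier ⊗[K] T.carrier)) x)
    (g := (swapMap g (g.tensor T) ∘ₗ TensorProduct.map LinearMap.id (swapMap g T) ∘ₗ
      swapMap g (g.tensor T)) ∘ₗ
      TensorProduct.mk K g.carrier (g.carrier ⊗[K] (g.carrier ⊗[K] T.carrier)) x)
    (swapMap_ext fun e f y hy z hz u => ?_) w
  change TensorProduct.map LinearMap.id (swapMap g T) (swapMap g (g.tensor T)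
      (TensorProduct.map LinearMap.id (swapMap g T) ((x : g.carrier) ⊗ₜ[K] (y ⊗ₜ[K] (z ⊗ₜ[K] u))))) =
    swapMap g (g.tensor T) (TensorProduct.map LinearMap.id (swapMap g T)
      (swapMap g (g.tensor T) ((x : g.carrier) ⊗ₜ[K] (y ⊗ₜ[K] (z ⊗ₜ[K] u)))))
  rw [TensorProduct.map_tmul, LinearMap.id_apply, swapMap_tmul g T hy hz, TensorProduct.tmul_smul,
    map_smul, swapMap_tmul g (g.tensor T) x.2 hz, map_smul, map_smul, TensorProduct.map_tmul,
    LinearMap.id_apply, swapMap_tmul g T x.2 hy, swapMap_tmul g (g.tensor T) x.2 hy,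
    map_smul, TensorProduct.map_tmul, LinearMap.id_apply, swapMap_tmul g T x.2 hz,
    TensorProduct.tmul_smul, TensorProduct.tmul_smul, map_smul, map_smul,
    swapMap_tmul g (g.tensor T) hy hz]
  module

end Brackets

end HLie
end

noncomputable section
namespace HLie

/-! ### The Jacobi identity of the bracket, up to the trivector. -/

section Coherence

variable {K : Type u} [Field K] {g U V W X T : GrVect K} {L : HomotopyLie g}
  {P : ShiftedPoisson L}

theorem comp_assoc_simp {U V W W' : GrVect K} {m n p mn : ℤ} (hmn : mn = m + n)
    (H : IFam g W W') (G : IFam g V W) (F : IFam g U V) :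
    comp mn p (comp m n H G) F = comp m (n + p) H (comp n p G F) := comp_assoc hmn rfl H G F

theorem up_comp_zero {U V W : GrVect K} (G : IFam g V W) (F : IFam g U V) :
    up 0 (comp 0 0 G F) = comp 0 0 (up 0 G) (up 0 F) := by
  rw [up_comp (by norm_num)]

theorem up_comp_neg_left {U V W : GrVect K} (G : IFam g V W) (F : IFam g U V) :
    up (-1) (comp (-1) 0 G F) = comp (-1) 0 (up (-1) G) (up 0 F) := by
  rw [up_comp (by norm_num)]

theorem up_comp_neg_right {U V W : GrVect K} (G : IFam g V W) (F : IFam g U V) :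
    up (-1) (comp 0 (-1) G F) = comp 0 (-1) (up 0 G) (up (-1) F) := by
  rw [up_comp (by norm_num)]

theorem up_swp_up_swp {n : ℤ} (F : IFam g U (g.tensor (g.tensor (g.tensor T)))) :
    comp 0 n (up 0 (swp g T)) (comp 0 n (up 0 (swp g T)) F) = F := by
  rw [← comp_assoc (mn := 0) (np := n) rfl (by ring), ← up_comp_zero, swp_comp_swp,
    one, up_strict, TensorProduct.map_id]
  exact one_comp F

theorem biv_tensor : biv P (g.tensor T) = comp 0 0 (up 0 (swp g T))
    (comp 0 0 (swp g (g.tensor T)) (up 0 (biv P T))) := by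
  rw [up_biv, comp_swp_swp, up_swp_up_swp]

/-- The insertion of two bivectors. -/
def bivTwo (P : ShiftedPoisson L) (X : GrVect K) :
    IFam g X (g.tensor (g.tensor (g.tensor (g.tensor X)))) :=
  comp 0 0 (up 0 (up 0 (biv P X))) (biv P X)

/-- Naturality of the bivector, applied to the bivector itself. -/
theorem biv_biv : comp 0 0 (biv P (g.tensor (g.tensor X))) (biv P X) = bivTwo P X :=
  (biv_natural P 0 (biv P X)).symm

theorem up_up_swap_bivTwo :
    comp 0 0 (up 0 (up 0 (swp g X))) (bivTwo P X) = bivTwo P X := by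
  rw [bivTwo, ← comp_assoc (mn := 0) (np := 0) rfl rfl, ← up_comp_zero, ← up_comp_zero, biv_swap]

theorem up_biv_biv : comp 0 0 (up 0 (biv P (g.tensor X))) (biv P X) =
    comp 0 0 (up 0 (up 0 (swp g X))) (comp 0 0 (up 0 (swp g (g.tensor X))) (bivTwo P X)) := by
  rw [biv_tensor, up_comp_zero, up_comp_zero, bivTwo]
  simp only [comp_assoc_simp, add_zero]

/-- The two inserted bivectors are equal, so exchanging them as blocks changes nothing. The block
exchange is a product of four transpositions, one of which has been moved to the other side. -/
theorem exchange_bivTwo :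
    comp 0 0 (up 0 (swp g (g.tensor X))) (bivTwo P X) =
      comp 0 0 (swp g (g.tensor (g.tensor X))) (comp 0 0 (up 0 (up 0 (swp g X)))
        (comp 0 0 (up 0 (swp g (g.tensor X))) (bivTwo P X))) := by
  have h := biv_biv (P := P) (X := X)
  rw [biv_tensor, comp_assoc (mn := 0) (np := 0) rfl rfl, comp_assoc (mn := 0) (np := 0) rfl rfl,
    up_biv_biv] at h
  nth_rewrite 1 [← h]
  rw [up_swp_up_swp]

/-- The derivative of `biv_natural`, solved for one term. In {{A,B},C} the differentiated bivector
stands before ϱ_C, and this moves it past. -/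
theorem varrho_biv_natural (F : IFam g U V) :
    comp (-1) 0 (varrho (biv P V)) (up 0 F) = comp 0 (-1) (up 0 (up 0 F)) (varrho (biv P U)) +
      comp (-1) 0 (up (-1) (up (-1) (varrho F))) (comp 0 0 (up 0 (swp g U))
        (comp 0 0 (swp g (g.tensor U)) (up 0 (biv P U)))) -
      comp 0 (-1) (biv P V) (varrho F) := by
  have h := congrArg varrho (biv_natural P 0 F)
  rw [varrho_comp (m' := -1) (n' := -1) (by norm_num) (by norm_num),
    varrho_comp (m' := -1) (n' := -1) (by norm_num) (by norm_num),
    varrho_up (n' := -1) (by norm_num), varrho_up (n' := -1) (by norm_num),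
    up_comp (m := -1) (n := 0) (by norm_num), zpow_zero, one_smul, one_smul] at h
  simp only [comp_assoc_simp, add_zero] at h
  rw [← sub_eq_iff_eq_add] at h
  rw [← h, add_comm]

variable (A B C : IFam g X X)

/-- The composition of the derivatives of `A`, `B` and `C`. -/
def derivThree : IFam g (g.tensor (g.tensor (g.tensor X))) X :=
  comp 0 0 (varrho A) (comp 0 0 (up 0 (varrho B)) (up 0 (up 0 (varrho C))))

/-- The composition of the second derivative of `A` and the derivatives of `B` and `C`. -/
def secondLeft : IFam g (g.tensor (g.tensor (g.tensor (g.tensor X)))) X :=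
  comp (-1) 0 (varrho (varrho A)) (comp 0 0 (up 0 (up 0 (varrho B)))
    (up 0 (up 0 (up 0 (varrho C)))))

/-- The composition of the second derivative of `B` and the derivatives of `A` and `C`. -/
def secondMiddle : IFam g (g.tensor (g.tensor (g.tensor (g.tensor X)))) X :=
  comp 0 (-1) (varrho A) (comp (-1) 0 (up (-1) (varrho (varrho B)))
    (up 0 (up 0 (up 0 (varrho C)))))

/-- The composition of the second derivative of `C` and the derivatives of `A` and `B`. -/
def secondRight : IFam g (g.tensor (g.tensor (g.tensor (g.tensor X)))) X :=
  comp 0 (-1) (varrho A) (comp 0 (-1) (up 0 (varrho B))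
    (up (-1) (up (-1) (varrho (varrho C)))))

/-- The outer derivative hits ϱ_A, ϱ_B or the bivector. Moving the differentiated bivector past ϱ_C
creates the difference in the last summand, which vanishes later by `exchange_bivTwo`. -/
theorem brk_brk_left : brk P (-1) 0 (brk P 0 0 A B) C =
    comp (-1) 0 (secondLeft A B C) (comp 0 0 (up 0 (up 0 (swp g X)))
      (comp 0 0 (up 0 (swp g (g.tensor X))) (bivTwo P X))) +
    comp (-1) 0 (secondMiddle A B C) (comp 0 0 (swp g (g.tensor (g.tensor X)))
      (comp 0 0 (up 0 (up 0 (swp g X))) (comp 0 0 (up 0 (swp g (g.tensor X))) (bivTwo P X)))) +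
    comp 0 (-1) (derivThree A B C) (comp (-1) 0 (varrho (biv P (g.tensor X))) (biv P X)) +
    (comp (-1) 0 (secondRight A B C) (comp 0 0 (up 0 (swp g (g.tensor X)))
      (comp 0 0 (swp g (g.tensor (g.tensor X))) (comp 0 0 (up 0 (up 0 (swp g X)))
        (comp 0 0 (up 0 (swp g (g.tensor X))) (bivTwo P X))))) -
    comp (-1) 0 (secondRight A B C) (bivTwo P X)) := by
  have h1 : comp 0 0 (up 0 (biv P X)) (comp 0 0 (up 0 (varrho C)) (biv P X)) =
      comp 0 0 (up 0 (up 0 (up 0 (varrho C)))) (comp 0 0 (up 0 (biv P (g.tensor X))) (biv P X)) := by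
    rw [← comp_assoc (mn := 0) (np := 0) rfl rfl, ← up_comp_zero, ← biv_natural, up_comp_zero,
      comp_assoc (mn := 0) (np := 0) rfl rfl]
  have h2 : ∀ F : IFam g X (g.tensor (g.tensor (g.tensor (g.tensor X)))),
      comp 0 0 (swp g (g.tensor X)) (comp 0 0 (up 0 (up 0 (up 0 (varrho C)))) F) =
      comp 0 0 (up 0 (up 0 (up 0 (varrho C)))) (comp 0 0 (swp g (g.tensor (g.tensor X))) F) := by
    intro F
    rw [← comp_assoc (mn := 0) (np := 0) rfl rfl, swp_natural,
      comp_assoc (mn := 0) (np := 0) rfl rfl]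
  have h3 : comp (-1) 0 (varrho (biv P X)) (comp 0 0 (up 0 (varrho C)) (biv P X)) =
      comp 0 (-1) (up 0 (up 0 (varrho C))) (comp (-1) 0 (varrho (biv P (g.tensor X))) (biv P X)) +
      comp (-1) 0 (up (-1) (up (-1) (varrho (varrho C)))) (comp 0 0 (up 0 (swp g (g.tensor X)))
        (comp 0 0 (swp g (g.tensor (g.tensor X)))
          (comp 0 0 (up 0 (biv P (g.tensor X))) (biv P X)))) -
      comp (-1) 0 (up (-1) (up (-1) (varrho (varrho C)))) (bivTwo P X) := by
    rw [← comp_assoc (mn := -1) (np := 0) rfl rfl, varrho_biv_natural, comp_sub_left,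
      comp_add_left, ← biv_natural]
    simp only [comp_assoc_simp, add_zero, zero_add, Int.reduceNeg, biv_biv]
  -- The plain derivation rule. The preceding identities then collect all bivectors on the right.
  have h4 : brk P (-1) 0 (brk P 0 0 A B) C =
      comp (-1) 0 (varrho (varrho A)) (comp 0 0 (up 0 (up 0 (varrho B)))
        (comp 0 0 (up 0 (biv P X)) (comp 0 0 (up 0 (varrho C)) (biv P X)))) +
      (comp 0 (-1) (varrho A) (comp (-1) 0 (up (-1) (varrho (varrho B)))
        (comp 0 0 (swp g (g.tensor X))
        (comp 0 0 (up 0 (biv P X)) (comp 0 0 (up 0 (varrho C)) (biv P X))))) +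
      comp 0 (-1) (varrho A) (comp 0 (-1) (up 0 (varrho B)) (comp (-1) 0 (varrho (biv P X))
        (comp 0 0 (up 0 (varrho C)) (biv P X))))) := by
    rw [brk, brk, varrho_comp (m' := -1) (n' := -1) (by norm_num) (by norm_num),
      varrho_comp (m' := -1) (n' := -1) (by norm_num) (by norm_num),
      varrho_up (n' := -1) (by norm_num), up_comp_zero]
    simp only [comp_add_left, comp_add_right, zpow_zero, one_smul, comp_assoc_simp, add_zero,
    zero_add, Int.reduceNeg]
  rw [h4, h3, h1, h2, up_biv_biv, secondLeft, secondMiddle, secondRight, derivThree]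
  simp only [comp_sub_right, comp_add_right, comp_assoc_simp, add_zero,
    zero_add, Int.reduceNeg]
  abel

theorem brk_brk_right : brk P 0 (-1) A (brk P 0 0 B C) =
    comp (-1) 0 (secondMiddle A B C) (bivTwo P X) +
    comp (-1) 0 (secondRight A B C) (comp 0 0 (up 0 (swp g (g.tensor X))) (bivTwo P X)) +
    comp 0 (-1) (derivThree A B C) (comp (-1) 0 (up (-1) (varrho (biv P X))) (biv P X)) := by
  rw [brk, brk, varrho_comp (m' := -1) (n' := -1) (by norm_num) (by norm_num),
    varrho_comp (m' := -1) (n' := -1) (by norm_num) (by norm_num),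
    varrho_up (n' := -1) (by norm_num), up_comp_zero, secondMiddle, secondRight, derivThree, bivTwo]
  simp only [up_comp_neg_left, up_comp_neg_right, up_comp_zero, up_add, comp_add_left, comp_add_right, zpow_zero, one_smul, comp_assoc_simp, add_zero,
    zero_add, Int.reduceNeg]
  abel

theorem Commuting.comp_eq_zero_left {U V W X : GrVect K} {n : ℤ} {F : IFam g U V}
    {F' : IFam g W X} {H : IFam g U W} {H' : IFam g V X} (h : Commuting 0 n F F' H H') :
    comp n 0 H' F = comp 0 n F' H := by
  rw [h.comp_eq, zero_mul, zpow_zero, one_smul]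

/-- In this lemma and its two companions, the second derivative changes sign when the two legs it
receives are exchanged. The position of the swap depends on which of A, B, C is differentiated
twice. -/
theorem secondLeft_swap (h : IsSkew A.1) :
    comp (-1) 0 (secondLeft A B C) (swp g (g.tensor (g.tensor X))) = -secondLeft A B C := by
  rw [secondLeft]
  simp only [comp_assoc_simp, add_zero]
  rw [← swp_natural, ← comp_assoc (mn := 0) (np := 0) (by norm_num) (by norm_num) (up 0 _),
    ← swp_natural, comp_assoc (mn := 0) (np := 0) (by norm_num) (by norm_num),
    ← comp_assoc (mn := -1) (np := 0) (by norm_num) (by norm_num), varrho_varrho_swp h (-1),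
    comp_neg_left]

theorem secondMiddle_swap (h : IsSkew B.1) :
    comp (-1) 0 (secondMiddle A B C) (up 0 (swp g (g.tensor X))) = -secondMiddle A B C := by
  rw [secondMiddle]
  simp only [comp_assoc_simp, add_zero, zero_add]
  rw [← up_comp_zero, ← swp_natural, up_comp_zero,
    ← comp_assoc (mn := -1) (np := 0) (by norm_num) (by norm_num) (up (-1) _),
    ← up_comp_neg_left, varrho_varrho_swp h (-1), up_neg, comp_neg_left, comp_neg_right]

theorem secondRight_swap (h : IsSkew C.1) :
    comp (-1) 0 (secondRight A B C) (up 0 (up 0 (swp g X))) = -secondRight A B C := by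
  rw [secondRight]
  simp only [comp_assoc_simp, add_zero, zero_add]
  rw [← up_comp_neg_left, ← up_comp_neg_left, varrho_varrho_swp h (-1), up_neg, up_neg,
    comp_neg_right, comp_neg_right]

variable {A B C}

theorem varrho_comp_up_varrho {F G : IFam g X X} (h : Commuting 1 1 F F G G) :
    comp 0 0 (varrho G) (up 0 (varrho F)) =
      comp 0 0 (varrho F) (comp 0 0 (up 0 (varrho G)) (swp g X)) := by
  rw [h.swap (m' := 0) (n' := 0) (by norm_num) (by norm_num), mul_zero, zpow_zero, one_smul]

/-- Since B and C commute, the terms of {{A,C},B} can be rewritten in the order A, B, C, at the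
price of permuted legs. The exchange lemmas below do the same for the second derivatives. -/
theorem derivThree_swap (h : Commuting 1 1 B B C C) :
    derivThree A C B = comp 0 0 (derivThree A B C) (up 0 (swp g X)) := by
  rw [derivThree, derivThree, ← up_comp_zero, varrho_comp_up_varrho h, up_comp_zero, up_comp_zero]
  simp only [comp_assoc_simp, add_zero]

theorem secondLeft_exchange (h : Commuting 1 1 B B C C) :
    secondLeft A C B = comp (-1) 0 (secondLeft A B C) (up 0 (up 0 (swp g X))) := by
  rw [secondLeft, secondLeft, ← up_comp_zero, ← up_comp_zero, varrho_comp_up_varrho h]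
  simp only [up_comp_zero, comp_assoc_simp, add_zero]

theorem varrho_comp_up_varrho_varrho {F G : IFam g X X} (h : Commuting 1 1 F F G G) :
    comp 0 (-1) (varrho G) (up (-1) (varrho (varrho F))) =
      comp (-1) 0 (varrho (varrho F)) (comp 0 0 (up 0 (up 0 (varrho G)))
        (comp 0 0 (up 0 (swp g X)) (swp g (g.tensor X)))) := by
  have h1 := (h.varrho (m' := 0) (by norm_num)).swap (m' := -1) (n' := 0) (by norm_num)
    (by norm_num)
  rw [mul_zero, zpow_zero, one_smul, varrho_up (n' := 0) (by norm_num), up_comp_zero] at h1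
  rw [h1]
  simp only [comp_assoc_simp, add_zero]

theorem secondMiddle_exchange (h : Commuting 1 1 B B C C) :
    comp 0 (-1) (varrho A) (comp 0 (-1) (up 0 (varrho C)) (up (-1) (up (-1) (varrho (varrho B))))) =
      comp (-1) 0 (secondMiddle A B C) (comp 0 0 (up 0 (up 0 (swp g X)))
        (up 0 (swp g (g.tensor X)))) := by
  rw [← up_comp_neg_right, varrho_comp_up_varrho_varrho h, secondMiddle]
  simp only [up_comp_neg_left, up_comp_zero, comp_assoc_simp, add_zero, zero_add]

theorem secondRight_exchange (h : Commuting 1 1 B B C C) :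
    secondMiddle A C B = comp (-1) 0 (secondRight A B C) (comp 0 0 (up 0 (swp g (g.tensor X)))
      (up 0 (up 0 (swp g X)))) := by
  have h1 : secondRight A B C = comp (-1) 0 (secondMiddle A C B)
      (comp 0 0 (up 0 (up 0 (swp g X))) (up 0 (swp g (g.tensor X)))) :=
    secondMiddle_exchange h.symm
  have h2 : comp 0 0 (up 0 (up 0 (swp g X))) (up 0 (up 0 (swp g X))) = one g _ := by
    rw [← up_comp_zero, ← up_comp_zero, swp_comp_swp, one, up_strict, up_strict,
      TensorProduct.map_id, TensorProduct.map_id]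
    rfl
  rw [h1]
  simp only [comp_assoc_simp, add_zero]
  rw [up_swp_up_swp, h2, comp_one]

theorem up_swap_up_swap_up_swap (F : IFam g U (g.tensor (g.tensor (g.tensor (g.tensor X))))) :
    comp 0 0 (up 0 (swp g (g.tensor X))) (comp 0 0 (up 0 (up 0 (swp g X)))
      (comp 0 0 (up 0 (swp g (g.tensor X))) F)) =
    comp 0 0 (up 0 (up 0 (swp g X))) (comp 0 0 (up 0 (swp g (g.tensor X)))
      (comp 0 0 (up 0 (up 0 (swp g X))) F)) := by
  have h : comp 0 0 (up 0 (swp g X)) (comp 0 0 (swp g (g.tensor X)) (up 0 (swp g X))) =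
      comp 0 0 (swp g (g.tensor X)) (comp 0 0 (up 0 (swp g X)) (swp g (g.tensor X))) := by
    rw [swp, swp, up_strict, strict_comp_strict, strict_comp_strict, strict_comp_strict,
      strict_comp_strict, swapMap_braid]
  have h1 := congrArg (fun G => comp 0 0 (up 0 G) F) h
  simp only [up_comp_zero, comp_assoc_simp, add_zero] at h1
  exact h1.symm

theorem strict_cycleSum : (strict (cycleSum g T) :
    IFam g (g.tensor (g.tensor (g.tensor T))) (g.tensor (g.tensor (g.tensor T)))) =
    one g _ + up 0 (swp g T) + comp 0 0 (swp g (g.tensor T)) (up 0 (swp g T)) := by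
  rw [swp, swp, up_strict, strict_comp_strict]
  refine IFam.ext fun l => ?_
  cases l with
  | nil => rfl
  | cons x l =>
    rw [IFam.add_apply, IFam.add_apply, one, strict_cons, strict_cons, strict_cons, strict_cons,
      add_zero, add_zero]

theorem up_varrho_biv_biv : comp (-1) 0 (up (-1) (varrho (biv P X))) (biv P X) =
    comp 0 (-1) (swp g (g.tensor X)) (comp 0 (-1) (up 0 (swp g X))
      (comp (-1) 0 (varrho (biv P (g.tensor X))) (biv P X))) := by
  rw [up_varrho_biv]
  simp only [comp_assoc_simp, add_zero, zero_add]
  rw [biv_swap]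

/-- Each of A, B, C is differentiated twice in exactly two of the three brackets, apart from the
differences that vanish by `exchange_bivTwo`. After rearranging legs, the two terms differ by one
transposition and cancel: `hl` for A, `hm` for B, `hr` for C. The three terms with a differentiated
bivector add up to `cycleSum`. -/
theorem brk_jacobi (hA : IsSkew A.1) (hB : IsSkew B.1) (hC : IsSkew C.1)
    (h : Commuting 1 1 B B C C) :
    brk P (-1) 0 (brk P 0 0 A B) C + brk P 0 (-1) A (brk P 0 0 B C) +
      brk P (-1) 0 (brk P 0 0 A C) B =
    comp 0 (-1) (derivThree A B C) (comp 0 (-1) (strict (cycleSum g X))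
      (comp (-1) 0 (varrho (biv P (g.tensor X))) (biv P X))) := by
  have hz : secondRight A C B = comp (-1) 0 (secondMiddle A B C)
      (comp 0 0 (up 0 (up 0 (swp g X))) (up 0 (swp g (g.tensor X)))) := secondMiddle_exchange h
  have hl : comp (-1) 0 (secondLeft A B C) (comp 0 0 (up 0 (swp g (g.tensor X))) (bivTwo P X)) =
      -comp (-1) 0 (secondLeft A B C) (comp 0 0 (up 0 (up 0 (swp g X)))
        (comp 0 0 (up 0 (swp g (g.tensor X))) (bivTwo P X))) := by
    rw [exchange_bivTwo, ← comp_assoc (mn := -1) (np := 0) rfl rfl, secondLeft_swap A B C hA,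
      comp_neg_left, ← exchange_bivTwo]
  have hm : comp (-1) 0 (secondMiddle A B C) (comp 0 0 (up 0 (swp g (g.tensor X))) (bivTwo P X)) =
      -comp (-1) 0 (secondMiddle A B C) (bivTwo P X) := by
    rw [← comp_assoc (mn := -1) (np := 0) rfl rfl, secondMiddle_swap A B C hB, comp_neg_left]
  have hr : comp (-1) 0 (secondRight A B C) (comp 0 0 (up 0 (swp g (g.tensor X)))
      (comp 0 0 (up 0 (up 0 (swp g X))) (comp 0 0 (up 0 (swp g (g.tensor X))) (bivTwo P X)))) =
      -comp (-1) 0 (secondRight A B C) (comp 0 0 (up 0 (swp g (g.tensor X))) (bivTwo P X)) := by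
    rw [up_swap_up_swap_up_swap, up_up_swap_bivTwo, ← comp_assoc (mn := -1) (np := 0) rfl rfl,
      secondRight_swap A B C hC, comp_neg_left]
  have hs : ∀ F : IFam g X (g.tensor (g.tensor (g.tensor (g.tensor X)))),
      comp 0 0 (up 0 (up 0 (swp g X))) (comp 0 0 (up 0 (up 0 (swp g X))) F) = F := by
    intro F
    rw [← comp_assoc (mn := 0) (np := 0) rfl rfl, ← up_comp_zero, ← up_comp_zero, swp_comp_swp,
      one, up_strict, up_strict, TensorProduct.map_id, TensorProduct.map_id]
    exact one_comp F
  rw [brk_brk_left A B C, brk_brk_right, brk_brk_left A C B, secondLeft_exchange h,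
    secondRight_exchange h, hz, derivThree_swap h, up_varrho_biv_biv, ← exchange_bivTwo,
    up_swp_up_swp, sub_self, add_zero]
  simp only [comp_assoc_simp, add_zero, zero_add]
  rw [sub_self, add_zero, hs, hl, hm, hr, strict_cycleSum]
  have e : ∀ G : IFam g X (g.tensor (g.tensor (g.tensor X))), comp 0 (-1) (one g _ +
      up 0 (swp g X) + comp 0 0 (swp g (g.tensor X)) (up 0 (swp g X))) G =
      G + comp 0 (-1) (up 0 (swp g X)) G +
        comp 0 (-1) (swp g (g.tensor X)) (comp 0 (-1) (up 0 (swp g X)) G) := by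
    intro G
    rw [comp_add_left, comp_add_left, one_comp, comp_assoc (mn := 0) (np := -1) rfl rfl]
  rw [e, comp_add_right, comp_add_right]
  abel

/-! ### The homotopy -/

/-- Each action commutes with the sum of the other two, so all three derivatives are closed by
`pdiff_varrho_action`. -/
theorem pdiff_derivThree {r : IFam g X X} (hr : r = A + B + C)
    (hAB : Commuting 1 1 A A B B) (hAC : Commuting 1 1 A A C C) (hBC : Commuting 1 1 B B C C)
    (eA : comp 1 1 A A = comp 0 2 (varrho A) (ellAt L X))
    (eB : comp 1 1 B B = comp 0 2 (varrho B) (ellAt L X))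
    (eC : comp 1 1 C C = comp 0 2 (varrho C) (ellAt L X))
    (hA : IsSkew A.1) (hB : IsSkew B.1) (hC : IsSkew C.1) :
    pdiff L (rhoUp L (rhoUp L (rhoUp L r))) r 0 (derivThree A B C) = 0 := by
  have dA := pdiff_varrho_action (Q := B + C) (S := A) (rX := r) (by rw [hr]; abel)
    (hAB.add hAC).symm eA hA
  have dB := pdiff_varrho_action (Q := A + C) (S := B) (rX := r) (by rw [hr]; abel)
    (hAB.symm.add hBC).symm eB hB
  have dC := pdiff_varrho_action (Q := A + B) (S := C) (rX := r) hr
    (hAC.symm.add hBC.symm).symm eC hC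
  rw [derivThree, pdiff_comp (rV := rhoUp L r) (m' := 1) (n' := 1) (by norm_num) (by norm_num)
    (by norm_num), pdiff_comp (rV := rhoUp L (rhoUp L r)) (m' := 1) (n' := 1) (by norm_num)
    (by norm_num) (by norm_num), pdiff_up (n' := 1) (by norm_num), pdiff_up (n' := 1) (by norm_num),
    pdiff_up (n' := 1) (by norm_num), dA, dB, dC, up_zero, up_zero, comp_zero_left, comp_zero_left,
    comp_zero_right]
  simp only [comp_zero_right, smul_zero, add_zero]

/-- By `pdiff_tri`, the right-hand side of `brk_jacobi` is a closed map applied to the differential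
of the trivector. -/
theorem brk_jacobi_eq_pdiff {r : IFam g X X} (hr : r = A + B + C)
    (hAB : Commuting 1 1 A A B B) (hAC : Commuting 1 1 A A C C) (hBC : Commuting 1 1 B B C C)
    (eA : comp 1 1 A A = comp 0 2 (varrho A) (ellAt L X))
    (eB : comp 1 1 B B = comp 0 2 (varrho B) (ellAt L X))
    (eC : comp 1 1 C C = comp 0 2 (varrho C) (ellAt L X))
    (hA : IsSkew A.1) (hB : IsSkew B.1) (hC : IsSkew C.1) :
    brk P (-1) 0 (brk P 0 0 A B) C + brk P 0 (-1) A (brk P 0 0 B C) +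
      brk P (-1) 0 (brk P 0 0 A C) B =
    pdiff L r r (-2) (comp 0 (-2) (derivThree A B C) (tri P X)) := by
  rw [brk_jacobi hA hB hC hBC, pdiff_comp (rV := rhoUp L (rhoUp L (rhoUp L r))) (m' := 1)
    (n' := -1) (by norm_num) (by norm_num) (by norm_num), pdiff_tri,
    pdiff_derivThree hr hAB hAC hBC eA eB eC hA hB hC, comp_zero_left, zero_add, zpow_zero,
    one_smul]

theorem derivThree_mem (hA : A ∈ Hom g X X 1) (hB : B ∈ Hom g X X 1) (hC : C ∈ Hom g X X 1) :
    derivThree A B C ∈ Hom g (g.tensor (g.tensor (g.tensor X))) X 0 :=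
  comp_mem (by norm_num) (varrho_mem (by norm_num) hA) (comp_mem (by norm_num)
    (up_mem (varrho_mem (by norm_num) hB)) (up_mem (up_mem (varrho_mem (by norm_num) hC))))

end Coherence

end HLie
end

noncomputable section
namespace HLie

/-! ### Compatibility of brackets with whiskering. -/

section Whiskering

variable {K : Type u} [Field K] {g U V W X Y Z T U' V' W' : GrVect K} {L : HomotopyLie g}
  {P : ShiftedPoisson L}

/-! ### The braiding and the associator -/

theorem swap_comp_swap (U V : GrVect K) : GrVect.swap V U ∘ₗ GrVect.swap U V = LinearMap.id :=
  GrVect.tensor_hom_ext fun p u hu q v hv => by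
    rw [LinearMap.comp_apply, GrVect.swap_tmul U V hu hv, map_smul, GrVect.swap_tmul V U hv hu,
      smul_smul, ← zpow_add₀ neg_one_ne_zero', mul_comm q p, Even.neg_one_zpow ⟨_, rfl⟩, one_smul]
    rfl

theorem braid_comp_braid : comp 0 0 (braid g V U) (braid g U V) = one g (U.tensor V) := by
  rw [braid, braid, strict_comp_strict, swap_comp_swap]
  rfl

theorem comp_braid_cancel {n : ℤ} {F F' : IFam g (V.tensor U) X}
    (h : comp n 0 F (braid g U V) = comp n 0 F' (braid g U V)) : F = F' := by
  have h1 := congrArg (fun G => comp n 0 G (braid g V U)) h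
  beta_reduce at h1
  rwa [comp_assoc (mn := n) (np := 0) (by ring) (by ring),
    comp_assoc (mn := n) (np := 0) (by ring) (by ring), braid_comp_braid, comp_one, comp_one] at h1

theorem wr_commuting_braid {n : ℤ} {F : IFam g U V} (hF : F ∈ Hom g U V n) :
    Commuting n 0 (wr W F) (wl n W F) (braid g U W) (braid g V W) := by
  refine commuting_strict n fun a => GrVect.tensor_hom_ext fun p u hu q w hw => ?_
  rw [LinearMap.comp_apply, LinearMap.comp_apply, wr_apply, TensorProduct.map_tmul,
    LinearMap.id_apply, GrVect.swap_tmul V W (hF.1 a p u hu) hw, GrVect.swap_tmul U W hu hw,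
    map_smul, wl_tmul _ _ _ hw, smul_smul, ← zpow_add₀ neg_one_ne_zero']
  congr 1
  apply neg_one_zpow_congr
  push_cast
  grind

theorem wl_commuting_braid {n : ℤ} {F : IFam g U V} (hF : F ∈ Hom g U V n) :
    Commuting n 0 (wl n W F) (wr W F) (braid g W U) (braid g W V) := by
  refine commuting_strict n fun a => GrVect.tensor_hom_ext fun q w hw p u hu => ?_
  rw [LinearMap.comp_apply, LinearMap.comp_apply, wl_tmul _ _ _ hw, map_smul,
    GrVect.swap_tmul W V hw (hF.1 a p u hu), GrVect.swap_tmul W U hw hu,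
    map_smul, wr_apply, TensorProduct.map_tmul, LinearMap.id_apply, smul_smul,
    ← zpow_add₀ neg_one_ne_zero']
  congr 1
  apply neg_one_zpow_congr
  push_cast
  grind

theorem varrho_wr (n : ℤ) (F : IFam g X Y) :
    comp n 0 (varrho (wr W F)) (assoc g g X W) = wr W (varrho F) := by
  refine IFam.ext fun l => ?_
  rw [assoc, comp_strict_apply, wr_apply]
  apply TensorProduct.ext
  refine GrVect.tensor_hom_ext_left fun d y x => ?_
  ext w
  change (varrho (wr W F)).1 l ((y : g.carrier) ⊗ₜ (x ⊗ₜ w)) =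
    (varrho F).1 l ((y : g.carrier) ⊗ₜ x) ⊗ₜ w
  rw [varrho_tmul, varrho_tmul, wr_apply, TensorProduct.map_tmul, LinearMap.id_apply,
    TensorProduct.smul_tmul']

theorem up_wr (n : ℤ) (F : IFam g X Y) : comp 0 n (assoc g g Y W) (wr W (up n F)) =
    comp n 0 (up n (wr W F)) (assoc g g X W) := by
  refine IFam.ext fun l => ?_
  rw [assoc, assoc, comp_strict_apply, strict_comp_apply, wr_apply]
  apply TensorProduct.ext
  refine GrVect.tensor_hom_ext_left fun d y x => ?_
  ext w
  change TensorProduct.assoc K g.carrier Y.carrier W.carrier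
    ((up n F).1 l ((y : g.carrier) ⊗ₜ x) ⊗ₜ w) =
    (up n (wr W F)).1 l ((y : g.carrier) ⊗ₜ (x ⊗ₜ w))
  rw [up_tmul _ _ _ y.2, up_tmul _ _ _ y.2, ← TensorProduct.smul_tmul', map_smul,
    TensorProduct.assoc_tmul, wr_apply, TensorProduct.map_tmul, LinearMap.id_apply]

theorem biv_wr : comp 0 0 (up 0 (assoc g g T W)) (comp 0 0 (assoc g g (g.tensor T) W)
    (wr W (biv P T))) = biv P (T.tensor W) := by
  refine IFam.ext fun l => ?_
  rw [assoc, up_strict, strict_comp_apply, assoc, strict_comp_apply, wr_apply]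
  ext t w
  change TensorProduct.map LinearMap.id (TensorProduct.assoc K g.carrier T.carrier
    W.carrier).toLinearMap (TensorProduct.assoc K g.carrier (g.carrier ⊗[K] T.carrier) W.carrier
      ((biv P T).1 l t ⊗ₜ w)) = (biv P (T.tensor W)).1 l (t ⊗ₜ w)
  rw [biv_apply, biv_apply, ← TensorProduct.smul_tmul', map_smul, map_smul]
  congr 1
  refine LinearMap.congr_fun (f := TensorProduct.map LinearMap.id
    (TensorProduct.assoc K g.carrier T.carrier W.carrier).toLinearMap ∘ₗ
    (TensorProduct.assoc K g.carrier (g.carrier ⊗[K] T.carrier) W.carrier).toLinearMap ∘ₗ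
    (TensorProduct.mk K _ W.carrier).flip w ∘ₗ graftTwo g T ∘ₗ
      (TensorProduct.mk K (g.tpow 2).carrier T.carrier).flip t)
    (g := graftTwo g (T.tensor W) ∘ₗ
      (TensorProduct.mk K (g.tpow 2).carrier (T.carrier ⊗[K] W.carrier)).flip (t ⊗ₜ w)) ?_
      ((P.p 0).1 l)
  refine tpow_two_ext fun p x hx q y hy => ?_
  change TensorProduct.map LinearMap.id (TensorProduct.assoc K g.carrier T.carrier
    W.carrier).toLinearMap (TensorProduct.assoc K g.carrier (g.carrier ⊗[K] T.carrier) W.carrier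
      (graftTwo g T (tcons x (tcons y (tnil g)) ⊗ₜ t) ⊗ₜ w)) =
    graftTwo g (T.tensor W) (tcons x (tcons y (tnil g)) ⊗ₜ (t ⊗ₜ w))
  rw [graftTwo_tmul, graftTwo_tmul]
  rfl

/-- The new factors of 𝔤 appear on the left, so a spectator on the right only changes parentheses.
Derivative, `up` and bivector are each compatible with the associator. -/
theorem wr_brk (m n : ℤ) (F : IFam g Y Z) (G : IFam g X Y) :
    wr W (brk P m n F G) = brk P m n (wr W F) (wr W G) := by
  rw [brk, brk, wr_comp, wr_comp, ← varrho_wr m F,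
    comp_assoc (mn := m) (np := n) (by ring) (by ring),
    ← comp_assoc (m := 0) (mn := n) (np := n) (by ring) (by ring), up_wr, ← varrho_wr n G,
    up_comp (m := n) (n := 0) (by ring),
    comp_assoc (mn := n) (np := 0) (by ring) (by ring),
    comp_assoc (mn := n) (np := 0) (by ring) (by ring), biv_wr]

/-- Conjugation with the braiding reduces this to `wr_brk`, where no Koszul signs arise. -/
theorem wl_brk {m n mn m' n' : ℤ} (hmn : mn = m + n) (hm : m' = m + 1) (hn : n' = n + 1)
    {F : IFam g Y Z} {G : IFam g X Y} (hF : F ∈ Hom g Y Z m') (hG : G ∈ Hom g X Y n') :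
    wl mn W (brk P m n F G) = brk P m n (wl m' W F) (wl n' W G) := by
  subst hm hn
  have h := (wr_commuting_braid (W := W) (brk_mem (P := P) hmn rfl rfl hF hG)).comp_eq
  rw [mul_zero, zpow_zero, one_smul, wr_brk,
    brk_natural hmn (wr_commuting_braid hF) (wr_commuting_braid hG)] at h
  exact (comp_braid_cancel h).symm

theorem Commuting.wr {A B C D : GrVect K} {m n : ℤ} {F : IFam g A B} {F' : IFam g C D}
    {H : IFam g A C} {H' : IFam g B D} (h : Commuting m n F F' H H') :
    Commuting m n (wr W F) (wr W F') (wr W H) (wr W H') := by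
  intro a b
  rw [wr_apply, wr_apply, wr_apply, wr_apply, ← TensorProduct.map_comp, ← TensorProduct.map_comp,
    h a b, TensorProduct.map_smul_left, LinearMap.id_comp]

end Whiskering

end HLie
end

noncomputable section
namespace HLie

/-! ### Inserting the bivector between two modules. -/

section Insertion

variable {K : Type u} [Field K] {g U V W U' V' : GrVect K} {L : HomotopyLie g}

/-- The map `y ⊗ (u ⊗ v) ↦ ± (u ⊗ y) ⊗ v`. -/
def intoFirst (g U V : GrVect K) :
    g.carrier ⊗[K] (U.carrier ⊗[K] V.carrier) →ₗ[K] (U.carrier ⊗[K] g.carrier) ⊗[K] V.carrier :=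
  TensorProduct.map (GrVect.swap g U) LinearMap.id ∘ₗ
    (TensorProduct.assoc K g.carrier U.carrier V.carrier).symm.toLinearMap

theorem intoFirst_tmul {d p : ℤ} {y : g.carrier} {u : U.carrier} (hy : y ∈ g.deg d)
    (hu : u ∈ U.deg p) (v : V.carrier) :
    intoFirst g U V (y ⊗ₜ (u ⊗ₜ v)) = (-1 : K) ^ (d * p) • ((u ⊗ₜ y) ⊗ₜ v) := by
  change GrVect.swap g U (y ⊗ₜ u) ⊗ₜ v = _
  rw [GrVect.swap_tmul g U hy hu, ← TensorProduct.smul_tmul']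

/-- The map `y ⊗ (z ⊗ (u ⊗ v)) ↦ ± (u ⊗ y) ⊗ (z ⊗ v)`. -/
def intoMiddle (g U V : GrVect K) :
    g.carrier ⊗[K] (g.carrier ⊗[K] (U.carrier ⊗[K] V.carrier)) →ₗ[K]
      (U.carrier ⊗[K] g.carrier) ⊗[K] (g.carrier ⊗[K] V.carrier) :=
  (TensorProduct.assoc K (U.carrier ⊗[K] g.carrier) g.carrier V.carrier).toLinearMap ∘ₗ
    TensorProduct.map ((TensorProduct.assoc K U.carrier g.carrier g.carrier).symm.toLinearMap ∘ₗ
      GrVect.swap (g.tensor g) U) LinearMap.id ∘ₗ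
    (TensorProduct.assoc K (g.carrier ⊗[K] g.carrier) U.carrier V.carrier).symm.toLinearMap ∘ₗ
    (TensorProduct.assoc K g.carrier g.carrier (U.carrier ⊗[K] V.carrier)).symm.toLinearMap

theorem intoMiddle_tmul {d e p : ℤ} {y z : g.carrier} {u : U.carrier} (hy : y ∈ g.deg d)
    (hz : z ∈ g.deg e) (hu : u ∈ U.deg p) (v : V.carrier) :
    intoMiddle g U V (y ⊗ₜ (z ⊗ₜ (u ⊗ₜ v))) =
      (-1 : K) ^ ((d + e) * p) • ((u ⊗ₜ y) ⊗ₜ (z ⊗ₜ v)) := by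
  change TensorProduct.assoc K (U.carrier ⊗[K] g.carrier) g.carrier V.carrier
    ((TensorProduct.assoc K U.carrier g.carrier g.carrier).symm
      (GrVect.swap (g.tensor g) U ((y ⊗ₜ z) ⊗ₜ u)) ⊗ₜ v) = _
  rw [GrVect.swap_tmul (g.tensor g) U (GrVect.tmul_mem g g rfl hy hz) hu, map_smul,
    ← TensorProduct.smul_tmul', map_smul]
  rfl

theorem varpi_apply (P : ShiftedPoisson L) (l : List (HEl g)) :
    (varpi P).1 l (1 : K) = (-1 : K) ^ (l.length + 1) •
      TensorProduct.map LinearMap.id (TensorProduct.rid K g.carrier).toLinearMap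
        ((P.p 0).1 l : g.carrier ⊗[K] (g.carrier ⊗[K] K)) := by
  change (-1 : K) ^ (l.length + 1) • ((1 : K) • TensorProduct.map LinearMap.id
    (TensorProduct.rid K g.carrier).toLinearMap
      ((P.p 0).1 l : g.carrier ⊗[K] (g.carrier ⊗[K] K))) = _
  rw [one_smul]

theorem map_rid_mem {d : ℤ} {z : (g.tpow 2).carrier} (hz : z ∈ (g.tpow 2).deg d) :
    (TensorProduct.map LinearMap.id (TensorProduct.rid K g.carrier).toLinearMap
      (z : g.carrier ⊗[K] (g.carrier ⊗[K] K)) : g.carrier ⊗[K] g.carrier) ∈ (g.tensor g).deg d := by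
  rw [← add_zero d]
  refine tensor_mem_of_tmul (U := g) (V := g.tpow 1) (X := g.tensor g) _ _ (fun p q x hx w hw => ?_) hz
  rw [add_zero]
  refine GrVect.tmul_mem g g rfl hx ?_
  rw [← add_zero q]
  refine tensor_mem_of_tmul (U := g) (V := GrVect.ground K) (X := g)
    (TensorProduct.rid K g.carrier).toLinearMap 0 (fun p q x hx c hc => ?_) hw
  change c • x ∈ _
  change c ∈ (if q = 0 then ⊤ else ⊥ : Submodule K K) at hc
  split_ifs at hc with h
  · subst h
    rw [add_zero, add_zero]
    exact Submodule.smul_mem _ _ hx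
  · rw [Submodule.mem_bot] at hc
    rw [hc, zero_smul]
    exact zero_mem _

/-- The definition of t inserts ϖ₂ between U and V, while `biv` inserts it in front. `intoMiddle`
moves both legs past U and so produces the Koszul sign of 1_U ⊙ ϖ₂. -/
theorem insertion_eq (P : ShiftedPoisson L) (U V : GrVect K) :
    insertion P U V = comp 0 0 (strict (intoMiddle g U V)) (biv P (U.tensor V)) := by
  refine IFam.ext fun l => ?_
  rw [insertion, odot_one, strict_comp_apply, strict_comp_apply, comp_strict_apply, wr_apply,
    one_odot_apply]
  refine GrVect.tensor_hom_ext_left fun p u v => ?_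
  have hz : (P.p 0).1 l ∈ (g.tpow 2).deg (degSum l - l.length) := by
    have := P.p_deg 0 l
    rwa [show degSum l + 4 - 2 * (((0 : ℕ) : ℤ) + 2) - l.length = degSum l - l.length by
      push_cast; ring] at this
  -- This compares the two models of 𝔤 ⊗ 𝔤: the second tensor power, which ends in a factor K, and
  -- the plain tensor product.
  have key : (TensorProduct.assoc K (g.carrier ⊗[K] g.carrier) U.carrier V.carrier).symm
      ((TensorProduct.assoc K g.carrier g.carrier (U.carrier ⊗[K] V.carrier)).symm
        (graftTwo g (U.tensor V) ((P.p 0).1 l ⊗ₜ ((u : U.carrier) ⊗ₜ v)))) =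
      (TensorProduct.map LinearMap.id (TensorProduct.rid K g.carrier).toLinearMap
        ((P.p 0).1 l : g.carrier ⊗[K] (g.carrier ⊗[K] K)) ⊗ₜ (u : U.carrier)) ⊗ₜ v := by
    let φ : (g.tpow 2).carrier →ₗ[K] ((g.carrier ⊗[K] g.carrier) ⊗[K] U.carrier) ⊗[K] V.carrier :=
      (TensorProduct.assoc K (g.carrier ⊗[K] g.carrier) U.carrier V.carrier).symm.toLinearMap ∘ₗ
        (TensorProduct.assoc K g.carrier g.carrier (U.carrier ⊗[K] V.carrier)).symm.toLinearMap ∘ₗ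
        graftTwo g (U.tensor V) ∘ₗ (TensorProduct.mk K (g.tpow 2).carrier
          (U.carrier ⊗[K] V.carrier)).flip ((u : U.carrier) ⊗ₜ v)
    let ψ : (g.tpow 2).carrier →ₗ[K] ((g.carrier ⊗[K] g.carrier) ⊗[K] U.carrier) ⊗[K] V.carrier :=
      (TensorProduct.mk K ((g.carrier ⊗[K] g.carrier) ⊗[K] U.carrier) V.carrier).flip v ∘ₗ
        (TensorProduct.mk K (g.carrier ⊗[K] g.carrier) U.carrier).flip (u : U.carrier) ∘ₗ
        (TensorProduct.map LinearMap.id (TensorProduct.rid K g.carrier).toLinearMap :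
          g.carrier ⊗[K] (g.carrier ⊗[K] K) →ₗ[K] g.carrier ⊗[K] g.carrier)
    suffices e : φ = ψ from LinearMap.congr_fun e ((P.p 0).1 l)
    refine tpow_two_ext
      (Y := ((g.carrier ⊗[K] g.carrier) ⊗[K] U.carrier) ⊗[K] V.carrier) fun d x hx e y hy => ?_
    change (TensorProduct.assoc K (g.carrier ⊗[K] g.carrier) U.carrier V.carrier).symm
      ((TensorProduct.assoc K g.carrier g.carrier (U.carrier ⊗[K] V.carrier)).symm
        (graftTwo g (U.tensor V) (tcons x (tcons y (tnil g)) ⊗ₜ ((u : U.carrier) ⊗ₜ v)))) =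
      ((x ⊗ₜ[K] ((1 : K) • y)) ⊗ₜ[K] (u : U.carrier)) ⊗ₜ[K] v
    rw [graftTwo_tmul, one_smul]
    rfl
  change TensorProduct.assoc K (U.carrier ⊗[K] g.carrier) g.carrier V.carrier
      ((TensorProduct.assoc K U.carrier g.carrier g.carrier).symm
        (U.sgn (0 - l.length + degSum l) (u : U.carrier) ⊗ₜ[K] (varpi P).1 l (1 : K)) ⊗ₜ[K] v) =
    intoMiddle g U V ((biv P (U.tensor V)).1 l ((u : U.carrier) ⊗ₜ v))
  rw [biv_apply, map_smul, varpi_apply, U.sgn_apply _ u.2]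
  change _ = (-1 : K) ^ (l.length + 1) •
    TensorProduct.assoc K (U.carrier ⊗[K] g.carrier) g.carrier V.carrier
      (TensorProduct.map ((TensorProduct.assoc K U.carrier g.carrier g.carrier).symm.toLinearMap ∘ₗ
        GrVect.swap (g.tensor g) U) (LinearMap.id : V.carrier →ₗ[K] V.carrier)
      ((TensorProduct.assoc K (g.carrier ⊗[K] g.carrier) U.carrier V.carrier).symm
      ((TensorProduct.assoc K g.carrier g.carrier (U.carrier ⊗[K] V.carrier)).symm
        (graftTwo g (U.tensor V) ((P.p 0).1 l ⊗ₜ ((u : U.carrier) ⊗ₜ v))))))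
  rw [key, TensorProduct.map_tmul, LinearMap.comp_apply,
    GrVect.swap_tmul (g.tensor g) U (map_rid_mem hz) u.2, TensorProduct.tmul_smul,
    ← TensorProduct.smul_tmul']
  simp only [map_smul, ← TensorProduct.smul_tmul', LinearMap.id_apply]
  congr 2
  apply neg_one_zpow_congr
  push_cast
  grind

theorem insertion_natural (P : ShiftedPoisson L) {f : IFam g U U'} (hf : f ∈ Hom g U U' 0) :
    comp 0 0 (wr (g.tensor V) (wr g f)) (insertion P U V) =
      comp 0 0 (insertion P U' V) (wr V f) := by
  have h : comp 0 0 (wr (g.tensor V) (wr g f)) (strict (intoMiddle g U V)) =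
      comp 0 0 (strict (intoMiddle g U' V)) (up 0 (up 0 (wr V f))) := by
    refine IFam.ext fun l => ?_
    rw [strict_comp_apply, comp_strict_apply]
    refine GrVect.tensor_hom_ext_left fun d y => ?_
    refine LinearMap.congr_fun (GrVect.tensor_hom_ext_left (U := g) (V := U.tensor V)
      (φ := ((wr (g.tensor V) (wr g f)).1 l ∘ₗ intoMiddle g U V) ∘ₗ TensorProduct.mk K _ _ ↑y)
      (ψ := (intoMiddle g U' V ∘ₗ (up 0 (up 0 (wr V f))).1 l) ∘ₗ TensorProduct.mk K _ _ ↑y)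
      fun e z => ?_)
    refine LinearMap.congr_fun (GrVect.tensor_hom_ext_left (U := U) (V := V)
      (φ := (((wr (g.tensor V) (wr g f)).1 l ∘ₗ intoMiddle g U V) ∘ₗ TensorProduct.mk K _ _ ↑y) ∘ₗ
        TensorProduct.mk K _ _ ↑z)
      (ψ := ((intoMiddle g U' V ∘ₗ (up 0 (up 0 (wr V f))).1 l) ∘ₗ TensorProduct.mk K _ _ ↑y) ∘ₗ
        TensorProduct.mk K _ _ ↑z)
      fun p u v => ?_)
    change (wr (g.tensor V) (wr g f)).1 l
        (intoMiddle g U V ((y : g.carrier) ⊗ₜ ((z : g.carrier) ⊗ₜ ((u : U.carrier) ⊗ₜ v)))) =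
      intoMiddle g U' V ((up 0 (up 0 (wr V f))).1 l
        ((y : g.carrier) ⊗ₜ ((z : g.carrier) ⊗ₜ ((u : U.carrier) ⊗ₜ v))))
    rw [intoMiddle_tmul y.2 z.2 u.2, map_smul, wr_apply, TensorProduct.map_tmul, wr_apply,
      TensorProduct.map_tmul, up_tmul _ _ _ y.2, up_tmul _ _ _ z.2, wr_apply,
      TensorProduct.map_tmul, TensorProduct.tmul_smul, map_smul, map_smul]
    simp only [LinearMap.id_apply]
    rw [intoMiddle_tmul y.2 z.2 (hf.1 l p u u.2), smul_smul, smul_smul,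
      ← zpow_add₀ neg_one_ne_zero', ← zpow_add₀ neg_one_ne_zero']
    congr 1
    apply neg_one_zpow_congr
    push_cast
    grind
  rw [insertion_eq, insertion_eq, ← comp_assoc (mn := 0) (np := 0) (by ring) (by ring), h,
    comp_assoc (mn := 0) (np := 0) (by ring) (by ring), biv_natural,
    ← comp_assoc (mn := 0) (np := 0) (by ring) (by ring)]

theorem wr_lam_intoFirst (m : ℤ) (f : IFam g U U') :
    comp m 0 (wr V (comp m 0 (varrho f) (braid g U g))) (strict (intoFirst g U V)) =
      varrho (wr V f) := by
  have h : (strict (intoFirst g U V) : IFam g (g.tensor (U.tensor V)) ((U.tensor g).tensor V)) =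
      comp 0 0 (wr V (braid g g U)) (assocInv g g U V) := by
    rw [braid, wr_strict, assocInv, strict_comp_strict]
    rfl
  have h' : comp 0 0 (assoc g g U V) (assocInv g g U V) = one g (g.tensor (U.tensor V)) := by
    rw [assoc, assocInv, strict_comp_strict, LinearEquiv.comp_symm]
    rfl
  rw [h, ← comp_assoc (mn := m) (np := 0) (by ring) (by ring), ← wr_comp,
    comp_assoc (mn := m) (np := 0) (by ring) (by ring), braid_comp_braid, comp_one, ← varrho_wr m,
    comp_assoc (mn := m) (np := 0) (by ring) (by ring), h', comp_one]

/-- The inner leg is consumed by h and the outer leg is kept for f. The outer leg may be moved past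
U before or after h acts. -/
theorem intoFirst_up (n : ℤ) (h : IFam g V V') :
    comp 0 n (strict (intoFirst g U V')) (up n (varrho (wl (n + 1) U h))) =
      comp n 0 (wl n (U.tensor g) (varrho h)) (strict (intoMiddle g U V)) := by
  refine IFam.ext fun l => ?_
  rw [strict_comp_apply, comp_strict_apply]
  refine GrVect.tensor_hom_ext_left fun d y => ?_
  refine LinearMap.congr_fun (GrVect.tensor_hom_ext_left (U := g) (V := U.tensor V)
    (φ := (intoFirst g U V' ∘ₗ (up n (varrho (wl (n + 1) U h))).1 l) ∘ₗ TensorProduct.mk K _ _ ↑y)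
    (ψ := ((wl n (U.tensor g) (varrho h)).1 l ∘ₗ intoMiddle g U V) ∘ₗ TensorProduct.mk K _ _ ↑y)
    fun e z => ?_)
  refine LinearMap.congr_fun (GrVect.tensor_hom_ext_left (U := U) (V := V)
    (φ := ((intoFirst g U V' ∘ₗ (up n (varrho (wl (n + 1) U h))).1 l) ∘ₗ
      TensorProduct.mk K _ _ ↑y) ∘ₗ TensorProduct.mk K _ _ ↑z)
    (ψ := (((wl n (U.tensor g) (varrho h)).1 l ∘ₗ intoMiddle g U V) ∘ₗ
      TensorProduct.mk K _ _ ↑y) ∘ₗ TensorProduct.mk K _ _ ↑z)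
    fun p u v => ?_)
  change intoFirst g U V' ((up n (varrho (wl (n + 1) U h))).1 l
      ((y : g.carrier) ⊗ₜ ((z : g.carrier) ⊗ₜ ((u : U.carrier) ⊗ₜ v)))) =
    (wl n (U.tensor g) (varrho h)).1 l
      (intoMiddle g U V ((y : g.carrier) ⊗ₜ ((z : g.carrier) ⊗ₜ ((u : U.carrier) ⊗ₜ v))))
  rw [intoMiddle_tmul y.2 z.2 u.2, up_tmul _ _ _ y.2, varrho_tmul, wl_tmul _ _ _ u.2, map_smul,
    map_smul, wl_tmul _ _ _ (GrVect.tmul_mem U g rfl u.2 y.2), varrho_tmul,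
    TensorProduct.tmul_smul, TensorProduct.tmul_smul, TensorProduct.tmul_smul, map_smul, map_smul,
    intoFirst_tmul y.2 u.2]
  simp only [smul_smul, mul_left_comm _ ((-1 : K) ^ (l.length + 1))]
  congr 1
  simp only [← zpow_natCast, ← zpow_add₀ (neg_one_ne_zero' (K := K))]
  apply neg_one_zpow_congr
  simp only [degSum_append, degSum_cons, degSum_nil, List.length_append, List.length_cons,
    List.length_nil]
  push_cast
  grind

/-- The bridge from the definition of t to brackets. The degree `n' = n + 1` is that of h, since ϱ
lowers degrees by one. -/
theorem odot_insertion {P : ShiftedPoisson L} (m n : ℤ) {mn n' : ℤ} (hmn : mn = m + n)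
    (hn : n' = n + 1) (f : IFam g U U') (h : IFam g V V') :
    comp mn 0 (odot m n (comp m 0 (varrho f) (braid g U g)) (varrho h)) (insertion P U V) =
      brk P m n (wr V' f) (wl n' U h) := by
  subst hmn hn
  rw [odot_eq_comp, insertion_eq, comp_assoc (mn := m + n) (np := n) rfl (by ring),
    ← comp_assoc (m := n) (mn := n) (np := 0) (by ring) (by ring), ← intoFirst_up,
    comp_assoc (m := 0) (mn := n) (np := n) (by ring) (by ring),
    ← comp_assoc (mn := m) (np := n) (by ring) (by ring), wr_lam_intoFirst]
  rfl

end Insertion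

end HLie
end

noncomputable section
namespace HLie

/-! ### Differentials of brackets on a module with two commuting actions. -/

section Naturality

variable {K : Type u} [Field K] {g W X Y Z Y' Z' : GrVect K} {L : HomotopyLie g}
  {P : ShiftedPoisson L}

theorem varrho_zero : varrho (0 : IFam g X Y) = 0 := by
  rw [← zero_smul K (0 : IFam g X Y), varrho_smul, zero_smul]

/-- An intertwiner `F` that commutes with the structure maps `S` and `S'` can be moved past the
bivector and `S`. -/
theorem Commuting.up_varrho_biv {m : ℤ} {F : IFam g X Y} {S : IFam g X X} {S' : IFam g Y Y}
    (h : Commuting m 1 F F S S') :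
    comp m 0 (HLie.up m F) (comp 0 0 (HLie.up 0 (HLie.varrho S)) (biv P X)) =
      comp 0 m (HLie.up 0 (HLie.varrho S')) (comp 0 m (biv P Y) F) := by
  have h1 := ((h.symm.varrho (m' := 0) (by norm_num)).up).comp_eq
  rw [zero_mul, zpow_zero, one_smul] at h1
  rw [← comp_assoc (mn := m) (np := 0) (by ring) (by ring), h1,
    comp_assoc (mn := m) (np := m) (by ring) (by ring), biv_natural]

/-- The differential of the bracket of an intertwiner with the action on the other factor. -/
theorem pdiff_brk_action_right {m m' : ℤ} (hm : m' = m - 1) {F : IFam g X Y}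
    {rX R S : IFam g X X} {rY R' S' : IFam g Y Y} (hX : rX = R + S) (hY : rY = R' + S')
    (hF : IsSkew F.1) (hFS : Commuting m 1 F F S S') (hRS : Commuting 1 1 R R S S)
    (hS : comp 1 1 S S = comp 0 2 (varrho S) (ellAt L X)) (hs : IsSkew S.1) :
    pdiff L rX rY m' (brk P m' 0 F S) = -brk P m 0 (pdiff L rX rY m F) S +
      comp 0 m (brk P 0 0 R' S') F - comp m 0 F (brk P 0 0 R S) := by
  -- Closedness of ϱ_S removes the second term of the Leibniz rule. In the first term, F is then
  -- moved to the right past ϱ_S and the bivector.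
  rw [pdiff_brk (rY := rX) (m' := m) (n' := 1) (by omega) (by omega) (by norm_num),
    pdiff_varrho_action hX hRS hS hs, up_zero, comp_zero_left, comp_zero_right, smul_zero, add_zero,
    pdiff_varrho_of_commuting hm hF hX hY hFS, comp_sub_left, comp_add_left, comp_neg_left,
    comp_assoc (mn := m) (np := m) (by ring) (by ring) (varrho R'),
    comp_assoc (mn := m) (np := 0) (by ring) (by ring) F, hFS.up_varrho_biv]
  simp only [brk]
  rw [comp_assoc (mn := 0) (np := m) (by ring) (by ring) (varrho R'),
    comp_assoc (mn := 0) (np := m) (by ring) (by ring) (up 0 (varrho S'))]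

/-- The differential of the bracket of the action on the other factor with an intertwiner. -/
theorem pdiff_brk_action_left {n n' : ℤ} (hn : n' = n - 1) {H : IFam g X Y}
    {rX R S : IFam g X X} {rY R' S' : IFam g Y Y} (hX : rX = R + S) (hY : rY = R' + S')
    (hH : IsSkew H.1) (hHR : Commuting n 1 H H R R') (hRS : Commuting 1 1 R' R' S' S')
    (hR : comp 1 1 R' R' = comp 0 2 (varrho R') (ellAt L Y)) (hr : IsSkew R'.1) :
    pdiff L rX rY n' (brk P 0 n' R' H) = -brk P 0 n R' (pdiff L rX rY n H) +
      comp 0 n (brk P 0 0 R' S') H - comp n 0 H (brk P 0 0 R S) := by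
  -- This takes H out of ϱ_{R'}(1 ⊙ H) and turns the last term of ∂ϱ_H into H{R, S}.
  have h1 := (hHR.symm.varrho (m' := 0) (by norm_num)).comp_eq
  rw [zero_mul, zpow_zero, one_smul] at h1
  have hX' : rX = S + R := by rw [hX, add_comm]
  have hY' : rY = S' + R' := by rw [hY, add_comm]
  rw [pdiff_brk (rY := rY) (m' := 1) (n' := n) (by omega) (by norm_num) (by omega),
    pdiff_varrho_action hY' hRS.symm hR hr, comp_zero_left, zero_add, zpow_zero, one_smul,
    pdiff_varrho_of_commuting hn hH hX' hY' hHR, up_sub, up_add, up_neg, comp_sub_left,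
    comp_add_left, comp_neg_left, comp_sub_right, comp_add_right, comp_neg_right,
    up_comp (by ring), up_comp (by ring),
    comp_assoc (mn := n) (np := n) (by ring) (by ring) (up 0 (varrho S')), biv_natural,
    comp_assoc (mn := n) (np := 0) (by ring) (by ring) (up n H),
    ← comp_assoc (m := 0) (n := n) (mn := n) (np := n) (by ring) (by ring) (varrho R') (up n H),
    ← h1, comp_assoc (mn := n) (np := 0) (by ring) (by ring) H]
  simp only [brk]
  rw [comp_assoc (mn := 0) (np := n) (by ring) (by ring) (varrho R'),
    comp_assoc (mn := 0) (np := n) (by ring) (by ring) (up 0 (varrho S'))]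

/-- The differential of the bracket of two commuting equivariant maps. -/
theorem pdiff_brk_of_closed {F : IFam g X Y} {F' : IFam g Z W} {H : IFam g X Z} {H' : IFam g Y W}
    {rX RX SX : IFam g X X} {rZ RZ SZ : IFam g Z Z} {rW RW SW : IFam g W W}
    (hX : rX = RX + SX) (hZ : rZ = RZ + SZ) (hW : rW = RW + SW)
    (hF : IsSkew F'.1) (hH : IsSkew H.1) (hFH : Commuting 0 0 F F' H H')
    (hFS : Commuting 0 1 F' F' SZ SW) (hHR : Commuting 0 1 H H RX RZ)
    (cF : pdiff L rZ rW 0 F' = 0) (cH : pdiff L rX rZ 0 H = 0) :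
    pdiff L rX rW (-2) (brk P (-1) (-1) F' H) =
      comp (-1) 0 (brk P 0 (-1) RW H') F - comp 0 (-1) F' (brk P 0 (-1) RZ H) -
      comp (-1) 0 (brk P (-1) 0 F' SZ) H + comp 0 (-1) H' (brk P (-1) 0 F SX) := by
  have hX' : rX = SX + RX := by rw [hX, add_comm]
  have hZ' : rZ = SZ + RZ := by rw [hZ, add_comm]
  have h1 := (hFH.varrho (m' := -1) (by norm_num)).comp_eq
  have h2 := (hFH.symm.varrho (m' := -1) (by norm_num)).comp_eq
  rw [mul_zero, zpow_zero, one_smul] at h1 h2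
  -- As F' and H are closed, ∂ϱ_{F'} and ∂ϱ_H have two terms each, whence four brackets. The factor
  -- (-1)^{-1} comes from moving ∂ past the odd map ϱ_{F'}.
  rw [pdiff_brk (rY := rZ) (m' := 0) (n' := 0) (by norm_num) (by norm_num) (by norm_num),
    pdiff_varrho_of_commuting (m := 0) (by norm_num) hF hZ hW hFS,
    pdiff_varrho_of_commuting (m := 0) (by norm_num) hH hX' hZ' hHR, cF, cH, varrho_zero,
    varrho_zero, neg_zero, zero_add, neg_zero, zero_add, up_sub,
    up_comp_zero, up_comp_zero, comp_sub_left, comp_sub_left, comp_sub_right, zpow_neg_one, inv_neg,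
    inv_one, IFam.neg_one_smul]
  simp only [brk]
  simp only [comp_assoc_simp, add_zero, zero_add, Int.reduceNeg]
  rw [← biv_natural P 0 H, ← biv_natural P 0 F,
    ← comp_assoc (m := 0) (n := -1) (mn := -1) (np := -1) (by ring) (by ring) (up 0 F'),
    ← up_comp_neg_right, h2, up_comp_neg_left,
    ← comp_assoc (m := 0) (n := -1) (mn := -1) (np := -1) (by ring) (by ring) H', h1,
    comp_assoc (mn := -1) (np := 0) (by ring) (by ring) (varrho F'),
    comp_assoc (mn := -1) (np := 0) (by ring) (by ring) (up (-1) (varrho H'))]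
  abel

end Naturality

end HLie
end

noncomputable section
namespace HLie

/-! ### Whiskering and the differential. -/

section Actions

variable {K : Type u} [Field K] {g U V W X Y U' V' : GrVect K} {L : HomotopyLie g}
  {P : ShiftedPoisson L}

theorem braid_mem : braid g U V ∈ Hom g (U.tensor V) (V.tensor U) 0 :=
  strict_mem fun d z hz => by
    rw [← add_zero d]
    refine tensor_mem_of_tmul (X := V.tensor U) _ _ (fun p q u hu v hv => ?_) hz
    rw [GrVect.swap_tmul U V hu hv, add_zero]
    exact Submodule.smul_mem _ _ (GrVect.tmul_mem V U (add_comm q p) hv hu)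

theorem braid_comp_cancel {n : ℤ} {F F' : IFam g X (U.tensor V)}
    (h : comp 0 n (braid g U V) F = comp 0 n (braid g U V) F') : F = F' := by
  have h1 := congrArg (fun G => comp 0 n (braid g V U) G) h
  beta_reduce at h1
  rwa [← comp_assoc (mn := 0) (np := n) (by ring) (by ring),
    ← comp_assoc (mn := 0) (np := n) (by ring) (by ring), braid_comp_braid, one_comp,
    one_comp] at h1

theorem wr_comp_ellAt (n : ℤ) (F : IFam g U U') :
    comp n 2 (varrho (wr V F)) (ellAt L (U.tensor V)) =
      wr V (comp n 2 (varrho F) (ellAt L U)) := by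
  have h : comp 0 2 (assoc g g U V) (wr V (ellAt L U)) = ellAt L (U.tensor V) := by
    refine IFam.ext fun l => ?_
    rw [assoc, strict_comp_apply, wr_apply]
    apply TensorProduct.ext'
    intro u v
    rfl
  rw [wr_comp, ← varrho_wr n, comp_assoc (mn := n) (np := 2) (by ring) (by ring), h]

theorem Commuting.comp_ellAt {m n : ℤ} (hm : m = n - 1) {F : IFam g U V} {F' : IFam g X Y}
    {H : IFam g U X} {H' : IFam g V Y} (h : Commuting n 0 F F' H H') :
    comp 0 (n + 1) H' (comp m 2 (HLie.varrho F) (ellAt L U)) =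
      comp (n + 1) 0 (comp m 2 (HLie.varrho F') (ellAt L X)) H := by
  have h1 := (h.varrho hm).comp_eq
  rw [mul_zero, zpow_zero, one_smul] at h1
  have h2 := ellAt_natural L 0 H
  rw [← comp_assoc (mn := m) (np := n + 1) (by ring) (by omega), h1,
    comp_assoc (mn := m) (np := 2) (by ring) (by ring),
    comp_assoc (mn := n + 1) (np := 2) (by omega) (by ring), h2]

/-- Conjugation with the braiding reduces this to `wr_comp_ellAt`. -/
theorem wl_comp_ellAt {m n n' : ℤ} (hm : m = n - 1) (hn : n' = n + 1) {F : IFam g V V'}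
    (hF : F ∈ Hom g V V' n) :
    comp m 2 (varrho (wl n U F)) (ellAt L (U.tensor V)) =
      wl n' U (comp m 2 (varrho F) (ellAt L V)) := by
  subst hn
  have h1 := (wl_commuting_braid (W := U) (comp_mem (mn := n + 1) (by omega) (varrho_mem hm hF)
    (ellAt_mem L))).comp_eq
  rw [mul_zero, zpow_zero, one_smul, ← wr_comp_ellAt,
    ← (wl_commuting_braid (W := U) hF).comp_ellAt hm] at h1
  exact (braid_comp_cancel h1).symm

variable {rU : IFam g U U} {rU' : IFam g U' U'} {rV : IFam g V V} {rV' : IFam g V' V'}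

/-- The action on V commutes up to sign with f ⊙ 1 and drops out of the differential. -/
theorem pdiff_wr {n : ℤ} {F : IFam g U U'} (hF : F ∈ Hom g U U' n) :
    pdiff L (rhoTensor rU rV) (rhoTensor rU' rV) n (wr V F) = wr V (pdiff L rU rU' n F) := by
  have h := (wr_wl_commuting (n := 1) hF rV).comp_eq
  rw [mul_one] at h
  rw [pdiff, pdiff, rhoTensor, rhoTensor, odot_one, odot_one, ← wl, ← wl, comp_add_left,
    comp_add_right, h, wr_comp_ellAt, wr_sub, wr_sub, wr_smul, wr_comp, wr_comp, wr_comp]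
  module

theorem pdiff_wl {n n' : ℤ} (hn : n' = n + 1) {F : IFam g V V'} (hF : F ∈ Hom g V V' n)
    (hr : rU ∈ Hom g U U 1) :
    pdiff L (rhoTensor rU rV) (rhoTensor rU rV') n (wl n U F) =
      wl n' U (pdiff L rV rV' n F) := by
  subst hn
  have h := (wr_wl_commuting (n := n) hr F).symm.comp_eq
  rw [mul_one] at h
  rw [pdiff, pdiff, rhoTensor, rhoTensor, odot_one, odot_one, ← wl, ← wl, comp_add_left,
    comp_add_right, h, wl_comp_ellAt rfl rfl hF, wl_sub, wl_sub, wl_smul, wl_comp (by ring),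
    wl_comp (by ring), wl_comp (by ring)]
  module

end Actions

/-! ### The transformation t in terms of brackets. -/

section Representations

variable {K : Type u} [Field K] {g : GrVect K} {L : HomotopyLie g} {P : ShiftedPoisson L}

/-- The action on the first factor of `U ⊗ V`. -/
def HRep.left (U V : HRep L) : IFam g (U.V.tensor V.V) (U.V.tensor V.V) := wr V.V U.rho

/-- The action on the second factor of `U ⊗ V`. -/
def HRep.right (U V : HRep L) : IFam g (U.V.tensor V.V) (U.V.tensor V.V) := wl 1 U.V V.rho

theorem HRep.tensor_rho (U V : HRep L) : (U.tensor V).rho = U.left V + U.right V := by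
  rw [HRep.left, HRep.right, ← odot_one (m := 1)]
  rfl

theorem HRep.left_mem (U V : HRep L) :
    U.left V ∈ Hom g (U.V.tensor V.V) (U.V.tensor V.V) 1 := wr_mem U.rho_mem

theorem HRep.right_mem (U V : HRep L) :
    U.right V ∈ Hom g (U.V.tensor V.V) (U.V.tensor V.V) 1 := wl_mem V.rho_mem

theorem HRep.left_right (U V : HRep L) :
    Commuting 1 1 (U.left V) (U.left V) (U.right V) (U.right V) :=
  wr_wl_commuting U.rho_mem V.rho

theorem HRep.left_left (U V : HRep L) : comp 1 1 (U.left V) (U.left V) =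
    comp 0 2 (varrho (U.left V)) (ellAt L (U.V.tensor V.V)) := by
  rw [HRep.left, wr_comp_ellAt, ← U.rho_rho, wr_comp]

theorem HRep.right_right (U V : HRep L) : comp 1 1 (U.right V) (U.right V) =
    comp 0 2 (varrho (U.right V)) (ellAt L (U.V.tensor V.V)) := by
  rw [HRep.right, wl_comp_ellAt (n' := 2) (by norm_num) (by norm_num) V.rho_mem, ← V.rho_rho,
    wl_comp (by norm_num)]

/-- The bracket is formed with `varrho` of the structure maps, which is -ϱ_U and -ϱ_V; the two signs
cancel. -/
theorem inducedTransf_obj (U V : HRep L) :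
    (inducedTransf P).obj U V = brk P 0 0 (U.left V) (U.right V) := by
  have h : ∀ W : HRep L, varrhoObj W = varrho (-W.rho) := fun W => by rw [varrho_neg, varrhoObj]
  change comp 0 0 (odot 0 0 (lamObj U) (varrhoObj V)) (insertion P U.V V.V) = _
  rw [lamObj, h, h, odot_insertion 0 0 (n' := 1) (by norm_num) (by norm_num), wr_neg, wl_neg,
    ← IFam.neg_one_smul, ← IFam.neg_one_smul, brk_smul_left, brk_smul_right, smul_smul]
  rw [neg_one_mul, neg_neg, one_smul]
  rfl

/-- Each summand contains just one of ϱ_V and λ_{U'}, whence the signs. In the first, h is pulled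
out to the left; in the second, f is pulled out to the right through the insertion. Both have degree
0, so this costs no sign. -/
theorem inducedTransf_hom (U U' V V' : HRep L) {f : IFam g U.V U'.V} (h : IFam g V.V V'.V)
    (hf : f ∈ Hom g U.V U'.V 0) :
    (inducedTransf P).hom U U' V V' f h =
      -comp 0 (-1) (wl 0 U'.V h) (brk P (-1) 0 (wr V.V f) (U.right V)) -
        comp (-1) 0 (brk P 0 (-1) (U'.left V') (wl 0 U'.V h)) (wr V.V f) := by
  have e : ∀ W : HRep L, varrhoObj W = varrho (-W.rho) := fun W => by rw [varrho_neg, varrhoObj]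
  have hl : lam f ∈ Hom g (U.V.tensor g) U'.V (-1) :=
    comp_mem (by norm_num) (varrho_mem (by norm_num) hf) (braid_mem)
  have h1 : comp (-1) 0 (odot (-1) 0 (lam f) (comp 0 0 h (varrhoObj V))) (insertion P U.V V.V) =
      comp 0 (-1) (wl 0 U'.V h) (brk P (-1) 0 (wr V.V f) (wl 1 U.V (-V.rho))) := by
    have h2 := (wr_wl_commuting (V := V.V) (V' := V'.V) (n := 0) hl h).comp_eq
    rw [mul_zero, zpow_zero, one_smul] at h2
    rw [odot_eq_comp, wl_comp (m := 0) (n := 0) (by norm_num),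
      ← comp_assoc (mn := -1) (np := 0) (by norm_num) (by norm_num), ← h2,
      comp_assoc (m := 0) (n := -1) (mn := -1) (np := -1) (by norm_num) (by norm_num),
      ← odot_eq_comp,
      comp_assoc (m := 0) (n := -1) (mn := -1) (np := -1) (by norm_num) (by norm_num), lam, e,
      odot_insertion (-1) 0 (n' := 1) (by norm_num) (by norm_num)]
  have h3 : comp (-1) 0 (odot 0 (-1) (comp 0 0 (lamObj U') (odot 0 0 f (one g g))) (varrho h))
      (insertion P U.V V.V) =
      comp (-1) 0 (brk P 0 (-1) (wr V'.V (-U'.rho)) (wl 0 U'.V h)) (wr V.V f) := by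
    have h2 := (wr_wl_commuting (V := g.tensor V.V) (V' := V'.V) (n := -1)
      (wr_mem (W := g) hf) (varrho h)).comp_eq
    rw [zero_mul, zpow_zero, one_smul] at h2
    rw [odot_eq_comp, odot_one, wr_comp, comp_assoc (mn := 0) (np := -1) (by norm_num) (by norm_num),
      ← h2, ← comp_assoc (mn := -1) (np := -1) (by norm_num) (by norm_num), ← odot_eq_comp,
      comp_assoc (mn := -1) (np := 0) (by norm_num) (by norm_num), insertion_natural P hf,
      ← comp_assoc (mn := -1) (np := 0) (by norm_num) (by norm_num), lamObj, e,
      odot_insertion 0 (-1) (n' := 0) (by norm_num) (by norm_num)]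
  change comp (-1) 0 (odot (-1) 0 (lam f) (comp 0 0 h (varrhoObj V)) +
    odot 0 (-1) (comp 0 0 (lamObj U') (odot 0 0 f (one g g))) (varrho h)) (insertion P U.V V.V) = _
  rw [comp_add_left, h1, h3, wr_neg, wl_neg, ← IFam.neg_one_smul, ← IFam.neg_one_smul,
    brk_smul_left, brk_smul_right, comp_smul_left, comp_smul_right, IFam.neg_one_smul,
    IFam.neg_one_smul, sub_eq_add_neg]
  rfl

end Representations

end HLie
end

noncomputable section
namespace HLie

/-! ### Equivariance and naturality of t. -/

section Pseudonaturality

variable {K : Type u} [Field K] {g : GrVect K} {L : HomotopyLie g} {P : ShiftedPoisson L}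
  {U U' V V' : HRep L}

theorem wr_zero {A B C : GrVect K} : wr C (0 : IFam g A B) = 0 := by
  rw [← zero_smul K (0 : IFam g A B), wr_smul, zero_smul]

theorem wl_zero {A B C : GrVect K} (n : ℤ) : wl n C (0 : IFam g A B) = 0 := by
  rw [← zero_smul K (0 : IFam g A B), wl_smul, zero_smul]

theorem brk_zero_left {A B C : GrVect K} (m n : ℤ) (G : IFam g A B) :
    brk P m n (0 : IFam g B C) G = 0 := by
  rw [brk, varrho_zero, comp_zero_left]

theorem brk_zero_right {A B C : GrVect K} (m n : ℤ) (F : IFam g B C) :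
    brk P m n F (0 : IFam g A B) = 0 := by
  rw [brk, varrho_zero, up_zero, comp_zero_left, comp_zero_right]

theorem odot_eq_comp_swap {A A' B B' : GrVect K} {m n : ℤ} (hmn : m * n = 0) {f : IFam g A A'}
    (hf : f ∈ Hom g A A' m) (h : IFam g B B') :
    odot m n f h = comp n m (wl n A' h) (wr B f) := by
  rw [odot_eq_comp, (wr_wl_commuting hf h).comp_eq, hmn, zpow_zero, one_smul]

/-- Both arguments are actions, whose derivatives are closed. -/
theorem pdiff_brk_left_right : pdiff L (U.tensor V).rho (U.tensor V).rho 0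
    (brk P 0 0 (U.left V) (U.right V)) = 0 := by
  rw [pdiff_brk (rY := (U.tensor V).rho) (m' := 1) (n' := 1) (by norm_num) (by norm_num)
    (by norm_num), pdiff_varrho_action (U.tensor_rho V) (U.left_right V) (U.right_right V)
      (U.right_mem V).2,
    pdiff_varrho_action ((U.tensor_rho V).trans (add_comm _ _)) (U.left_right V).symm
      (U.left_left V) (U.left_mem V).2, up_zero, comp_zero_left, comp_zero_left, comp_zero_right,
    smul_zero, add_zero]

theorem inducedTransf_obj_mem : (inducedTransf P).obj U V ∈
    Hom g (U.V.tensor V.V) (U.V.tensor V.V) 0 := by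
  rw [inducedTransf_obj]
  exact brk_mem (by norm_num) (by norm_num) (by norm_num) (U.left_mem V) (U.right_mem V)

theorem isEquivariant_inducedTransf_obj :
    IsEquivariant (U.tensor V) (U.tensor V) ((inducedTransf P).obj U V) := by
  refine ⟨inducedTransf_obj_mem, ?_⟩
  rw [diff_eq_pdiff, inducedTransf_obj]
  exact pdiff_brk_left_right

theorem wr_comp_brk_sub {m m' : ℤ} (hm : m' = m - 1) {f : IFam g U.V U'.V}
    (hf : f ∈ Hom g U.V U'.V m) :
    comp m 0 (wr V.V f) (brk P 0 0 (U.left V) (U.right V)) -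
      comp 0 m (brk P 0 0 (U'.left V) (U'.right V)) (wr V.V f) =
    -pdiff L (U.tensor V).rho (U'.tensor V).rho m' (brk P m' 0 (wr V.V f) (U.right V)) -
      brk P m 0 (wr V.V (diff U U' m f)) (U.right V) := by
  have e : pdiff L (U.tensor V).rho (U'.tensor V).rho m (wr V.V f) = wr V.V (diff U U' m f) :=
    pdiff_wr hf
  rw [pdiff_brk_action_right hm (U.tensor_rho V) (U'.tensor_rho V) (wr_mem hf).2
    (wr_wl_commuting hf V.rho) (U.left_right V) (U.right_right V) (U.right_mem V).2, e]
  abel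

theorem wl_comp_brk_sub {n n' n'' : ℤ} (hn : n' = n - 1) (hn' : n'' = n + 1) {h : IFam g V.V V'.V}
    (hh : h ∈ Hom g V.V V'.V n) :
    comp n 0 (wl n U.V h) (brk P 0 0 (U.left V) (U.right V)) -
      comp 0 n (brk P 0 0 (U.left V') (U.right V')) (wl n U.V h) =
    -pdiff L (U.tensor V).rho (U.tensor V').rho n' (brk P 0 n' (U.left V') (wl n U.V h)) -
      brk P 0 n (U.left V') (wl n'' U.V (diff V V' n h)) := by
  have e : pdiff L (U.tensor V).rho (U.tensor V').rho n (wl n U.V h) =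
      wl n'' U.V (diff V V' n h) := pdiff_wl hn' hh U.rho_mem
  rw [pdiff_brk_action_left hn (U.tensor_rho V) (U.tensor_rho V') (wl_mem hh).2
    (wr_wl_commuting U.rho_mem h).symm (U.left_right V') (U.left_left V') (U.left_mem V').2, e]
  abel

/-- f ⊙ h is a composite of two whiskerings, and their naturality defects telescope. -/
theorem comp_brk_sub {m n mn m' n' n'' : ℤ} (hmn : mn = m + n) (hm : m' = m - 1) (hn : n' = n - 1)
    (hn' : n'' = n + 1) {f : IFam g U.V U'.V} (hf : f ∈ Hom g U.V U'.V m) {h : IFam g V.V V'.V}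
    (hh : h ∈ Hom g V.V V'.V n) :
    comp mn 0 (comp n m (wl n U'.V h) (wr V.V f)) (brk P 0 0 (U.left V) (U.right V)) -
      comp 0 mn (brk P 0 0 (U'.left V') (U'.right V')) (comp n m (wl n U'.V h) (wr V.V f)) =
    -comp n m (wl n U'.V h)
        (pdiff L (U.tensor V).rho (U'.tensor V).rho m' (brk P m' 0 (wr V.V f) (U.right V))) -
      comp n m (wl n U'.V h) (brk P m 0 (wr V.V (diff U U' m f)) (U.right V)) -
      comp n m (pdiff L (U'.tensor V).rho (U'.tensor V').rho n'
        (brk P 0 n' (U'.left V') (wl n U'.V h))) (wr V.V f) -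
      comp n m (brk P 0 n (U'.left V') (wl n'' U'.V (diff V V' n h))) (wr V.V f) := by
  have h1 := congrArg (comp n m (wl n U'.V h)) (wr_comp_brk_sub (P := P) (V := V) hm hf)
  have h2 := congrArg (fun F => comp n m F (wr V.V f))
    (wl_comp_brk_sub (P := P) (U := U') hn hn' hh)
  beta_reduce at h2
  rw [comp_sub_right, comp_sub_right, comp_neg_right,
    ← comp_assoc (mn := mn) (np := m) (by omega) (by ring),
    ← comp_assoc (m := n) (n := 0) (mn := n) (np := m) (by omega) (by ring)] at h1
  rw [comp_sub_left, comp_sub_left, comp_neg_left,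
    comp_assoc (m := 0) (n := n) (mn := n) (np := mn) (by omega) (by omega)] at h2
  have h3 := congrArg₂ (· + ·) h1 h2
  beta_reduce at h3
  rw [sub_add_sub_cancel] at h3
  rw [h3]
  abel

theorem inducedTransf_hom_mem {f : IFam g U.V U'.V} {h : IFam g V.V V'.V}
    (hf : f ∈ Hom g U.V U'.V 0) (hh : h ∈ Hom g V.V V'.V 0) :
    (inducedTransf P).hom U U' V V' f h ∈ Hom g (U.tensor V).V (U'.tensor V').V (-1) := by
  rw [inducedTransf_hom U U' V V' h hf]
  exact Submodule.sub_mem _ (Submodule.neg_mem _ (comp_mem (by norm_num) (wl_mem hh)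
    (brk_mem (by norm_num) (by norm_num) (by norm_num) (wr_mem hf) (U.right_mem V))))
    (comp_mem (by norm_num) (brk_mem (by norm_num) (by norm_num) (by norm_num) (U'.left_mem V')
      (wl_mem hh)) (wr_mem hf))

theorem HEq₂.of_eq {f h : IFam g U.V V.V} (e : f = h) : HEq₂ U V f h :=
  ⟨0, zero_mem _, by
    rw [e, sub_self, diff_eq_pdiff, ← zero_smul K (0 : IFam g U.V V.V), pdiff_smul, zero_smul,
      zero_smul]⟩

/-- For closed f and h, the right-hand side of `comp_brk_sub` is visibly a differential, and t_{f,h}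
is its primitive. -/
theorem inducedTransf_natural {f : IFam g U.V U'.V} {h : IFam g V.V V'.V}
    (hf : IsEquivariant U U' f) (hh : IsEquivariant V V' h) :
    comp 0 0 (odot 0 0 f h) ((inducedTransf P).obj U V) -
        comp 0 0 ((inducedTransf P).obj U' V') (odot 0 0 f h) =
      diff (U.tensor V) (U'.tensor V') (-1) ((inducedTransf P).hom U U' V V' f h) := by
  have e1 : pdiff L (U.tensor V).rho (U'.tensor V).rho 0 (wr V.V f) = 0 :=
    (pdiff_wr hf.1).trans (by rw [← diff_eq_pdiff, hf.2, wr_zero])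
  have e2 : pdiff L (U'.tensor V).rho (U'.tensor V').rho 0 (wl 0 U'.V h) = 0 :=
    (pdiff_wl (n' := 1) (by norm_num) hh.1 U'.rho_mem).trans
      (by rw [← diff_eq_pdiff, hh.2, wl_zero])
  rw [inducedTransf_obj, inducedTransf_obj, odot_eq_comp_swap (by norm_num) hf.1,
    comp_brk_sub (m' := -1) (n' := -1) (n'' := 1) (by norm_num) (by norm_num) (by norm_num)
      (by norm_num) hf.1 hh.1, hf.2, hh.2, wr_zero, wl_zero, brk_zero_left, brk_zero_right,
    inducedTransf_hom U U' V V' h hf.1, diff_eq_pdiff, pdiff_sub, pdiff_neg,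
    pdiff_comp (rV := (U'.tensor V).rho) (m' := 1) (n' := 0) (by norm_num) (by norm_num)
      (by norm_num), e2,
    pdiff_comp (rV := (U'.tensor V).rho) (m' := 0) (n' := 1) (by norm_num) (by norm_num)
      (by norm_num), e1, comp_zero_left, comp_zero_right, comp_zero_right, comp_zero_left,
    zpow_zero, one_smul, smul_zero]
  abel

theorem inducedTransf_natural_left {f : IFam g U.V U'.V} {h : IFam g V.V V'.V}
    (hf : f ∈ Hom g U.V U'.V (-1)) (hh : IsEquivariant V V' h) :
    HEq₂ (U.tensor V) (U'.tensor V')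
      (comp (-1) 0 (odot (-1) 0 f h) ((inducedTransf P).obj U V) -
        comp 0 (-1) ((inducedTransf P).obj U' V') (odot (-1) 0 f h))
      ((inducedTransf P).hom U U' V V' (diff U U' (-1) f) h) := by
  have hd : diff U U' (-1) f ∈ Hom g U.V U'.V 0 := pdiff_mem (by norm_num) hf U.rho_mem U'.rho_mem
  have e1 : pdiff L (U.tensor V).rho (U'.tensor V).rho (-1) (wr V.V f) =
      wr V.V (diff U U' (-1) f) := pdiff_wr hf
  have e2 : pdiff L (U'.tensor V).rho (U'.tensor V').rho 0 (wl 0 U'.V h) = 0 :=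
    (pdiff_wl (n' := 1) (by norm_num) hh.1 U'.rho_mem).trans
      (by rw [← diff_eq_pdiff, hh.2, wl_zero])
  -- The formula for t_{f,h}, read with f of degree -1; it then has degree -2.
  refine ⟨-comp 0 (-2) (wl 0 U'.V h) (brk P (-2) 0 (wr V.V f) (U.right V)) -
    comp (-1) (-1) (brk P 0 (-1) (U'.left V') (wl 0 U'.V h)) (wr V.V f), ?_, ?_⟩
  · exact Submodule.sub_mem _ (Submodule.neg_mem _ (comp_mem (by norm_num) (wl_mem hh.1)
      (brk_mem (by norm_num) (by norm_num) (by norm_num) (wr_mem hf) (U.right_mem V))))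
      (comp_mem (by norm_num) (brk_mem (by norm_num) (by norm_num) (by norm_num) (U'.left_mem V')
        (wl_mem hh.1)) (wr_mem hf))
  rw [inducedTransf_obj, inducedTransf_obj, odot_eq_comp_swap (by norm_num) hf,
    comp_brk_sub (m' := -2) (n' := -1) (n'' := 1) (by norm_num) (by norm_num) (by norm_num)
      (by norm_num) hf hh.1, hh.2, wl_zero, brk_zero_right,
    inducedTransf_hom U U' V V' h hd, diff_eq_pdiff (U.tensor V), pdiff_sub, pdiff_neg,
    pdiff_comp (rV := (U'.tensor V).rho) (m' := 1) (n' := -1) (by norm_num) (by norm_num)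
      (by norm_num), e2,
    pdiff_comp (rV := (U'.tensor V).rho) (m' := 0) (n' := 0) (by norm_num) (by norm_num)
      (by norm_num), e1, comp_zero_left, comp_zero_left, zpow_zero, one_smul, zpow_neg_one,
    inv_neg, inv_one, IFam.neg_one_smul]
  abel

theorem inducedTransf_natural_right {f : IFam g U.V U'.V} {h : IFam g V.V V'.V}
    (hf : IsEquivariant U U' f) (hh : h ∈ Hom g V.V V'.V (-1)) :
    HEq₂ (U.tensor V) (U'.tensor V')
      (comp (-1) 0 (odot 0 (-1) f h) ((inducedTransf P).obj U V) -
        comp 0 (-1) ((inducedTransf P).obj U' V') (odot 0 (-1) f h))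
      ((inducedTransf P).hom U U' V V' f (diff V V' (-1) h)) := by
  have e1 : pdiff L (U.tensor V).rho (U'.tensor V).rho 0 (wr V.V f) = 0 :=
    (pdiff_wr hf.1).trans (by rw [← diff_eq_pdiff, hf.2, wr_zero])
  have e2 : pdiff L (U'.tensor V).rho (U'.tensor V').rho (-1) (wl (-1) U'.V h) =
      wl 0 U'.V (diff V V' (-1) h) := pdiff_wl (by norm_num) hh U'.rho_mem
  -- Again the formula for t_{f,h}, now with h odd. Moving ∂ past 1 ⊙ h costs a sign, so the first
  -- term enters with a plus.
  refine ⟨comp (-1) (-1) (wl (-1) U'.V h) (brk P (-1) 0 (wr V.V f) (U.right V)) -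
    comp (-2) 0 (brk P 0 (-2) (U'.left V') (wl (-1) U'.V h)) (wr V.V f), ?_, ?_⟩
  · exact Submodule.sub_mem _ (comp_mem (by norm_num) (wl_mem hh)
      (brk_mem (by norm_num) (by norm_num) (by norm_num) (wr_mem hf.1) (U.right_mem V)))
      (comp_mem (by norm_num) (brk_mem (by norm_num) (by norm_num) (by norm_num) (U'.left_mem V')
        (wl_mem hh)) (wr_mem hf.1))
  rw [inducedTransf_obj, inducedTransf_obj, odot_eq_comp_swap (by norm_num) hf.1,
    comp_brk_sub (m' := -1) (n' := -2) (n'' := 0) (by norm_num) (by norm_num) (by norm_num)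
      (by norm_num) hf.1 hh, hf.2, wr_zero, brk_zero_left,
    inducedTransf_hom U U' V V' _ hf.1, diff_eq_pdiff (U.tensor V), pdiff_sub,
    pdiff_comp (rV := (U'.tensor V).rho) (m' := 0) (n' := 0) (by norm_num) (by norm_num)
      (by norm_num), e2,
    pdiff_comp (rV := (U'.tensor V).rho) (m' := -1) (n' := 1) (by norm_num) (by norm_num)
      (by norm_num), e1, comp_zero_right, comp_zero_right, smul_zero, zpow_neg_one,
    inv_neg, inv_one, IFam.neg_one_smul]
  abel

end Pseudonaturality

end HLie
end

noncomputable section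
namespace HLie

/-! ### Compatibility of t with composition. -/

section Composition

variable {K : Type u} [Field K] {g A B C : GrVect K} {L : HomotopyLie g} {P : ShiftedPoisson L}

/-- A derivation in the first argument, because `varrho` is one. F has to commute with the action in
the second argument in order to leave the bracket on the right. -/
theorem brk_comp_left {F : IFam g A B} {F' : IFam g B C} {S : IFam g A A} {S' : IFam g B B}
    (h : Commuting 0 1 F F S S') :
    brk P (-1) 0 (comp 0 0 F' F) S =
      comp (-1) 0 (brk P (-1) 0 F' S') F + comp 0 (-1) F' (brk P (-1) 0 F S) := by
  rw [brk, varrho_comp (m' := -1) (n' := -1) (by norm_num) (by norm_num), zpow_zero, one_smul,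
    comp_add_left, comp_assoc (m := -1) (n := 0) (mn := -1) (np := 0) (by norm_num) (by norm_num),
    h.up_varrho_biv, brk, brk]
  simp only [comp_assoc_simp, add_zero, zero_add, Int.reduceNeg]

/-- The mirror image: here H' leaves the bracket on the left and must commute with the action in the
first argument. -/
theorem brk_comp_right {H : IFam g A B} {H' : IFam g B C} {R : IFam g B B} {R' : IFam g C C}
    (h : Commuting 0 1 H' H' R R') :
    brk P 0 (-1) R' (comp 0 0 H' H) =
      comp (-1) 0 (brk P 0 (-1) R' H') H + comp 0 (-1) H' (brk P 0 (-1) R H) := by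
  have h1 := (h.symm.varrho (m' := 0) (by norm_num)).comp_eq
  rw [mul_zero, zpow_zero, one_smul] at h1
  rw [brk, varrho_comp (m' := -1) (n' := -1) (by norm_num) (by norm_num), zpow_zero, one_smul,
    up_add, up_comp_neg_left, up_comp_neg_right, comp_add_left, comp_add_right,
    comp_assoc (mn := -1) (np := 0) (by norm_num) (by norm_num), biv_natural P 0 H,
    comp_assoc (mn := -1) (np := -1) (by norm_num) (by norm_num),
    ← comp_assoc (m := 0) (n := 0) (mn := 0) (np := -1) (by norm_num) (by norm_num) (varrho R'),
    ← h1, brk, brk]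
  simp only [comp_assoc_simp, add_zero, zero_add, Int.reduceNeg]

variable {U U' U'' V V' V'' : HRep L}

theorem wr_commuting_right {n : ℤ} {f : IFam g U.V U'.V} (hf : f ∈ Hom g U.V U'.V n) :
    Commuting n 1 (wr V.V f) (wr V.V f) (U.right V) (U'.right V) := wr_wl_commuting hf V.rho

theorem wl_commuting_left {n : ℤ} (h : IFam g V.V V'.V) :
    Commuting n 1 (wl n U.V h) (wl n U.V h) (U.left V) (U.left V') :=
  (wr_wl_commuting U.rho_mem h).symm

theorem inducedTransf_hom_comp {f : IFam g U.V U'.V} {f' : IFam g U'.V U''.V} {h : IFam g V.V V'.V}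
    {h' : IFam g V'.V V''.V} (hf : IsEquivariant U U' f) (hf' : IsEquivariant U' U'' f')
    (hh : IsEquivariant V V' h) (hh' : IsEquivariant V' V'' h') :
    HEq₂ (U.tensor V) (U''.tensor V'')
      ((inducedTransf P).hom U U'' V V'' (comp 0 0 f' f) (comp 0 0 h' h))
      (comp (-1) 0 ((inducedTransf P).hom U' U'' V' V'' f' h') (odot 0 0 f h) +
        comp 0 (-1) (odot 0 0 f' h') ((inducedTransf P).hom U U' V V' f h)) := by
  have e1 : pdiff L (U.tensor V).rho (U'.tensor V).rho 0 (wr V.V f) = 0 :=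
    (pdiff_wr hf.1).trans (by rw [← diff_eq_pdiff, hf.2, wr_zero])
  have e2 : pdiff L (U''.tensor V').rho (U''.tensor V'').rho 0 (wl 0 U''.V h') = 0 :=
    (pdiff_wl (n' := 1) (by norm_num) hh'.1 U''.rho_mem).trans
      (by rw [← diff_eq_pdiff, hh'.2, wl_zero])
  have e3 : pdiff L (U'.tensor V').rho (U''.tensor V').rho 0 (wr V'.V f') = 0 :=
    (pdiff_wr hf'.1).trans (by rw [← diff_eq_pdiff, hf'.2, wr_zero])
  have e4 : pdiff L (U'.tensor V).rho (U'.tensor V').rho 0 (wl 0 U'.V h) = 0 :=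
    (pdiff_wl (n' := 1) (by norm_num) hh.1 U'.rho_mem).trans
      (by rw [← diff_eq_pdiff, hh.2, wl_zero])
  have key := pdiff_brk_of_closed (P := P) (U'.tensor_rho V) (U'.tensor_rho V') (U''.tensor_rho V')
    (wr_mem hf'.1).2 (wl_mem hh.1).2 (wr_wl_commuting hf'.1 h) (wr_commuting_right hf'.1)
    (wl_commuting_left h) e3 e4
  have c : ∀ {X : GrVect K} (n : ℤ) (F : IFam g X (U'.V.tensor V.V)),
      comp 0 n (wr V'.V f') (comp 0 n (wl 0 U'.V h) F) =
        comp 0 n (wl 0 U''.V h) (comp 0 n (wr V.V f') F) := fun n F => by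
    rw [← comp_assoc (mn := 0) (np := n) (by norm_num) (by ring),
      ← comp_assoc (mn := 0) (np := n) (by norm_num) (by ring),
      (wr_wl_commuting hf'.1 h).comp_eq_zero_left]
  -- After both derivation rules have been applied to t_{f'f,h'h}, the two sides differ by the four
  -- terms of `key`, placed between 1 ⊙ h' and f ⊙ 1.
  refine ⟨-comp 0 (-2) (wl 0 U''.V h') (comp (-2) 0
    (brk P (-1) (-1) (wr V'.V f') (wl 0 U'.V h)) (wr V.V f)), ?_, ?_⟩
  · exact Submodule.neg_mem _ (comp_mem (by norm_num) (wl_mem hh'.1) (comp_mem (by norm_num)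
      (brk_mem (by norm_num) (by norm_num) (by norm_num) (wr_mem hf'.1) (wl_mem hh.1))
      (wr_mem hf.1)))
  rw [diff_eq_pdiff, pdiff_neg, pdiff_comp (rV := (U''.tensor V').rho) (m' := 1) (n' := -1)
      (by norm_num) (by norm_num) (by norm_num), e2, comp_zero_left, zero_add, zpow_zero, one_smul,
    pdiff_comp (rV := (U'.tensor V).rho) (m' := -1) (n' := 1) (by norm_num) (by norm_num)
      (by norm_num), e1, comp_zero_right, smul_zero, add_zero, key,
    inducedTransf_hom _ _ _ _ _ (comp_mem (by norm_num) hf'.1 hf.1),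
    inducedTransf_hom _ _ _ _ _ hf'.1, inducedTransf_hom _ _ _ _ _ hf.1,
    odot_eq_comp_swap (by norm_num) hf.1, odot_eq_comp_swap (by norm_num) hf'.1,
    wl_comp (by norm_num), wr_comp, brk_comp_left (wr_commuting_right hf.1),
    brk_comp_right (wl_commuting_left h')]
  simp only [comp_assoc_simp, add_zero, zero_add, Int.reduceNeg, comp_add_left, comp_add_right,
    comp_sub_left, comp_sub_right, comp_neg_left, comp_neg_right, c]
  abel

theorem isPseudonatural_inducedTransf (P : ShiftedPoisson L) :
    IsPseudonatural (inducedTransf P) where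
  obj_mem _ _ := isEquivariant_inducedTransf_obj
  hom_mem _ _ _ _ _ _ hf hh := inducedTransf_hom_mem hf.1 hh.1
  hom_add_left U U' V V' f f' h hf hf' hh := HEq₂.of_eq <| by
    rw [inducedTransf_hom _ _ _ _ _ (Submodule.add_mem _ hf.1 hf'.1),
      inducedTransf_hom _ _ _ _ _ hf.1, inducedTransf_hom _ _ _ _ _ hf'.1, wr_add, brk_add_left,
      comp_add_right, comp_add_right]
    abel
  hom_add_right U U' V V' f h h' hf hh hh' := HEq₂.of_eq <| by
    rw [inducedTransf_hom _ _ _ _ _ hf.1, inducedTransf_hom _ _ _ _ _ hf.1,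
      inducedTransf_hom _ _ _ _ _ hf.1, wl_add, brk_add_right, comp_add_left, comp_add_left]
    abel
  hom_smul_left U U' V V' c f h hf hh := HEq₂.of_eq <| by
    rw [inducedTransf_hom _ _ _ _ _ (Submodule.smul_mem _ c hf.1),
      inducedTransf_hom _ _ _ _ _ hf.1, wr_smul, brk_smul_left, comp_smul_right, comp_smul_right]
    module
  hom_smul_right U U' V V' c f h hf hh := HEq₂.of_eq <| by
    rw [inducedTransf_hom _ _ _ _ _ hf.1, inducedTransf_hom _ _ _ _ _ hf.1, wl_smul,
      brk_smul_right, comp_smul_left, comp_smul_left]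
    module
  natural _ _ _ _ _ _ hf hh := inducedTransf_natural hf hh
  natural_left _ _ _ _ _ _ hf hh := inducedTransf_natural_left hf hh
  natural_right _ _ _ _ _ _ hf hh := inducedTransf_natural_right hf hh
  hom_comp _ _ _ _ _ _ _ _ _ _ hf hf' hh hh' := inducedTransf_hom_comp hf hf' hh hh'

end Composition

end HLie
end

noncomputable section
namespace HLie

/-! ### Transport along associators and braidings. -/

section Transport

variable {K : Type u} [Field K] {g A B C D X Y Z X' Y' Z' U V W U' V' W' : GrVect K}
  {L : HomotopyLie g} {P : ShiftedPoisson L}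

/-- The intertwiner `F` corresponds to `F'` under the intertwiners `H` and `H'` of degree `0`. -/
def Transports (n : ℤ) (F : IFam g A B) (F' : IFam g C D) (H : IFam g A C) (H' : IFam g B D) :
    Prop := comp 0 n H' F = comp n 0 F' H

theorem Commuting.transports {n : ℤ} {F : IFam g A B} {F' : IFam g C D} {H : IFam g A C}
    {H' : IFam g B D} (h : Commuting n 0 F F' H H') : Transports n F F' H H' := by
  have h1 := h.comp_eq
  rwa [mul_zero, zpow_zero, one_smul] at h1

theorem Transports.comp {m n mn : ℤ} (hmn : mn = m + n) {F : IFam g Y Z} {F' : IFam g Y' Z'}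
    {G : IFam g X Y} {G' : IFam g X' Y'} {H₁ : IFam g X X'} {H₂ : IFam g Y Y'} {H₃ : IFam g Z Z'}
    (hF : Transports m F F' H₂ H₃) (hG : Transports n G G' H₁ H₂) :
    Transports mn (comp m n F G) (HLie.comp m n F' G') H₁ H₃ := by
  unfold Transports at *
  rw [← comp_assoc (mn := m) (np := mn) (by omega) (by omega), hF,
    comp_assoc (mn := m) (np := n) (by omega) (by omega), hG,
    comp_assoc (mn := mn) (np := n) (by omega) (by omega)]

theorem Transports.brk {m n mn m' n' : ℤ} (hmn : mn = m + n) (hm : m' = m + 1) (hn : n' = n + 1) {F : IFam g Y Z} {F' : IFam g Y' Z'}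
    {G : IFam g X Y} {G' : IFam g X' Y'} {H₁ : IFam g X X'} {H₂ : IFam g Y Y'} {H₃ : IFam g Z Z'}
    (hF : Commuting m' 0 F F' H₂ H₃) (hG : Commuting n' 0 G G' H₁ H₂) :
    Transports mn (brk P m n F G) (HLie.brk P m n F' G') H₁ H₃ := by
  subst hm hn
  exact brk_natural hmn hF hG

theorem Transports.neg {n : ℤ} {F : IFam g A B} {F' : IFam g C D} {H : IFam g A C}
    {H' : IFam g B D} (h : Transports n F F' H H') : Transports n (-F) (-F') H H' := by
  unfold Transports at *
  rw [comp_neg_left, comp_neg_right, h]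

theorem Transports.sub {n : ℤ} {F G : IFam g A B} {F' G' : IFam g C D} {H : IFam g A C}
    {H' : IFam g B D} (h : Transports n F F' H H') (h' : Transports n G G' H H') :
    Transports n (F - G) (F' - G') H H' := by
  unfold Transports at *
  rw [comp_sub_left, comp_sub_right, h, h']

theorem assoc_comp_assocInv : comp 0 0 (assoc g U V W) (assocInv g U V W) = one g _ := by
  rw [assoc, assocInv, strict_comp_strict, LinearEquiv.comp_symm]
  rfl

theorem assocInv_comp_assoc : comp 0 0 (assocInv g U V W) (assoc g U V W) = one g _ := by
  rw [assoc, assocInv, strict_comp_strict, LinearEquiv.symm_comp]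
  rfl

/-- Conjugates are never computed: any F' that corresponds to F under the associators is the
conjugate of F. The next three lemmas serve the same purpose. -/
theorem Transports.toRight_eq {n : ℤ} {F : IFam g ((U.tensor V).tensor W) ((U'.tensor V').tensor W')}
    {F' : IFam g (U.tensor (V.tensor W)) (U'.tensor (V'.tensor W'))}
    (h : Transports n F F' (assoc g U V W) (assoc g U' V' W')) : toRight n F = F' := by
  rw [toRight, ← comp_assoc (mn := n) (np := n) (by ring) (by ring), h,
    comp_assoc (mn := n) (np := 0) (by ring) (by ring), assoc_comp_assocInv, comp_one]

theorem Transports.toLeft_eq {n : ℤ} {F : IFam g ((U.tensor V).tensor W) ((U'.tensor V').tensor W')}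
    {F' : IFam g (U.tensor (V.tensor W)) (U'.tensor (V'.tensor W'))}
    (h : Transports n F F' (assoc g U V W) (assoc g U' V' W')) : toLeft n F' = F := by
  rw [toLeft, ← h, ← comp_assoc (mn := 0) (np := n) (by ring) (by ring), assocInv_comp_assoc,
    one_comp]

theorem Transports.conjRight_eq {n : ℤ}
    {F : IFam g (U.tensor (W.tensor V)) (U'.tensor (W'.tensor V'))}
    {F' : IFam g (U.tensor (V.tensor W)) (U'.tensor (V'.tensor W'))}
    (h : Transports n F F' (wl 0 U (braid g W V)) (wl 0 U' (braid g W' V'))) :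
    conjRight n F = F' := by
  change HLie.comp 0 n (wl 0 U' (braid g W' V')) (HLie.comp n 0 F (wl 0 U (braid g V W))) = F'
  rw [← comp_assoc (mn := n) (np := n) (by ring) (by ring), h,
    comp_assoc (mn := n) (np := 0) (by ring) (by ring), ← wl_comp (m := 0) (n := 0) (mn := 0) (by ring),
    braid_comp_braid, one,
    wl_strict, TensorProduct.map_id]
  exact comp_one F'

theorem Transports.conjLeft_eq {n : ℤ}
    {F : IFam g ((V.tensor U).tensor W) ((V'.tensor U').tensor W')}
    {F' : IFam g ((U.tensor V).tensor W) ((U'.tensor V').tensor W')}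
    (h : Transports n F F' (wr W (braid g V U)) (wr W' (braid g V' U'))) :
    conjLeft n F = F' := by
  rw [conjLeft, odot_one, odot_one, ← comp_assoc (mn := n) (np := n) (by ring) (by ring), h,
    comp_assoc (mn := n) (np := 0) (by ring) (by ring), ← wr_comp, braid_comp_braid, one,
    wr_strict, TensorProduct.map_id]
  exact comp_one F'

theorem Commuting.wl {m n : ℤ} {F : IFam g A B} {F' : IFam g C D}
    {H : IFam g A C} {H' : IFam g B D} (h : Commuting m n F F' H H') :
    Commuting m n (wl m W F) (HLie.wl m W F') (HLie.wl n W H) (HLie.wl n W H') := by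
  intro a b
  apply GrVect.tensor_hom_ext_left
  intro d y u
  have e := LinearMap.congr_fun (h a b) u
  rw [LinearMap.comp_apply, LinearMap.smul_apply, LinearMap.comp_apply] at e
  rw [LinearMap.comp_apply, LinearMap.smul_apply, LinearMap.comp_apply, wl_tmul _ _ _ y.2,
    wl_tmul _ _ _ y.2, map_smul, map_smul, wl_tmul _ _ _ y.2, wl_tmul _ _ _ y.2, e,
    TensorProduct.tmul_smul]
  module

theorem wr_wr_commuting_assoc (n : ℤ) (F : IFam g U U') :
    Commuting n 0 (wr W (wr V F)) (wr (V.tensor W) F) (assoc g U V W) (assoc g U' V W) := by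
  refine commuting_strict n fun a => ?_
  rw [wr_apply, wr_apply, wr_apply]
  ext u v w
  rfl

theorem wr_wl_commuting_assoc (n : ℤ) (F : IFam g V V') :
    Commuting n 0 (wr W (wl n U F)) (wl n U (wr W F)) (assoc g U V W) (assoc g U V' W) := by
  refine commuting_strict n fun a => ?_
  rw [wr_apply, wl_apply, wl_apply, wr_apply]
  ext u v w
  rfl

theorem wl_wl_commuting_assoc (n : ℤ) (F : IFam g W W') :
    Commuting n 0 (wl n (U.tensor V) F) (wl n U (wl n V F)) (assoc g U V W) (assoc g U V W') := by
  refine commuting_strict n fun a => ?_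
  apply TensorProduct.ext
  refine GrVect.tensor_hom_ext fun p u hu q v hv => ?_
  ext w
  change TensorProduct.assoc K U.carrier V.carrier W'.carrier
      ((wl n (U.tensor V) F).1 a ((u ⊗ₜ v) ⊗ₜ w)) =
    (wl n U (wl n V F)).1 a (u ⊗ₜ (v ⊗ₜ w))
  rw [wl_tmul _ _ _ (GrVect.tmul_mem U V rfl hu hv), wl_tmul _ _ _ hu, wl_tmul _ _ _ hv, map_smul,
    TensorProduct.tmul_smul, smul_smul, ← zpow_add₀ neg_one_ne_zero', ← mul_add]
  rfl

end Transport

/-! ### Hexagon relations for t_{U,V}. -/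

section Hexagons

variable {K : Type u} [Field K] {g : GrVect K} {L : HomotopyLie g} {P : ShiftedPoisson L}

theorem wr_commuting_wl_braid {U U' V W : GrVect K} {n : ℤ} {f : IFam g U U'}
    (hf : f ∈ Hom g U U' n) :
    Commuting n 0 (wr (W.tensor V) f) (wr (V.tensor W) f) (wl 0 U (braid g W V))
      (wl 0 U' (braid g W V)) := wr_wl_commuting hf (braid g W V)

theorem wl_commuting_wr_braid {U V W W' : GrVect K} {n : ℤ} (f : IFam g W W') :
    Commuting n 0 (wl n (V.tensor U) f) (wl n (U.tensor V) f) (wr W (braid g V U))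
      (wr W' (braid g V U)) := (wr_wl_commuting braid_mem f).symm

/-- The action on V ⊗ W is the sum of the actions on V and on W, and the bracket is additive in its
second argument. The summands are the whiskered t_{U,V} and t_{U,W}, up to reordering factors. -/
theorem inducedTransf_left_obj (U V W : HRep L) : (inducedTransf P).obj U (V.tensor W) =
    toRight 0 (odot 0 0 ((inducedTransf P).obj U V) (one g W.V)) +
      conjRight 0 (toRight 0 (odot 0 0 ((inducedTransf P).obj U W) (one g V.V))) := by
  have h1 : Transports 0 (brk P 0 0 (wr W.V (U.left V)) (wr W.V (U.right V)))
      (brk P 0 0 (wr (V.V.tensor W.V) U.rho) (wl 1 U.V (V.left W))) (assoc g _ _ _)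
      (assoc g _ _ _) :=
    .brk (by norm_num) (by norm_num) (by norm_num) (wr_wr_commuting_assoc 1 U.rho) (wr_wl_commuting_assoc 1 V.rho)
  have h2 : Transports 0 (brk P 0 0 (wr V.V (U.left W)) (wr V.V (U.right W)))
      (brk P 0 0 (wr (W.V.tensor V.V) U.rho) (wl 1 U.V (wr V.V W.rho))) (assoc g _ _ _)
      (assoc g _ _ _) :=
    .brk (by norm_num) (by norm_num) (by norm_num) (wr_wr_commuting_assoc 1 U.rho) (wr_wl_commuting_assoc 1 W.rho)
  have h3 : Transports 0 (brk P 0 0 (wr (W.V.tensor V.V) U.rho) (wl 1 U.V (wr V.V W.rho)))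
      (brk P 0 0 (wr (V.V.tensor W.V) U.rho) (wl 1 U.V (V.right W))) (wl 0 U.V (braid g W.V V.V))
      (wl 0 U.V (braid g W.V V.V)) :=
    .brk (by norm_num) (by norm_num) (by norm_num) (wr_commuting_wl_braid U.rho_mem)
      (wr_commuting_braid (W := V.V) W.rho_mem).wl
  rw [inducedTransf_obj, inducedTransf_obj, inducedTransf_obj, odot_one, odot_one, wr_brk, wr_brk,
    h1.toRight_eq, h2.toRight_eq, h3.conjRight_eq, ← brk_add_right, ← wl_add, ← V.tensor_rho W]
  rfl

/-- The same argument with additivity in the first argument of the bracket. -/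
theorem inducedTransf_right_obj (U V W : HRep L) : (inducedTransf P).obj (U.tensor V) W =
    toLeft 0 (odot 0 0 (one g U.V) ((inducedTransf P).obj V W)) +
      conjLeft 0 (toLeft 0 (odot 0 0 (one g V.V) ((inducedTransf P).obj U W))) := by
  have h1 : Transports 0 (brk P 0 0 (wr W.V (U.right V)) (wl 1 (U.V.tensor V.V) W.rho))
      (brk P 0 0 (wl 1 U.V (V.left W)) (wl 1 U.V (V.right W))) (assoc g _ _ _)
      (assoc g _ _ _) :=
    .brk (by norm_num) (by norm_num) (by norm_num) (wr_wl_commuting_assoc 1 V.rho) (wl_wl_commuting_assoc 1 W.rho)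
  have h2 : Transports 0 (brk P 0 0 (wr W.V (V.right U)) (wl 1 (V.V.tensor U.V) W.rho))
      (brk P 0 0 (wl 1 V.V (U.left W)) (wl 1 V.V (U.right W))) (assoc g _ _ _)
      (assoc g _ _ _) :=
    .brk (by norm_num) (by norm_num) (by norm_num) (wr_wl_commuting_assoc 1 U.rho) (wl_wl_commuting_assoc 1 W.rho)
  have h3 : Transports 0 (brk P 0 0 (wr W.V (V.right U)) (wl 1 (V.V.tensor U.V) W.rho))
      (brk P 0 0 (wr W.V (U.left V)) (wl 1 (U.V.tensor V.V) W.rho)) (wr W.V (braid g V.V U.V))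
      (wr W.V (braid g V.V U.V)) :=
    .brk (by norm_num) (by norm_num) (by norm_num) (wl_commuting_braid (W := V.V) U.rho_mem).wr (wl_commuting_wr_braid W.rho)
  have e : ∀ (X Y : HRep L), odot 0 0 (one g X.V) ((inducedTransf P).obj Y W) =
      brk P 0 0 (wl 1 X.V (Y.left W)) (wl 1 X.V (Y.right W)) := fun X Y => by
    rw [inducedTransf_obj]
    exact wl_brk (by norm_num) (by norm_num) (by norm_num) (Y.left_mem W) (Y.right_mem W)
  rw [e, e, h1.toLeft_eq, h2.toLeft_eq, h3.conjLeft_eq, ← brk_add_left, ← wr_add,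
    add_comm (U.right V), ← U.tensor_rho V, inducedTransf_obj]
  rfl

end Hexagons

end HLie
end

noncomputable section
namespace HLie

/-! ### The shape of t_{f,h} in abstract form. -/

section HomTerm

variable {K : Type u} [Field K] {g A B B' C C' D A' W : GrVect K} {L : HomotopyLie g}
  (P : ShiftedPoisson L)

/-- The intertwiner `-H {F, S} - {R, H} F`. -/
def homTerm (F : IFam g A B) (S : IFam g A A) (H : IFam g B C) (R : IFam g C C) : IFam g A C :=
  -comp 0 (-1) H (brk P (-1) 0 F S) - comp (-1) 0 (brk P 0 (-1) R H) F

variable {P}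

theorem wr_homTerm (F : IFam g A B) (S : IFam g A A) (H : IFam g B C) (R : IFam g C C) :
    wr W (homTerm P F S H R) = homTerm P (wr W F) (wr W S) (wr W H) (wr W R) := by
  rw [homTerm, homTerm, wr_sub, wr_neg, wr_comp, wr_comp, wr_brk, wr_brk]

theorem wl_homTerm {F : IFam g A B} {S : IFam g A A} {H : IFam g B C} {R : IFam g C C}
    (hF : F ∈ Hom g A B 0) (hS : S ∈ Hom g A A 1) (hH : H ∈ Hom g B C 0) (hR : R ∈ Hom g C C 1) :
    wl (-1) W (homTerm P F S H R) =
      homTerm P (wl 0 W F) (wl 1 W S) (wl 0 W H) (wl 1 W R) := by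
  rw [homTerm, homTerm, wl_sub, wl_neg, wl_comp (m := 0) (n := -1) (by norm_num),
    wl_comp (m := -1) (n := 0) (by norm_num),
    wl_brk (m' := 0) (n' := 1) (by norm_num) (by norm_num) (by norm_num) hF hS,
    wl_brk (m' := 1) (n' := 0) (by norm_num) (by norm_num) (by norm_num) hR hH]

theorem Transports.homTerm {F : IFam g A B} {S : IFam g A A} {H : IFam g B C} {R : IFam g C C}
    {F' : IFam g A' B'} {S' : IFam g A' A'} {H' : IFam g B' C'} {R' : IFam g C' C'}
    {HA : IFam g A A'} {HB : IFam g B B'} {HC : IFam g C C'} (hF : Commuting 0 0 F F' HA HB)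
    (hS : Commuting 1 0 S S' HA HA) (hH : Commuting 0 0 H H' HB HC)
    (hR : Commuting 1 0 R R' HC HC) :
    Transports (-1) (homTerm P F S H R) (HLie.homTerm P F' S' H' R') HA HC :=
  ((hH.transports.comp (by norm_num) 
    (.brk (by norm_num) (by norm_num) (by norm_num) hF hS)).neg).sub
    (Transports.comp (by norm_num) (.brk (by norm_num) (by norm_num) (by norm_num) hR hH)
      hF.transports)

/-- The left hexagon in abstract form. S₁ and S₂ are the actions on V and W, H₁ and H₂ are h and k
on their factors. The expression is additive in S and the bracket is a derivation in H; the square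
`h₂` changes the order of h and k. -/
theorem homTerm_add_comp {F : IFam g A B} {S₁ S₂ : IFam g A A} {H₁ : IFam g B C}
    {H₂' : IFam g B C'} {H₁' : IFam g C' D} {H₂ : IFam g C D} {R₁ : IFam g C C}
    {R₂ : IFam g C' C'} {R : IFam g D D} (h₁ : Commuting 0 1 H₂ H₂ R₁ R)
    (h₂ : Commuting 0 0 H₂' H₂ H₁ H₁') (hR : Commuting 1 0 R₂ R H₁' H₁') :
    homTerm P F (S₁ + S₂) (comp 0 0 H₂ H₁) R =
      comp 0 (-1) H₂ (homTerm P F S₁ H₁ R₁) + comp 0 (-1) H₁' (homTerm P F S₂ H₂' R₂) := by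
  have e : comp 0 (-1) H₁' (brk P 0 (-1) R₂ H₂') = comp (-1) 0 (brk P 0 (-1) R H₂) H₁ :=
    brk_natural (m := 0) (n := -1) (by norm_num) (by simpa using hR) (by simpa using h₂)
  have e' := congrArg (fun G => comp (-1) 0 G F) e
  have c := congrArg (fun G => comp 0 (-1) G (brk P (-1) 0 F S₂)) h₂.comp_eq_zero_left
  beta_reduce at c e'
  simp only [comp_assoc_simp, add_zero, zero_add, Int.reduceNeg] at c e'
  rw [homTerm, homTerm, homTerm, brk_comp_right h₁, brk_add_right]
  simp only [comp_assoc_simp, add_zero, zero_add, Int.reduceNeg, comp_add_left, comp_add_right,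
    comp_sub_right, comp_neg_right, c, e']
  abel

/-- The right hexagon in abstract form. R₁ + R₂ is the action on U' ⊗ V', and H F is f ⊙ h. -/
theorem homTerm_comp_add {F : IFam g A B} {H : IFam g B C} {H' : IFam g A B'} {F' : IFam g B' C}
    {G : IFam g C D} {S : IFam g A A} {S₁ : IFam g B B} {S₂ : IFam g B' B'} {R₁ R₂ : IFam g D D}
    (h₁ : Commuting 0 1 F F S S₁) (h₂ : Commuting 0 0 F F' H' H) (hS : Commuting 1 0 S S₂ H' H') :
    homTerm P (comp 0 0 H F) S G (R₁ + R₂) =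
      comp (-1) 0 (homTerm P H S₁ G R₂) F + comp (-1) 0 (homTerm P F' S₂ G R₁) H' := by
  have e : comp 0 (-1) H (brk P (-1) 0 F S) = comp (-1) 0 (brk P (-1) 0 F' S₂) H' :=
    brk_natural (m := -1) (n := 0) (by norm_num) (by simpa using h₂) (by simpa using hS)
  rw [homTerm, homTerm, homTerm, brk_comp_left h₁, brk_add_left, e]
  simp only [comp_assoc_simp, add_zero, zero_add, Int.reduceNeg, comp_add_left, comp_add_right,
    comp_sub_left, comp_neg_left, h₂.comp_eq_zero_left]
  abel

end HomTerm

/-! ### Hexagon relations for t_{f,h}. -/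

section Hexagons

variable {K : Type u} [Field K] {g : GrVect K} {L : HomotopyLie g} {P : ShiftedPoisson L}
  {U U' V V' W W' : HRep L}

theorem inducedTransf_hom_eq_homTerm {f : IFam g U.V U'.V} (h : IFam g V.V V'.V)
    (hf : f ∈ Hom g U.V U'.V 0) : (inducedTransf P).hom U U' V V' f h =
      homTerm P (wr V.V f) (wl 1 U.V V.rho) (wl 0 U'.V h) (wr V'.V U'.rho) :=
  inducedTransf_hom U U' V V' h hf

theorem inducedTransf_left_hom {f : IFam g U.V U'.V} {h : IFam g V.V V'.V} {k : IFam g W.V W'.V}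
    (hf : IsEquivariant U U' f) (hh : IsEquivariant V V' h) (hk : IsEquivariant W W' k) :
    (inducedTransf P).hom U U' (V.tensor W) (V'.tensor W') f (odot 0 0 h k) =
      toRight (-1) (odot (-1) 0 ((inducedTransf P).hom U U' V V' f h) k) +
        conjRight (-1) (toRight (-1) (odot (-1) 0 ((inducedTransf P).hom U U' W W' f k) h)) := by
  have h1 := (wl_wl_commuting_assoc (U := U'.V) (V := V'.V) 0 k).transports.comp (mn := -1)
    (by norm_num) (Transports.homTerm (P := P)
      (wr_wr_commuting_assoc (V := V.V) (W := W.V) 0 f)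
      (wr_wl_commuting_assoc (U := U.V) (W := W.V) 1 V.rho)
      (wr_wl_commuting_assoc (U := U'.V) (W := W.V) 0 h)
      (wr_wr_commuting_assoc (V := V'.V) (W := W.V) 1 U'.rho))
  have h2 := (wl_wl_commuting_assoc (U := U'.V) (V := W'.V) 0 h).transports.comp (mn := -1)
    (by norm_num) (Transports.homTerm (P := P)
      (wr_wr_commuting_assoc (V := W.V) (W := V.V) 0 f)
      (wr_wl_commuting_assoc (U := U.V) (W := V.V) 1 W.rho)
      (wr_wl_commuting_assoc (U := U'.V) (W := V.V) 0 k)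
      (wr_wr_commuting_assoc (V := W'.V) (W := V.V) 1 U'.rho))
  have h3 := (wl_commuting_braid (W := W'.V) hh.1).wl (W := U'.V) |>.transports.comp (mn := -1)
    (by norm_num) (Transports.homTerm (P := P)
      (wr_commuting_wl_braid (V := V.V) (W := W.V) hf.1)
      ((wr_commuting_braid (W := V.V) W.rho_mem).wl (W := U.V))
      ((wr_commuting_braid (W := V.V) hk.1).wl (W := U'.V))
      (wr_commuting_wl_braid (V := V.V) (W := W'.V) U'.rho_mem))
  rw [odot_eq_comp_swap (m := -1) (by norm_num) (inducedTransf_hom_mem hf.1 hh.1),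
    odot_eq_comp_swap (m := -1) (by norm_num) (inducedTransf_hom_mem hf.1 hk.1),
    inducedTransf_hom_eq_homTerm _ hf.1, inducedTransf_hom_eq_homTerm _ hf.1,
    inducedTransf_hom_eq_homTerm _ hf.1, wr_homTerm, wr_homTerm, h1.toRight_eq, h2.toRight_eq,
    h3.conjRight_eq, V.tensor_rho W, wl_add, odot_eq_comp_swap (by norm_num) hh.1,
    wl_comp (by norm_num)]
  exact homTerm_add_comp (wr_wl_commuting U'.rho_mem _).symm
    ((wr_wl_commuting hh.1 k).symm.wl) (wr_wl_commuting U'.rho_mem _)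

theorem inducedTransf_right_hom {f : IFam g U.V U'.V} {h : IFam g V.V V'.V} {k : IFam g W.V W'.V}
    (hf : IsEquivariant U U' f) (hh : IsEquivariant V V' h) (hk : IsEquivariant W W' k) :
    (inducedTransf P).hom (U.tensor V) (U'.tensor V') W W' (odot 0 0 f h) k =
      toLeft (-1) (odot 0 (-1) f ((inducedTransf P).hom V V' W W' h k)) +
        conjLeft (-1) (toLeft (-1) (odot 0 (-1) h ((inducedTransf P).hom U U' W W' f k))) := by
  have hm : odot 0 0 f h ∈ Hom g (U.V.tensor V.V) (U'.V.tensor V'.V) 0 := by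
    rw [odot_eq_comp_swap (by norm_num) hf.1]
    exact comp_mem (by norm_num) (wl_mem hh.1) (wr_mem hf.1)
  have h1 := (Transports.homTerm (P := P)
      (wr_wl_commuting_assoc (U := U'.V) (W := W.V) 0 h)
      (wl_wl_commuting_assoc (U := U'.V) (V := V.V) 1 W.rho)
      (wl_wl_commuting_assoc (U := U'.V) (V := V'.V) 0 k)
      (wr_wl_commuting_assoc (U := U'.V) (W := W'.V) 1 V'.rho)).comp (mn := -1) (by norm_num)
    (wr_wr_commuting_assoc (V := V.V) (W := W.V) 0 f).transports
  have h2 := (Transports.homTerm (P := P)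
      (wr_wl_commuting_assoc (U := V'.V) (W := W.V) 0 f)
      (wl_wl_commuting_assoc (U := V'.V) (V := U.V) 1 W.rho)
      (wl_wl_commuting_assoc (U := V'.V) (V := U'.V) 0 k)
      (wr_wl_commuting_assoc (U := V'.V) (W := W'.V) 1 U'.rho)).comp (mn := -1) (by norm_num)
    (wr_wr_commuting_assoc (V := U.V) (W := W.V) 0 h).transports
  have h3 := (Transports.homTerm (P := P)
      ((wl_commuting_braid (W := V'.V) hf.1).wr (W := W.V))
      (wl_commuting_wr_braid (U := U.V) (V := V'.V) W.rho)
      (wl_commuting_wr_braid (U := U'.V) (V := V'.V) k)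
      ((wl_commuting_braid (W := V'.V) U'.rho_mem).wr (W := W'.V))).comp (mn := -1) (by norm_num)
    ((wr_commuting_braid (W := U.V) hh.1).wr (W := W.V)).transports
  rw [odot_eq_comp_swap (n := -1) (by norm_num) hf.1,
    odot_eq_comp_swap (n := -1) (by norm_num) hh.1,
    inducedTransf_hom_eq_homTerm _ hf.1, inducedTransf_hom_eq_homTerm _ hh.1,
    inducedTransf_hom_eq_homTerm _ hm,
    wl_homTerm (wr_mem hf.1) (wl_mem W.rho_mem) (wl_mem hk.1) (wr_mem U'.rho_mem),
    wl_homTerm (wr_mem hh.1) (wl_mem W.rho_mem) (wl_mem hk.1) (wr_mem V'.rho_mem),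
    h1.toLeft_eq, h2.toLeft_eq, h3.conjLeft_eq, U'.tensor_rho V', wr_add,
    odot_eq_comp_swap (by norm_num) hf.1, wr_comp]
  exact homTerm_comp_add (wr_wl_commuting (wr_mem hf.1) W.rho)
    ((wr_wl_commuting hf.1 h).wr) (wr_wl_commuting (wl_mem hh.1) W.rho).symm

end Hexagons

end HLie
end

noncomputable section
namespace HLie

/-! ### Behaviour of t under the braiding. -/

section Equivariance

variable {K : Type u} [Field K] {g : GrVect K} {L : HomotopyLie g} {P : ShiftedPoisson L}
  {U U' V V' W : HRep L}

theorem transports_obj : Transports 0 (brk P 0 0 (U.left V) (U.right V))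
    (brk P 0 0 (V.right U) (V.left U)) (braid g U.V V.V) (braid g U.V V.V) :=
  .brk (by norm_num) (by norm_num) (by norm_num) (wr_commuting_braid (W := V.V) U.rho_mem)
    (wl_commuting_braid (W := U.V) V.rho_mem)

theorem brk_right_left : brk P 0 0 (V.right U) (V.left U) = brk P 0 0 (V.left U) (V.right U) := by
  rw [brk_swap (by norm_num) (by norm_num) (V.left_right U), mul_zero, zpow_zero, one_smul]

theorem pdiff_braid : pdiff L (U.tensor V).rho (V.tensor U).rho 0 (braid g U.V V.V) = 0 := by
  have h1 : comp 0 1 (braid g U.V V.V) (U.left V) = comp 1 0 (V.right U) (braid g U.V V.V) :=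
    (wr_commuting_braid (W := V.V) U.rho_mem).transports
  have h2 : comp 0 1 (braid g U.V V.V) (U.right V) = comp 1 0 (V.left U) (braid g U.V V.V) :=
    (wl_commuting_braid (W := U.V) V.rho_mem).transports
  have h3 : varrho (braid g U.V V.V) = 0 := varrho_strict _
  rw [pdiff, h3, comp_zero_left, U.tensor_rho V, V.tensor_rho U, comp_add_left, comp_add_right,
    h1, h2, zpow_zero, one_smul, sub_zero]
  abel

theorem isGammaEquivariant_inducedTransf (P : ShiftedPoisson L) :
    IsGammaEquivariant (inducedTransf P) where
  obj U V := by
    rw [inducedTransf_obj, inducedTransf_obj, ← brk_right_left (U := U) (V := V)]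
    exact transports_obj
  hom U U' V V' f h hf hh := by
    have e3 : pdiff L (V.tensor U').rho (V'.tensor U').rho 0 (wr U'.V h) = 0 :=
      (pdiff_wr hh.1).trans (by rw [← diff_eq_pdiff, hh.2, wr_zero])
    have e4 : pdiff L (V.tensor U).rho (V.tensor U').rho 0 (wl 0 V.V f) = 0 :=
      (pdiff_wl (n' := 1) (by norm_num) hf.1 V.rho_mem).trans
        (by rw [← diff_eq_pdiff, hf.2, wl_zero])
    have key := pdiff_brk_of_closed (P := P) (V.tensor_rho U) (V.tensor_rho U') (V'.tensor_rho U')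
      (wr_mem hh.1).2 (wl_mem hf.1).2 (wr_wl_commuting hh.1 f) (wr_commuting_right hh.1)
      (wl_commuting_left f) e3 e4
    have h1 : comp 0 (-1) (braid g U'.V V'.V) ((inducedTransf P).hom U U' V V' f h) =
        comp (-1) 0 (homTerm P (wl 0 V.V f) (V.left U) (wr U'.V h) (V'.right U'))
          (braid g U.V V.V) := by
      rw [inducedTransf_hom_eq_homTerm _ hf.1]
      exact Transports.homTerm (wr_commuting_braid (W := V.V) hf.1)
        (wl_commuting_braid (W := U.V) V.rho_mem) (wl_commuting_braid (W := U'.V) hh.1)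
        (wr_commuting_braid (W := V'.V) U'.rho_mem)
    have s1 := brk_swap (P := P) (m := -1) (n := 0) (m' := 0) (n' := 1) (by norm_num) (by norm_num)
      (wl_commuting_left (U := V) f)
    have s2 := brk_swap (P := P) (m := -1) (n := 0) (m' := 0) (n' := 1) (by norm_num) (by norm_num)
      (wr_commuting_right (V := U') hh.1)
    rw [mul_zero, zpow_zero, one_smul] at s1 s2
    -- Conjugation with γ turns t_{f,h} into an expression that applies f and h in the order
    -- opposite to t_{h,f}. After `s1` and `s2`, the difference is the differential of {h ⊙ 1, 1 ⊙
    -- f} given by `key`.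
    refine ⟨comp (-2) 0 (brk P (-1) (-1) (wr U'.V h) (wl 0 V.V f)) (braid g U.V V.V), ?_, ?_⟩
    · exact comp_mem (by norm_num) (brk_mem (by norm_num) (by norm_num) (by norm_num)
        (wr_mem hh.1) (wl_mem hf.1)) braid_mem
    rw [h1, inducedTransf_hom _ _ _ _ _ hh.1, diff_eq_pdiff,
      pdiff_comp (rV := (V.tensor U).rho) (m' := -1) (n' := 1) (by norm_num) (by norm_num)
        (by norm_num), pdiff_braid, comp_zero_right, smul_zero, add_zero, key, homTerm, s1, s2,
      ← comp_sub_left]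
    congr 1
    abel

/-- Both γ and the identity have zero derivative, so the two brackets in t vanish without any
homotopy. -/
theorem isTotallyGammaEquivariant_inducedTransf (P : ShiftedPoisson L) :
    IsTotallyGammaEquivariant (inducedTransf P) := fun U V W => HEq₂.of_eq <| by
  rw [inducedTransf_hom _ _ _ _ _ braid_mem, braid, one, wr_strict, wl_strict, brk_strict_left,
    brk_strict_right, comp_zero_left, comp_zero_right, neg_zero, sub_zero]

end Equivariance

/-! ### Coherence. -/

section Coherence

variable {K : Type u} [Field K] {g : GrVect K} {L : HomotopyLie g} {P : ShiftedPoisson L}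
  {U U' V V' W : HRep L}

theorem wr_one {A B : GrVect K} : wr B (one g A) = one g (A.tensor B) := by
  rw [one, wr_strict, TensorProduct.map_id]
  rfl

theorem wl_one {A B : GrVect K} : wl 0 B (one g A) = one g (B.tensor A) := by
  rw [one, wl_strict, TensorProduct.map_id]
  rfl

theorem brk_one_left {A B : GrVect K} (m n : ℤ) (G : IFam g A B) : brk P m n (one g B) G = 0 :=
  brk_strict_left m n _ G

theorem brk_one_right {A B : GrVect K} (m n : ℤ) (F : IFam g A B) : brk P m n F (one g A) = 0 :=
  brk_strict_right m n F _

theorem inducedTransf_hom_one {f : IFam g U.V U'.V} (hf : f ∈ Hom g U.V U'.V 0) :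
    (inducedTransf P).hom U U' V V f (one g V.V) = -brk P (-1) 0 (wr V.V f) (U.right V) := by
  rw [inducedTransf_hom _ _ _ _ _ hf, wl_one, brk_one_right, comp_zero_left, sub_zero, one_comp]

theorem inducedTransf_one_hom (h : IFam g V.V V'.V) :
    (inducedTransf P).hom U U V V' (one g U.V) h = -brk P 0 (-1) (U.left V') (wl 0 U.V h) := by
  rw [inducedTransf_hom _ _ _ _ _ one_mem, wr_one, brk_one_left, comp_zero_right, neg_zero,
    zero_sub, comp_one]

/-- Composition with a map without inputs involves a single shuffle, so here the identity of
composites is already componentwise. This allows a transported bracket to be an argument of a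
further bracket. -/
theorem commuting_of_transports {A B C D : GrVect K} {n : ℤ} {F : IFam g A B} {F' : IFam g C D}
    {φ : A.carrier →ₗ[K] C.carrier} {φ' : B.carrier →ₗ[K] D.carrier}
    (h : Transports n F F' (strict φ) (strict φ')) : Commuting n 0 F F' (strict φ) (strict φ') := by
  refine commuting_strict n fun a => ?_
  have e := congrArg (fun G => G.1 a) h
  beta_reduce at e
  rwa [strict_comp_apply, comp_strict_apply] at e

theorem commuting_assoc_of_transports {A B C A' B' C' : GrVect K} {n : ℤ}
    {F : IFam g ((A.tensor B).tensor C) ((A'.tensor B').tensor C')}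
    {F' : IFam g (A.tensor (B.tensor C)) (A'.tensor (B'.tensor C'))}
    (h : Transports n F F' (assoc g A B C) (assoc g A' B' C')) :
    Commuting n 0 F F' (assoc g A B C) (assoc g A' B' C') := commuting_of_transports h

theorem commuting_wl_braid_of_transports {A B C A' B' C' : GrVect K} {n : ℤ}
    {F : IFam g (A.tensor (B.tensor C)) (A'.tensor (B'.tensor C'))}
    {F' : IFam g (A.tensor (C.tensor B)) (A'.tensor (C'.tensor B'))}
    (h : Transports n F F' (wl 0 A (braid g B C)) (wl 0 A' (braid g B' C'))) :
    Commuting n 0 F F' (wl 0 A (braid g B C)) (wl 0 A' (braid g B' C')) := by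
  rw [braid, wl_strict, braid, wl_strict] at h ⊢
  exact commuting_of_transports h

/-- On U ⊗ (V ⊗ W), t_{t_{U,V},1_W} becomes the nested bracket -{{A, B}, C} of the three actions. -/
theorem wr_brk_left_right_transports (U V W : HRep L) :
    Transports (-1) (-brk P (-1) 0 (wr W.V (brk P 0 0 (U.left V) (U.right V)))
        ((U.tensor V).right W))
      (-brk P (-1) 0 (brk P 0 0 (U.left (V.tensor W)) (wl 1 U.V (V.left W)))
        (wl 1 U.V (V.right W))) (assoc g U.V V.V W.V) (assoc g U.V V.V W.V) := by
  have h : Transports 0 (wr W.V (brk P 0 0 (U.left V) (U.right V)))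
      (brk P 0 0 (U.left (V.tensor W)) (wl 1 U.V (V.left W))) (assoc g U.V V.V W.V)
      (assoc g U.V V.V W.V) := by
    rw [wr_brk]
    exact .brk (by norm_num) (by norm_num) (by norm_num) (wr_wr_commuting_assoc 1 U.rho) (wr_wl_commuting_assoc 1 V.rho)
  have h' := commuting_assoc_of_transports h
  exact (Transports.brk (m := -1) (n := 0) (by norm_num) (by norm_num) (by norm_num) h' (wl_wl_commuting_assoc 1 W.rho)).neg

theorem wl_comp_wl_eq {A B : GrVect K} {F : IFam g A A} (hF : F ∈ Hom g A A 1)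
    (e : comp 1 1 F F = comp 0 2 (varrho F) (ellAt L A)) :
    comp 1 1 (wl 1 B F) (wl 1 B F) = comp 0 2 (varrho (wl 1 B F)) (ellAt L (B.tensor A)) := by
  rw [wl_comp_ellAt (n' := 2) (by norm_num) (by norm_num) hF, ← e, wl_comp (by norm_num)]

theorem isCoherent_inducedTransf (P : ShiftedPoisson L) : IsCoherent (inducedTransf P) := by
  intro U V W
  have hB : wl 1 U.V (V.left W) ∈ Hom g _ _ 1 := wl_mem (V.left_mem W)
  have hC : wl 1 U.V (V.right W) ∈ Hom g _ _ 1 := wl_mem (V.right_mem W)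
  have hr : (U.tensor (V.tensor W)).rho =
      U.left (V.tensor W) + wl 1 U.V (V.left W) + wl 1 U.V (V.right W) := by
    rw [add_assoc, ← wl_add, ← V.tensor_rho W]
    exact U.tensor_rho _
  have jacobi := brk_jacobi_eq_pdiff (P := P) hr (wr_wl_commuting U.rho_mem _)
    (wr_wl_commuting U.rho_mem _) (V.left_right W).wl (U.left_left _)
    (wl_comp_wl_eq (V.left_mem W) (V.left_left W)) (wl_comp_wl_eq (V.right_mem W) (V.right_right W))
    (U.left_mem _).2 hB.2 hC.2
  -- Conjugating with the braiding of V and W exchanges the roles of their actions, so that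
  -- t_{t_{U,W},1_V} becomes -{{A, C}, B}.
  have h3 : Transports (-1) (-brk P (-1) 0 (brk P 0 0 (U.left (W.tensor V)) (wl 1 U.V (W.left V)))
        (wl 1 U.V (W.right V)))
      (-brk P (-1) 0 (brk P 0 0 (U.left (V.tensor W)) (wl 1 U.V (V.right W)))
        (wl 1 U.V (V.left W))) (wl 0 U.V (braid g W.V V.V)) (wl 0 U.V (braid g W.V V.V)) := by
    have h : Transports 0 (brk P 0 0 (U.left (W.tensor V)) (wl 1 U.V (W.left V)))
        (brk P 0 0 (U.left (V.tensor W)) (wl 1 U.V (V.right W))) (wl 0 U.V (braid g W.V V.V))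
        (wl 0 U.V (braid g W.V V.V)) :=
      .brk (by norm_num) (by norm_num) (by norm_num) (wr_commuting_wl_braid U.rho_mem)
        (wr_commuting_braid (W := V.V) W.rho_mem).wl
    exact (Transports.brk (by norm_num) (by norm_num) (by norm_num)
      (commuting_wl_braid_of_transports h) (wl_commuting_braid (W := W.V) V.rho_mem).wl).neg
  -- The homotopy of the Jacobi identity. Its sign is negative because all three terms of the
  -- coherence relation are minus the corresponding nested brackets.
  refine ⟨-comp 0 (-2) (derivThree (U.left (V.tensor W)) (wl 1 U.V (V.left W))
    (wl 1 U.V (V.right W))) (tri P (U.V.tensor (V.V.tensor W.V))), ?_, ?_⟩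
  · exact Submodule.neg_mem _ (comp_mem (by norm_num) (derivThree_mem (U.left_mem _) hB hC)
      (tri_mem P))
  rw [diff_eq_pdiff, pdiff_neg, sub_zero]
  refine Eq.trans ?_ (congrArg Neg.neg jacobi)
  rw [inducedTransf_hom_one inducedTransf_obj_mem, inducedTransf_hom_one inducedTransf_obj_mem,
    inducedTransf_one_hom, inducedTransf_obj, inducedTransf_obj, inducedTransf_obj, 
    (wr_brk_left_right_transports U V W).toRight_eq,
    (wr_brk_left_right_transports U W V).toRight_eq, h3.conjRight_eq, wl_brk (m' := 1) (n' := 1) (by norm_num) (by norm_num)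
      (by norm_num) (V.left_mem W) (V.right_mem W)]
  abel

end Coherence

theorem isInfinitesimal2Braiding_inducedTransf {K : Type u} [Field K] {g : GrVect K}
    {L : HomotopyLie g} (P : ShiftedPoisson L) : IsInfinitesimal2Braiding (inducedTransf P) where
  toIsPseudonatural := isPseudonatural_inducedTransf P
  left_obj := inducedTransf_left_obj
  left_hom _ _ _ _ _ _ _ _ _ hf hh hk := .of_eq (inducedTransf_left_hom hf hh hk)
  right_obj := inducedTransf_right_obj
  right_hom _ _ _ _ _ _ _ _ _ hf hh hk := .of_eq (inducedTransf_right_hom hf hh hk)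

end HLie
end

theorem theorem3 {K : Type u} [Field K] [CharZero K] {g : HLie.GrVect K}
    (L : HLie.HomotopyLie g) (P : HLie.ShiftedPoisson L) :
    HLie.IsInfinitesimal2Braiding (HLie.inducedTransf P) ∧
      HLie.IsGammaEquivariant (HLie.inducedTransf P) ∧
      HLie.IsTotallyGammaEquivariant (HLie.inducedTransf P) ∧
      HLie.IsCoherent (HLie.inducedTransf P) :=
  ⟨HLie.isInfinitesimal2Braiding_inducedTransf P, HLie.isGammaEquivariant_inducedTransf P,
    HLie.isTotallyGammaEquivariant_inducedTransf P, HLie.isCoherent_inducedTransf P⟩
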